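/- **Theorem 2.1.** Let $n\ge 1$, $p>1$, and let $u\in C^6(\mathbb R^n)$ be a (classical, possibly sign-changing) solution of $$(-\Delta)^3u=|u|^{p-1}u\quad\text{in }\mathbb R^n .$$ Put $k=\frac{6}{p-1}$ and $$\begin{aligned} \delta_1&=2(n-1)-4k,\qquad \delta_2=6k(1+k)-6(n-1)k+(n-1)(n-3),\\ \delta_3&=-4k(1+k)(2+k)+6(n-1)k(1+k)-(n-1)(n-3)(1+2k),\\ \delta_4&=k(1+k)(2+k)(3+k)-2(n-1)k(1+k)(2+k)+(n-1)(n-3)k(2+k),\\ \alpha&=n-3-2k,\qquad \beta=k(4+k-n). \end{aligned}$$ Fix $x\in\mathbb R^n$. For $\lambda>0$ let $B_\lambda=\{y:|y-x|<\lambda\}$, $r=|y-x|$, $\partial_r f(y)=\nabla f(y)\cdot\frac{y-x}{r}$, and write $$\begin{aligned} T_1&=ku+\lambda\partial_ru,\qquad T_2=k(k-1)u+2k\lambda\partial_ru+\lambda^2\partial_{rr}u,\\ T_3&=k(k-1)(k-2)u+3k(k-1)\lambda\partial_ru+3k\lambda^2\partial_{rr}u+\lambda^3\partial_{rrr}u,\\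 T_4&=k(k-1)(k-2)(k-3)u+4k(k-1)(k-2)\lambda\partial_ru+6k(k-1)\lambda^2\partial_{rr}u+4k\lambda^3\partial_{rrr}u+\lambda^4\partial_{rrrr}u,\\ G&=\lambda^2\Delta u-\lambda^2\partial_{rr}u-(n-1)\lambda\partial_ru,\qquad |\nabla^{\tan}f|^2=|\nabla f|^2-|\partial_rf|^2 . \end{aligned}$$ Let $e=6\frac{p+1}{p-1}-n$ (so that $e-5=2k+1-n$) and $$\begin{aligned} E(\lambda,x,u)={}&\lambda^{e}\Big(\int_{B_\lambda}\tfrac12|\nabla\Delta u|^2-\tfrac1{p+1}\int_{B_\lambda}|u|^{p+1}\Big) -\int_{\partial B_\lambda}\lambda^{e-5}T_4T_1+2\int_{\partial B_\lambda}\lambda^{e-5}T_3T_2\\ &-(\delta_1-6)\int_{\partial B_\lambda}\lambda^{e-5}T_3T_1+\tfrac12(k+2)\lambda^{e-1}\int_{\partial B_\lambda}(\Delta u)^2 -(24-6\delta_1+\delta_2)\int_{\partial B_\lambda}\lambda^{e-5}T_2T_1\\ &-(9\delta_1-3\delta_2-36)\int_{\partial B_\lambda}\lambda^{e-5}T_1^2+(\delta_1-8)\int_{\partial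 B_\lambda}\lambda^{e-5}T_2^2 +\delta_4\int_{\partial B_\lambda}\lambda^{e-5}T_1u+2\delta_4\int_{\partial B_\lambda}\lambda^{e-5}u^2\\ &+2\int_{\partial B_\lambda}\lambda^{e-5}G^2+\tfrac12\int_{\partial B_\lambda}\lambda^{2-n}\frac{d}{d\lambda}\big[\lambda^{2k}G^2\big]\\ &-4(\beta-n+4)\int_{\partial B_\lambda}\lambda^{e-5}\lambda^2|\nabla^{\tan}u|^2-(\beta-n+4)\int_{\partial B_\lambda}\lambda^{2-n}\frac{d}{d\lambda}\big[\lambda^{2k}\lambda^2|\nabla^{\tan}u|^2\big]\\ &-6\int_{\partial B_\lambda}\lambda^{e-5}\lambda^2|\nabla^{\tan}T_1|^2+\int_{\partial B_\lambda}\lambda^{4-n}\frac{d}{d\lambda}\big[\lambda^{2k}|\nabla^{\tan}T_1|^2\big]. \end{aligned}$$ Here $\lambda$ is held constant inside $\nabla^{\tan}T_1$, and $\frac{d}{d\lambda}[\cdots]$ at $y=x+\lambda\theta\in\partial B_\lambda$ is the derivative in $\lambda$, with $\theta$ fixed, of the bracket evaluated at $x+\lambda\theta$; surface integrals are with respect to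 surface measure. Let $u^\lambda(y)=\lambda^{k}u(x+\lambda y)$, let $\partial B_1$ on the right-hand side below be the unit sphere centred at the origin, and let $\nabla_\theta$, $\mathbf{div}_\theta$ be the gradient and divergence on it. Then $E(\cdot,x,u)$ is differentiable on $(0,\infty)$, and for every $\lambda>0$ $$\begin{aligned} \frac{dE(\lambda,x,u)}{d\lambda}={}&\int_{\partial B_1}\Big(2\lambda^5\Big(\frac{d^3u^\lambda}{d\lambda^3}\Big)^2+(10\delta_1-2\delta_2-56)\lambda^3\Big(\frac{d^2u^\lambda}{d\lambda^2}\Big)^2\\ &\qquad+(-18\delta_1+6\delta_2-4\delta_3+2\delta_4+72)\lambda\Big(\frac{du^\lambda}{d\lambda}\Big)^2\Big)\\ &+\int_{\partial B_1}\Big(4\lambda^3\Big|\frac{d^2}{d\lambda^2}\nabla_\theta u^\lambda\Big|^2+(8\alpha-4\beta+4n-28)\lambda\Big|\frac{d}{d\lambda}\nabla_\theta u^\lambda\Big|^2\Big)\\ &+2\lambda\int_{\partial B_1}\Big[\frac{d}{d\lambda}\mathbf{div}_\theta(\nabla_\theta u^\lambda)\Big]^2+\lambda\int_{\partial B_1}\Big(\frac{d\,\Delta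 u^\lambda}{d\lambda}\Big)^2 . \end{aligned}$$ -/

import Mathlib

open MeasureTheory
open scoped Laplacian Gradient

noncomputable section

namespace Triharmonic

/-- `ℝⁿ` with its Euclidean norm. -/
abbrev Space (n : ℕ) : Type := EuclideanSpace ℝ (Fin n)

/-- The scaling exponent `6 / (p - 1)`. -/
def kappa (p : ℝ) : ℝ := 6 / (p - 1)

def delta1 (n : ℕ) (p : ℝ) : ℝ := 2 * ((n : ℝ) - 1) - 4 * kappa p

def delta2 (n : ℕ) (p : ℝ) : ℝ :=
  6 * kappa p * (1 + kappa p) - 6 * ((n : ℝ) - 1) * kappa p + ((n : ℝ) - 1) * ((n : ℝ) - 3)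

def delta3 (n : ℕ) (p : ℝ) : ℝ :=
  -4 * kappa p * (1 + kappa p) * (2 + kappa p) + 6 * ((n : ℝ) - 1) * kappa p * (1 + kappa p)
    - ((n : ℝ) - 1) * ((n : ℝ) - 3) * (1 + 2 * kappa p)

def delta4 (n : ℕ) (p : ℝ) : ℝ :=
  kappa p * (1 + kappa p) * (2 + kappa p) * (3 + kappa p)
    - 2 * ((n : ℝ) - 1) * kappa p * (1 + kappa p) * (2 + kappa p)
    + ((n : ℝ) - 1) * ((n : ℝ) - 3) * kappa p * (2 + kappa p)

def alpha (n : ℕ) (p : ℝ) : ℝ := (n : ℝ) - 3 - 2 * kappa p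

def beta (n : ℕ) (p : ℝ) : ℝ := kappa p * (4 + kappa p - (n : ℝ))

variable {n : ℕ}

/-- The operator `-Δ`. -/
def negLaplacian (u : Space n → ℝ) : Space n → ℝ := fun y => -(Δ u) y

/-- `u` is a classical solution of `(-Δ)³ u = |u|^(p-1) u` in `ℝⁿ`. -/
structure IsSolution (p : ℝ) (u : Space n → ℝ) : Prop where
  contDiff : ContDiff ℝ 6 u
  equation : ∀ y, (negLaplacian^[3] u) y = |u y| ^ (p - 1) * u y

/-- The radial derivative `∂_r u (y) = ∇u(y) · (y - x) / |y - x|` with respect to the centre `x`. -/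
def radialDeriv (x : Space n) (u : Space n → ℝ) (y : Space n) : ℝ :=
  inner ℝ (∇ u y) (‖y - x‖⁻¹ • (y - x))

/-- Integration over the unit sphere `∂B₁` against surface measure. -/
def unitSphereIntegral (f : Space n → ℝ) : ℝ :=
  ∫ θ : Metric.sphere (0 : Space n) 1, f (θ : Space n) ∂((volume : Measure (Space n)).toSphere)

/-- Integration over the sphere `∂B_r(x)` against surface measure (`1 ≤ n`, `0 < r`). -/
def sphereIntegral (x : Space n) (r : ℝ) (f : Space n → ℝ) : ℝ :=
  r ^ (n - 1) * unitSphereIntegral fun θ => f (x + r • θ)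

/-- The extension of a function on the unit sphere that is constant along rays from the origin;
it depends on the values of `F` on the unit sphere only (off the origin). -/
def rayExtension {G : Type*} (F : Space n → G) : Space n → G := fun y => F (‖y‖⁻¹ • y)

/-- The gradient on the unit sphere of the restriction of `f` to it, as a vector of `ℝⁿ` tangent
to the sphere. -/
def angularGradient (f : Space n → ℝ) (θ : Space n) : Space n := ∇ (rayExtension f) θ

/-- The divergence on the unit sphere of a tangent vector field. -/
def angularDiv (X : Space n → Space n) (θ : Space n) : ℝ :=
  LinearMap.trace ℝ (Space n) (fderiv ℝ (rayExtension X) θ : Space n →ₗ[ℝ] Space n)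

/-- The rescaling `u^lam` about the point `x`. -/
def rescale (p : ℝ) (x : Space n) (u : Space n → ℝ) (lam : ℝ) : Space n → ℝ :=
  fun y => lam ^ kappa p * u (x + lam • y)

/-- `κ u + lam ∂_r u`, where `κ = 6 / (p - 1)`. -/
def T1 (p : ℝ) (x : Space n) (u : Space n → ℝ) (lam : ℝ) (y : Space n) : ℝ :=
  kappa p * u y + lam * radialDeriv x u y

/-- `κ(κ-1) u + 2κ lam ∂_r u + lam² ∂_rr u`. -/
def T2 (p : ℝ) (x : Space n) (u : Space n → ℝ) (lam : ℝ) (y : Space n) : ℝ :=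
  kappa p * (kappa p - 1) * u y + 2 * kappa p * lam * radialDeriv x u y
    + lam ^ 2 * ((radialDeriv x)^[2] u) y

/-- `κ(κ-1)(κ-2) u + 3κ(κ-1) lam ∂_r u + 3κ lam² ∂_rr u + lam³ ∂_rrr u`. -/
def T3 (p : ℝ) (x : Space n) (u : Space n → ℝ) (lam : ℝ) (y : Space n) : ℝ :=
  kappa p * (kappa p - 1) * (kappa p - 2) * u y
    + 3 * kappa p * (kappa p - 1) * lam * radialDeriv x u y
    + 3 * kappa p * lam ^ 2 * ((radialDeriv x)^[2] u) y
    + lam ^ 3 * ((radialDeriv x)^[3] u) y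

/-- `κ(κ-1)(κ-2)(κ-3) u + 4κ(κ-1)(κ-2) lam ∂_r u + 6κ(κ-1) lam² ∂_rr u + 4κ lam³ ∂_rrr u
+ lam⁴ ∂_rrrr u`. -/
def T4 (p : ℝ) (x : Space n) (u : Space n → ℝ) (lam : ℝ) (y : Space n) : ℝ :=
  kappa p * (kappa p - 1) * (kappa p - 2) * (kappa p - 3) * u y
    + 4 * kappa p * (kappa p - 1) * (kappa p - 2) * lam * radialDeriv x u y
    + 6 * kappa p * (kappa p - 1) * lam ^ 2 * ((radialDeriv x)^[2] u) y
    + 4 * kappa p * lam ^ 3 * ((radialDeriv x)^[3] u) y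
    + lam ^ 4 * ((radialDeriv x)^[4] u) y

/-- `lam² Δu - lam² ∂_rr u - (n-1) lam ∂_r u`. -/
def angularPart (x : Space n) (u : Space n → ℝ) (lam : ℝ) (y : Space n) : ℝ :=
  lam ^ 2 * (Δ u) y - lam ^ 2 * ((radialDeriv x)^[2] u) y
    - ((n : ℝ) - 1) * lam * radialDeriv x u y

/-- `|∇f|² - |∂_r f|²`. -/
def tangentialSq (x : Space n) (f : Space n → ℝ) (y : Space n) : ℝ :=
  ‖∇ f y‖ ^ 2 - (radialDeriv x f y) ^ 2

/-- For `y ∈ ∂B_lam(x)`, the derivative at `t = lam` of `t^(12/(p-1)) Q t`, where `Q t` is evaluated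
at the point of `∂B_t(x)` on the ray from `x` through `y`. -/
def rayDeriv (p : ℝ) (x : Space n) (Q : ℝ → Space n → ℝ) (lam : ℝ) (y : Space n) : ℝ :=
  deriv (fun t : ℝ => t ^ (2 * kappa p) * Q t (x + (t / lam) • (y - x))) lam

/-- The energy `E(lam, x, u)`. -/
def energy (p lam : ℝ) (x : Space n) (u : Space n → ℝ) : ℝ :=
  let e : ℝ := 6 * ((p + 1) / (p - 1)) - n
  lam ^ e * ((∫ y in Metric.ball x lam, 1 / 2 * ‖∇ (Δ u) y‖ ^ 2)
      - 1 / (p + 1) * ∫ y in Metric.ball x lam, |u y| ^ (p + 1))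
    - sphereIntegral x lam (fun y => lam ^ (e - 5) * (T4 p x u lam y * T1 p x u lam y))
    + 2 * sphereIntegral x lam (fun y => lam ^ (e - 5) * (T3 p x u lam y * T2 p x u lam y))
    - (delta1 n p - 6)
      * sphereIntegral x lam (fun y => lam ^ (e - 5) * (T3 p x u lam y * T1 p x u lam y))
    + 1 / 2 * (kappa p + 2) * lam ^ (e - 1) * sphereIntegral x lam (fun y => (Δ u) y ^ 2)
    - (24 - 6 * delta1 n p + delta2 n p)
      * sphereIntegral x lam (fun y => lam ^ (e - 5) * (T2 p x u lam y * T1 p x u lam y))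
    - (9 * delta1 n p - 3 * delta2 n p - 36)
      * sphereIntegral x lam (fun y => lam ^ (e - 5) * T1 p x u lam y ^ 2)
    + (delta1 n p - 8)
      * sphereIntegral x lam (fun y => lam ^ (e - 5) * T2 p x u lam y ^ 2)
    + delta4 n p * sphereIntegral x lam (fun y => lam ^ (e - 5) * (T1 p x u lam y * u y))
    + 2 * delta4 n p * sphereIntegral x lam (fun y => lam ^ (e - 5) * u y ^ 2)
    + 2 * sphereIntegral x lam (fun y => lam ^ (e - 5) * angularPart x u lam y ^ 2)
    + 1 / 2 * sphereIntegral x lam (fun y =>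
        lam ^ (2 - (n : ℝ)) * rayDeriv p x (fun t z => angularPart x u t z ^ 2) lam y)
    - 4 * (beta n p - n + 4)
      * sphereIntegral x lam (fun y => lam ^ (e - 5) * (lam ^ 2 * tangentialSq x u y))
    - (beta n p - n + 4) * sphereIntegral x lam (fun y =>
        lam ^ (2 - (n : ℝ)) * rayDeriv p x (fun t z => t ^ 2 * tangentialSq x u z) lam y)
    - 6 * sphereIntegral x lam (fun y =>
        lam ^ (e - 5) * (lam ^ 2 * tangentialSq x (T1 p x u lam) y))
    + sphereIntegral x lam (fun y =>
        lam ^ (4 - (n : ℝ)) * rayDeriv p x (fun t z => tangentialSq x (T1 p x u t) z) lam y)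

end Triharmonic

end

/-! Put U(y) = u(x + y), κ = 6/(p - 1), and let 𝓔 = y · ∇ be the Euler operator. Since t ∂_t acts on
t^c f(tθ) as 𝓔 + c acts on f, all λ-derivatives become operators on functions on ℝⁿ: the j-th
λ-derivative of u^λ at θ is λ^(κ-j) w_j(λθ) with w_j = `ladder κ U j`. The spherical Laplacian and
carré du champ become `sph` and `gam`; 𝓔 commutes with the first and is a derivation for the second.
In these terms (`energy_eq`) the energy is λ^(2κ+6-n) ∫_{B_λ} h + λ^(2κ) ∫_{∂B_1} Q(λθ), with h =
`bulkDensity` and Q = `boundaryDensity`.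

Bulk term. Both parts of h scale with weight 2κ + 6, so (𝓔 + 2κ + 6)h is the first variation of h in
the direction w_1 = (𝓔 + κ)U. By the equation this variation is the divergence of Δw_1 ∇ΔU - Δ²U
∇w_1 + w_1 ∇Δ²U (`dvg_bulkField`, an identity of Pohozaev type). The divergence theorem then makes
the derivative of the bulk term a boundary integral (`hasDerivAt_bulk`).

Boundary terms. On the sphere |y|⁴ Δ²U is a combination of the w_j, the `sph` w_j and `sph` (`sph`
w_0); δ_1, ..., δ_4, α, β are its coefficients (`norm_pow_mul_bilaplacian`). The density Q is built
so that (𝓔 + 2κ)Q completes the boundary integral to squares. For example -w_4 w_1 removes w_5 w_1,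
2 w_3 w_2 removes the resulting -2 w_4 w_2 and leaves 2 w_3², and (κ+2)/2 (|y|²ΔU)² removes the
product of |y|²ΔU with |y|²Δw_1 and leaves (|y|²Δw_1)². What remains besides the dissipation is a
combination of expressions f `sph` g + `gam` f g (`balance_pointwise`), and each of these has mean
zero on spheres (`sphMean_mul_sph`), being the divergence of a tangential field.
`sphMean_dissipation` translates the dissipation back into derivatives of u^λ. -/

noncomputable section

namespace Triharmonic

variable {n : ℕ}

/-! ### Partial derivatives and the Euler operator -/

/-- The partial derivative in the `i`-th coordinate direction. -/
def pd (i : Fin n) (f : Space n → ℝ) (y : Space n) : ℝ :=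
  fderiv ℝ f y (EuclideanSpace.single i 1)

/-- The Euler operator `f ↦ y · ∇f`. -/
def euler {F : Type*} [NormedAddCommGroup F] [NormedSpace ℝ F] (f : Space n → F) (y : Space n) : F :=
  fderiv ℝ f y y

theorem contDiff_pd {m N : WithTop ℕ∞} {f : Space n → ℝ} (hf : ContDiff ℝ N f) (h : m + 1 ≤ N)
    (i : Fin n) : ContDiff ℝ m (pd i f) :=
  (hf.fderiv_right h).clm_apply contDiff_const

theorem contDiff_euler {m N : WithTop ℕ∞} {F : Type*} [NormedAddCommGroup F] [NormedSpace ℝ F]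
    {f : Space n → F} (hf : ContDiff ℝ N f) (h : m + 1 ≤ N) : ContDiff ℝ m (euler f) :=
  (hf.fderiv_right h).clm_apply contDiff_id

theorem fderiv_apply_eq_sum (f : Space n → ℝ) (y v : Space n) :
    fderiv ℝ f y v = ∑ i, v i * pd i f y := by
  conv_lhs => rw [← (EuclideanSpace.basisFun (Fin n) ℝ).sum_repr v]
  simp [pd]

theorem euler_eq_sum (f : Space n → ℝ) (y : Space n) : euler f y = ∑ i, y i * pd i f y :=
  fderiv_apply_eq_sum f y y

theorem gradient_apply (f : Space n → ℝ) (y : Space n) (i : Fin n) : (∇ f y) i = pd i f y := by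
  have h : inner ℝ (∇ f y) (EuclideanSpace.single i (1 : ℝ)) = pd i f y := inner_gradient_left
  rw [EuclideanSpace.inner_single_right] at h
  simpa using h

theorem inner_gradient_gradient (f g : Space n → ℝ) (y : Space n) :
    inner ℝ (∇ f y) (∇ g y) = ∑ i, pd i f y * pd i g y := by
  rw [PiLp.inner_apply]
  exact Finset.sum_congr rfl fun i _ => by simp [gradient_apply, mul_comm]

theorem norm_gradient_sq (f : Space n → ℝ) (y : Space n) :
    ‖∇ f y‖ ^ 2 = ∑ i, pd i f y ^ 2 := by
  rw [← real_inner_self_eq_norm_sq, inner_gradient_gradient]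
  simp [sq]

theorem pd_add {f g : Space n → ℝ} {y : Space n} (hf : DifferentiableAt ℝ f y)
    (hg : DifferentiableAt ℝ g y) (i : Fin n) :
    pd i (fun z => f z + g z) y = pd i f y + pd i g y := by
  simp [pd, fderiv_fun_add hf hg]

theorem pd_sub {f g : Space n → ℝ} {y : Space n} (hf : DifferentiableAt ℝ f y)
    (hg : DifferentiableAt ℝ g y) (i : Fin n) :
    pd i (fun z => f z - g z) y = pd i f y - pd i g y := by
  simp [pd, fderiv_fun_sub hf hg]

theorem pd_mul {f g : Space n → ℝ} {y : Space n} (hf : DifferentiableAt ℝ f y)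
    (hg : DifferentiableAt ℝ g y) (i : Fin n) :
    pd i (fun z => f z * g z) y = f y * pd i g y + pd i f y * g y := by
  simp [pd, fderiv_fun_mul hf hg, mul_comm]

theorem pd_const_mul {f : Space n → ℝ} {y : Space n} (hf : DifferentiableAt ℝ f y) (c : ℝ)
    (i : Fin n) : pd i (fun z => c * f z) y = c * pd i f y := by
  simp [pd, fderiv_const_mul hf]

theorem pd_sum {ι : Type*} (s : Finset ι) {f : ι → Space n → ℝ} {y : Space n}
    (hf : ∀ j ∈ s, DifferentiableAt ℝ (f j) y) (i : Fin n) :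
    pd i (fun z => ∑ j ∈ s, f j z) y = ∑ j ∈ s, pd i (f j) y := by
  simp [pd, fderiv_fun_sum hf]

theorem differentiable_coord (j : Fin n) : Differentiable ℝ (fun z : Space n => z j) :=
  (EuclideanSpace.proj (𝕜 := ℝ) j).differentiable

theorem contDiff_coord {m : WithTop ℕ∞} (j : Fin n) : ContDiff ℝ m (fun z : Space n => z j) :=
  (EuclideanSpace.proj (𝕜 := ℝ) j).contDiff

theorem pd_coord (i j : Fin n) (y : Space n) :
    pd i (fun z => z j) y = if j = i then 1 else 0 := by
  have h : fderiv ℝ (fun z : Space n => z j) y = EuclideanSpace.proj (𝕜 := ℝ) j :=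
    (EuclideanSpace.proj (𝕜 := ℝ) j).fderiv
  simp [pd, h]

theorem pd_normSq (i : Fin n) (y : Space n) : pd i (fun z => ‖z‖ ^ 2) y = 2 * y i := by
  simp [pd, fderiv_norm_sq_apply, EuclideanSpace.inner_single_right]

theorem pd_comm {f : Space n → ℝ} (hf : ContDiff ℝ 2 f) (i j : Fin n) (y : Space n) :
    pd i (pd j f) y = pd j (pd i f) y := by
  have hd : DifferentiableAt ℝ (fderiv ℝ f) y :=
    ((hf.fderiv_right (m := 1) (by norm_num)).differentiable (by norm_num)) y
  have key : ∀ a b : Fin n, pd a (pd b f) y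
      = fderiv ℝ (fderiv ℝ f) y (EuclideanSpace.single a 1) (EuclideanSpace.single b 1) := by
    intro a b
    have := fderiv_clm_apply hd (differentiableAt_const (EuclideanSpace.single b (1 : ℝ)))
    change fderiv ℝ (fun z => fderiv ℝ f z (EuclideanSpace.single b 1)) y _ = _
    rw [this]
    simp
  rw [key, key]
  exact (hf.contDiffAt.isSymmSndFDerivAt (by simp)).eq _ _

theorem laplacian_eq_sum {f : Space n → ℝ} (hf : ContDiff ℝ 2 f) (y : Space n) :
    (Δ f) y = ∑ i, pd i (pd i f) y := by
  have hd : DifferentiableAt ℝ (fderiv ℝ f) y :=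
    ((hf.fderiv_right (m := 1) (by norm_num)).differentiable (by norm_num)) y
  rw [InnerProductSpace.laplacian_eq_iteratedFDeriv_orthonormalBasis f
    (EuclideanSpace.basisFun (Fin n) ℝ)]
  refine Finset.sum_congr rfl fun i _ => ?_
  have := fderiv_clm_apply hd (differentiableAt_const (EuclideanSpace.single i (1 : ℝ)))
  change _ = fderiv ℝ (fun z => fderiv ℝ f z (EuclideanSpace.single i 1)) y _
  rw [this, iteratedFDeriv_two_apply]
  simp

theorem laplacian_eq_sum_fun {f : Space n → ℝ} (hf : ContDiff ℝ 2 f) :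
    Δ f = fun y => ∑ i, pd i (pd i f) y :=
  funext (laplacian_eq_sum hf)

theorem contDiff_laplacian {m N : WithTop ℕ∞} {f : Space n → ℝ} (hf : ContDiff ℝ N f)
    (h : m + 2 ≤ N) : ContDiff ℝ m (Δ f) := by
  rw [laplacian_eq_sum_fun (hf.of_le (le_trans (by simp) h))]
  have h' : m + 1 + 1 ≤ N := by rwa [add_assoc, one_add_one_eq_two]
  exact ContDiff.sum fun i _ => contDiff_pd (contDiff_pd hf h' i) le_rfl i

section EulerAlgebra

variable {f g : Space n → ℝ} {y : Space n}

theorem euler_add (hf : DifferentiableAt ℝ f y) (hg : DifferentiableAt ℝ g y) :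
    euler (fun z => f z + g z) y = euler f y + euler g y := by
  simp [euler, fderiv_fun_add hf hg]

theorem euler_sub (hf : DifferentiableAt ℝ f y) (hg : DifferentiableAt ℝ g y) :
    euler (fun z => f z - g z) y = euler f y - euler g y := by
  simp [euler, fderiv_fun_sub hf hg]

theorem euler_mul (hf : DifferentiableAt ℝ f y) (hg : DifferentiableAt ℝ g y) :
    euler (fun z => f z * g z) y = f y * euler g y + euler f y * g y := by
  simp [euler, fderiv_fun_mul hf hg, mul_comm]

theorem euler_const_mul (hf : DifferentiableAt ℝ f y) (c : ℝ) :
    euler (fun z => c * f z) y = c * euler f y := by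
  simp [euler, fderiv_const_mul hf]

theorem euler_sum {ι : Type*} (s : Finset ι) {f : ι → Space n → ℝ} {y : Space n}
    (hf : ∀ j ∈ s, DifferentiableAt ℝ (f j) y) :
    euler (fun z => ∑ j ∈ s, f j z) y = ∑ j ∈ s, euler (f j) y := by
  simp [euler, fderiv_fun_sum hf]

theorem differentiable_normSq : Differentiable ℝ (fun z : Space n => ‖z‖ ^ 2) :=
  (contDiff_norm_sq ℝ (n := 1)).differentiable (by norm_num)

theorem euler_normSq (y : Space n) : euler (fun z : Space n => ‖z‖ ^ 2) y = 2 * ‖y‖ ^ 2 := by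
  simp [euler, fderiv_norm_sq_apply]

theorem sum_sq_eq_normSq (y : Space n) : ∑ i, y i * y i = ‖y‖ ^ 2 := by
  rw [EuclideanSpace.norm_sq_eq]
  simp [sq]

/-- The commutator of a partial derivative with the Euler operator. -/
theorem pd_euler (hf : ContDiff ℝ 2 f) (i : Fin n) (y : Space n) :
    pd i (euler f) y = euler (pd i f) y + pd i f y := by
  have hpd : ∀ j, Differentiable ℝ (pd j f) := fun j =>
    (contDiff_pd hf (m := 1) (by norm_num) j).differentiable (by norm_num)
  rw [show euler f = fun z => ∑ j, z j * pd j f z from funext (euler_eq_sum f), pd_sum _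
    (fun j _ => ((differentiable_coord j) y).fun_mul (hpd j y)), euler_eq_sum]
  simp_rw [pd_mul (differentiable_coord _ y) (hpd _ y), pd_coord, pd_comm hf i]
  simp [Finset.sum_add_distrib]

theorem pd_euler_fun (hf : ContDiff ℝ 2 f) (i : Fin n) :
    pd i (euler f) = fun y => euler (pd i f) y + pd i f y :=
  funext (pd_euler hf i)

/-- The commutator of the Laplacian with the Euler operator. -/
theorem laplacian_euler (hf : ContDiff ℝ 3 f) (y : Space n) :
    (Δ (euler f)) y = euler (Δ f) y + 2 * (Δ f) y := by
  have h2 : ContDiff ℝ 2 f := hf.of_le (by norm_num)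
  have hpd : ∀ j, ContDiff ℝ 2 (pd j f) := fun j => contDiff_pd hf (by norm_num) j
  have hpd' : ∀ j, Differentiable ℝ (pd j (pd j f)) := fun j =>
    (contDiff_pd (hpd j) (m := 1) (by norm_num) j).differentiable (by norm_num)
  have he : ContDiff ℝ 2 (euler f) := contDiff_euler hf (by norm_num)
  have hepd : ∀ j, Differentiable ℝ (euler (pd j f)) := fun j =>
    (contDiff_euler (hpd j) (m := 1) (by norm_num)).differentiable (by norm_num)
  rw [laplacian_eq_sum he, laplacian_eq_sum_fun h2, euler_sum _ (fun j _ => hpd' j y),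
    Finset.mul_sum, ← Finset.sum_add_distrib]
  refine Finset.sum_congr rfl fun i _ => ?_
  rw [pd_euler_fun h2, pd_add (hepd i y) ((hpd i).differentiable (by norm_num) y),
    pd_euler (hpd i)]
  ring

/-- Applied to Δf in place of f, this produces |y|⁴ Δ²f from two successive applications of |y|² Δ.
-/
theorem laplacian_normSq_mul (hf : ContDiff ℝ 2 f) (y : Space n) :
    (Δ (fun z => ‖z‖ ^ 2 * f z)) y = 2 * n * f y + 4 * euler f y + ‖y‖ ^ 2 * (Δ f) y := by
  have hd : Differentiable ℝ f := hf.differentiable (by norm_num)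
  have hpd : ∀ j, Differentiable ℝ (pd j f) := fun j =>
    (contDiff_pd hf (m := 1) (by norm_num) j).differentiable (by norm_num)
  rw [laplacian_eq_sum ((contDiff_norm_sq ℝ).mul hf), laplacian_eq_sum hf, euler_eq_sum,
    Finset.mul_sum, Finset.mul_sum]
  have key : ∀ i : Fin n, pd i (pd i (fun z => ‖z‖ ^ 2 * f z)) y
      = 2 * f y + 4 * (y i * pd i f y) + ‖y‖ ^ 2 * pd i (pd i f) y := by
    intro i
    have h1 : pd i (fun z => ‖z‖ ^ 2 * f z)
        = fun z => ‖z‖ ^ 2 * pd i f z + 2 * (z i * f z) := by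
      funext z
      rw [pd_mul (differentiable_normSq z) (hd z), pd_normSq]
      ring
    rw [h1, pd_add ((differentiable_normSq y).fun_mul (hpd i y))
      (((differentiable_coord i y).fun_mul (hd y)).const_mul 2),
      pd_mul (differentiable_normSq y) (hpd i y), pd_normSq,
      pd_const_mul ((differentiable_coord i y).fun_mul (hd y)),
      pd_mul (differentiable_coord i y) (hd y), pd_coord]
    simp
    ring
  simp_rw [key, Finset.sum_add_distrib]
  simp
  ring

end EulerAlgebra

/-! ### The spherical Laplacian and the spherical carré du champ, as homogeneous operators -/

/-- The spherical Laplacian as an operator on functions on `ℝⁿ`, homogeneous of degree zero. -/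
def sph (f : Space n → ℝ) (y : Space n) : ℝ :=
  ‖y‖ ^ 2 * (Δ f) y - euler (euler f) y - ((n : ℝ) - 2) * euler f y

/-- The inner product of the spherical gradients, homogeneous of degree zero. -/
def gam (f g : Space n → ℝ) (y : Space n) : ℝ :=
  ‖y‖ ^ 2 * inner ℝ (∇ f y) (∇ g y) - euler f y * euler g y

section Spherical

variable {f g : Space n → ℝ}

theorem contDiff_sph {m N : WithTop ℕ∞} (hf : ContDiff ℝ N f) (h : m + 2 ≤ N) :
    ContDiff ℝ m (sph f) := by
  have h' : m + 1 + 1 ≤ N := by rwa [add_assoc, one_add_one_eq_two]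
  exact (((contDiff_norm_sq ℝ).mul (contDiff_laplacian hf h)).sub
    (contDiff_euler (contDiff_euler hf h') le_rfl)).sub
    (contDiff_const.mul (contDiff_euler (hf.of_le (le_trans (by simp) h')) le_rfl))

theorem contDiff_gam {m N : WithTop ℕ∞} (hf : ContDiff ℝ N f) (hg : ContDiff ℝ N g)
    (h : m + 1 ≤ N) : ContDiff ℝ m (gam f g) := by
  unfold gam
  simp_rw [inner_gradient_gradient]
  exact ((contDiff_norm_sq ℝ).mul (ContDiff.sum fun i _ =>
    (contDiff_pd hf h i).mul (contDiff_pd hg h i))).sub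
    ((contDiff_euler hf h).mul (contDiff_euler hg h))

theorem gam_comm (f g : Space n → ℝ) : gam f g = gam g f := by
  funext y
  rw [gam, gam, real_inner_comm, mul_comm (euler f y)]

theorem gradient_add_fun {y : Space n} (hf : DifferentiableAt ℝ f y) (hg : DifferentiableAt ℝ g y) :
    ∇ (fun z => f z + g z) y = ∇ f y + ∇ g y := by
  ext i
  simp [gradient_apply, pd_add hf hg]

theorem gradient_const_mul_fun {y : Space n} (hf : DifferentiableAt ℝ f y) (c : ℝ) :
    ∇ (fun z => c * f z) y = c • ∇ f y := by
  ext i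
  simp [gradient_apply, pd_const_mul hf]

theorem gam_add_left {h : Space n → ℝ} {y : Space n} (hf : DifferentiableAt ℝ f y)
    (hg : DifferentiableAt ℝ g y) :
    gam (fun z => f z + g z) h y = gam f h y + gam g h y := by
  rw [gam, gradient_add_fun hf hg, euler_add hf hg, inner_add_left, gam, gam]
  ring

theorem gam_const_mul_left {h : Space n → ℝ} {y : Space n} (hf : DifferentiableAt ℝ f y)
    (c : ℝ) : gam (fun z => c * f z) h y = c * gam f h y := by
  rw [gam, gradient_const_mul_fun hf, euler_const_mul hf, real_inner_smul_left, gam]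
  ring

theorem sph_add {y : Space n} (hf : ContDiff ℝ 2 f) (hg : ContDiff ℝ 2 g) :
    sph (fun z => f z + g z) y = sph f y + sph g y := by
  have hfd : Differentiable ℝ f := hf.differentiable (by norm_num)
  have hgd : Differentiable ℝ g := hg.differentiable (by norm_num)
  have hfe : Differentiable ℝ (euler f) :=
    (contDiff_euler hf (m := 1) (by norm_num)).differentiable (by norm_num)
  have hge : Differentiable ℝ (euler g) :=
    (contDiff_euler hg (m := 1) (by norm_num)).differentiable (by norm_num)
  have h1 : euler (fun z => f z + g z) = fun z => euler f z + euler g z :=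
    funext fun z => euler_add (hfd z) (hgd z)
  have h2 : (Δ (fun z => f z + g z)) y = (Δ f) y + (Δ g) y :=
    ContDiffAt.laplacian_add hf.contDiffAt hg.contDiffAt
  rw [sph, h1, h2, euler_add (hfe y) (hge y), sph, sph]
  ring

theorem sph_const_mul {y : Space n} (hf : ContDiff ℝ 2 f) (c : ℝ) :
    sph (fun z => c * f z) y = c * sph f y := by
  have hfd : Differentiable ℝ f := hf.differentiable (by norm_num)
  have hfe : Differentiable ℝ (euler f) :=
    (contDiff_euler hf (m := 1) (by norm_num)).differentiable (by norm_num)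
  have h1 : euler (fun z => c * f z) = fun z => c * euler f z :=
    funext fun z => euler_const_mul (hfd z) c
  have h2 : (Δ (fun z => c * f z)) y = c * (Δ f) y :=
    InnerProductSpace.laplacian_smul c hf.contDiffAt
  rw [sph, h1, h2, euler_const_mul (hfe y), sph]
  ring

theorem normSq_mul_laplacian (f : Space n → ℝ) (y : Space n) :
    ‖y‖ ^ 2 * (Δ f) y = euler (euler f) y + ((n : ℝ) - 2) * euler f y + sph f y := by
  rw [sph]
  ring

/-- The spherical Laplacian commutes with the Euler operator. -/
theorem euler_sph (hf : ContDiff ℝ 3 f) (y : Space n) :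
    euler (sph f) y = sph (euler f) y := by
  have he : ContDiff ℝ 2 (euler f) := contDiff_euler hf (by norm_num)
  have hee : ContDiff ℝ 1 (euler (euler f)) := contDiff_euler he (by norm_num)
  have hl : Differentiable ℝ (Δ f) :=
    (contDiff_laplacian hf (m := 1) (by norm_num)).differentiable (by norm_num)
  have h1 := he.differentiable (by norm_num) y
  have h2 := hee.differentiable (by norm_num) y
  have e : sph f = fun y => ‖y‖ ^ 2 * (Δ f) y - euler (euler f) y - ((n : ℝ) - 2) * euler f y := rfl
  rw [e, euler_sub (((differentiable_normSq y).fun_mul (hl y)).fun_sub h2) (h1.const_mul _),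
    euler_sub ((differentiable_normSq y).fun_mul (hl y)) h2, euler_mul (differentiable_normSq y) (hl y),
    euler_normSq, euler_const_mul h1, sph, laplacian_euler hf]
  ring

/-- The Euler operator is a derivation for the spherical carré du champ. -/
theorem euler_gam (hf : ContDiff ℝ 2 f) (hg : ContDiff ℝ 2 g) (y : Space n) :
    euler (gam f g) y = gam (euler f) g y + gam f (euler g) y := by
  have hfd : ∀ j, Differentiable ℝ (pd j f) := fun j =>
    (contDiff_pd hf (m := 1) (by norm_num) j).differentiable (by norm_num)
  have hgd : ∀ j, Differentiable ℝ (pd j g) := fun j =>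
    (contDiff_pd hg (m := 1) (by norm_num) j).differentiable (by norm_num)
  have hfe : Differentiable ℝ (euler f) :=
    (contDiff_euler hf (m := 1) (by norm_num)).differentiable (by norm_num)
  have hge : Differentiable ℝ (euler g) :=
    (contDiff_euler hg (m := 1) (by norm_num)).differentiable (by norm_num)
  have hs : DifferentiableAt ℝ (fun z => ∑ i, pd i f z * pd i g z) y :=
    DifferentiableAt.fun_sum fun i _ => (hfd i y).fun_mul (hgd i y)
  have e : gam f g = fun y => ‖y‖ ^ 2 * (∑ i, pd i f y * pd i g y) - euler f y * euler g y := by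
    funext z
    rw [gam, inner_gradient_gradient]
  rw [e, euler_sub ((differentiable_normSq y).fun_mul hs) ((hfe y).fun_mul (hge y)),
    euler_mul (differentiable_normSq y) hs, euler_mul (hfe y) (hge y), euler_normSq,
    euler_sum _ (fun i _ => (hfd i y).fun_mul (hgd i y)), gam, gam, inner_gradient_gradient,
    inner_gradient_gradient]
  simp_rw [euler_mul (hfd _ y) (hgd _ y), pd_euler hf, pd_euler hg, add_mul, mul_add,
    Finset.sum_add_distrib]
  ring

end Spherical

/-! ### Integration over spheres -/

/-- The integral over the unit sphere of `θ ↦ f (r θ)`. -/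
def sphMean (f : Space n → ℝ) (r : ℝ) : ℝ := unitSphereIntegral fun θ => f (r • θ)

theorem integrable_sphere {f : Metric.sphere (0 : Space n) 1 → ℝ} (hf : Continuous f) :
    Integrable f ((volume : Measure (Space n)).toSphere) :=
  hf.integrable_of_hasCompactSupport (HasCompactSupport.of_compactSpace f)

theorem integrable_sphMean {f : Space n → ℝ} (hf : Continuous f) (r : ℝ) :
    Integrable (fun θ : Metric.sphere (0 : Space n) 1 => f (r • (θ : Space n)))
      ((volume : Measure (Space n)).toSphere) :=
  integrable_sphere (by fun_prop)

theorem continuous_unitSphereIntegral {f : ℝ → Space n → ℝ} (hf : Continuous f.uncurry) :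
    Continuous fun r => unitSphereIntegral (f r) := by
  unfold unitSphereIntegral
  have h := continuous_parametric_integral_of_continuous
    (μ := (volume : Measure (Space n)).toSphere) (s := Set.univ)
    (f := fun r (θ : Metric.sphere (0 : Space n) 1) => f r θ)
    (by exact hf.comp (by fun_prop : Continuous fun q : ℝ × Metric.sphere (0 : Space n) 1 =>
      (q.1, (q.2 : Space n)))) isCompact_univ
  simpa using h

theorem continuous_sphMean {f : Space n → ℝ} (hf : Continuous f) : Continuous (sphMean f) :=
  continuous_unitSphereIntegral (f := fun r θ => f (r • θ))
    (hf.comp (by fun_prop : Continuous fun q : ℝ × Space n => q.1 • q.2))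

theorem unitSphereIntegral_congr {f g : Space n → ℝ} (h : ∀ θ, ‖θ‖ = 1 → f θ = g θ) :
    unitSphereIntegral f = unitSphereIntegral g :=
  integral_congr_ae (.of_forall fun θ => h θ (by simp))

theorem hasDerivAt_ray {F : Type*} [NormedAddCommGroup F] [NormedSpace ℝ F] {f : Space n → F}
    {θ : Space n} {r : ℝ} (hf : DifferentiableAt ℝ f (r • θ)) :
    HasDerivAt (fun t : ℝ => f (t • θ)) (fderiv ℝ f (r • θ) θ) r := by
  have h : HasDerivAt (fun t : ℝ => t • θ) θ r := by
    simpa using (hasDerivAt_id r).smul_const θ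
  exact hf.hasFDerivAt.comp_hasDerivAt r h

theorem fderiv_ray {F : Type*} [NormedAddCommGroup F] [NormedSpace ℝ F] (f : Space n → F)
    (θ : Space n) {r : ℝ} (hr : r ≠ 0) :
    fderiv ℝ f (r • θ) θ = r⁻¹ • euler f (r • θ) := by
  rw [euler, map_smul, smul_smul, inv_mul_cancel₀ hr, one_smul]

/-- Differentiation under the integral: for t within 1 of r and θ on the unit sphere, the
t-derivative of f(tθ) is bounded by compactness, and the surface measure is finite. -/
theorem hasDerivAt_sphMean {f : Space n → ℝ} (hf : ContDiff ℝ 1 f) {r : ℝ} (hr : r ≠ 0) :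
    HasDerivAt (sphMean f) (r⁻¹ * sphMean (euler f) r) r := by
  have hc : Continuous fun q : ℝ × Space n => fderiv ℝ f (q.1 • q.2) q.2 :=
    ((hf.continuous_fderiv (by norm_num)).comp (by fun_prop)).clm_apply continuous_snd
  obtain ⟨K, hK⟩ := ((isCompact_closedBall r 1).prod
    (isCompact_sphere (0 : Space n) 1)).exists_bound_of_continuousOn hc.continuousOn
  have hd : Differentiable ℝ f := hf.differentiable (by norm_num)
  have key := hasDerivAt_integral_of_dominated_loc_of_deriv_le
    (μ := (volume : Measure (Space n)).toSphere) (s := Metric.closedBall r 1) (x₀ := r)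
    (F := fun t (θ : Metric.sphere (0 : Space n) 1) => f (t • (θ : Space n)))
    (F' := fun t (θ : Metric.sphere (0 : Space n) 1) => fderiv ℝ f (t • (θ : Space n)) θ)
    (bound := fun _ => K) (Metric.closedBall_mem_nhds r one_pos)
    (.of_forall fun t => (integrable_sphMean hf.continuous t).aestronglyMeasurable)
    (integrable_sphMean hf.continuous r)
    (integrable_sphere (f := fun θ : Metric.sphere (0 : Space n) 1 =>
      fderiv ℝ f (r • (θ : Space n)) θ) (hc.comp
        (by fun_prop : Continuous fun θ : Metric.sphere (0 : Space n) 1 =>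
          (r, (θ : Space n))))).aestronglyMeasurable
    (.of_forall fun θ t ht => hK (t, θ) ⟨ht, θ.2⟩)
    (integrable_const K)
    (.of_forall fun θ t _ => hasDerivAt_ray (hd _))
  refine key.2.congr_deriv ?_
  change _ = r⁻¹ * ∫ θ : Metric.sphere (0 : Space n) 1, euler f (r • (θ : Space n)) ∂_
  rw [← integral_const_mul]
  refine integral_congr_ae (.of_forall fun θ => ?_)
  simp only [fderiv_ray f (θ : Space n) hr, smul_eq_mul]

theorem nontrivial_space (hn : 1 ≤ n) : Nontrivial (Space n) := by
  have : Nonempty (Fin n) := ⟨⟨0, hn⟩⟩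
  infer_instance

/-- Integration in polar coordinates. -/
theorem integral_polar (hn : 1 ≤ n) {f : Space n → ℝ} (hf : Integrable f) :
    ∫ y, f y = ∫ r in Set.Ioi (0 : ℝ), r ^ (n - 1) * sphMean f r := by
  have := nontrivial_space hn
  set μ : Measure (Space n) := volume
  have hmp := μ.measurePreserving_homeomorphUnitSphereProd
  have hdim : Module.finrank ℝ (Space n) = n := by simp
  rw [hdim] at hmp
  -- The function in polar coordinates on the punctured space; since `1 ≤ n`, the origin is a null
  -- set.
  let G : Metric.sphere (0 : Space n) 1 × Set.Ioi (0 : ℝ) → ℝ := fun q => f (q.2.1 • (q.1 : Space n))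
  have hG : ∀ z : ({0}ᶜ : Set (Space n)), G (homeomorphUnitSphereProd (Space n) z) = f z := by
    intro z
    have hz : ‖(z : Space n)‖ ≠ 0 := norm_ne_zero_iff.2 z.2
    simp [G, smul_smul, hz]
  have hint : Integrable G (μ.toSphere.prod (.volumeIoiPow (n - 1))) := by
    rw [← hmp.integrable_comp_emb (Homeomorph.measurableEmbedding _)]
    have : G ∘ homeomorphUnitSphereProd (Space n) = f ∘ Subtype.val := funext hG
    rw [this, ← integrableOn_iff_comap_subtypeVal (measurableSet_singleton _).compl]
    exact hf.integrableOn
  calc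
    ∫ y, f y = ∫ z : ({0}ᶜ : Set (Space n)), f z ∂(μ.comap (↑)) := by
      rw [integral_subtype_comap (measurableSet_singleton _).compl f,
        restrict_compl_singleton]
    _ = ∫ q, G q ∂μ.toSphere.prod (.volumeIoiPow (n - 1)) := by
      rw [← hmp.integral_comp (Homeomorph.measurableEmbedding _) G]
      simp_rw [hG]
    _ = ∫ r : Set.Ioi (0 : ℝ), sphMean f r ∂(.volumeIoiPow (n - 1)) := by
      rw [integral_prod_symm _ hint]
      rfl
    _ = _ := by
      simp only [Measure.volumeIoiPow, ENNReal.ofReal]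
      rw [integral_withDensity_eq_integral_smul,
        integral_subtype_comap measurableSet_Ioi
          fun a ↦ Real.toNNReal (a ^ (n - 1)) • sphMean f a,
        setIntegral_congr_fun measurableSet_Ioi fun x hx ↦ ?_]
      · simp only [NNReal.smul_def, Real.coe_toNNReal _ (pow_nonneg (le_of_lt hx) _), smul_eq_mul]
      · exact (measurable_subtype_coe.pow_const _).real_toNNReal

theorem integral_ball_polar (hn : 1 ≤ n) {f : Space n → ℝ} (hf : Continuous f) {R : ℝ}
    (hR : 0 ≤ R) :
    ∫ y in Metric.ball 0 R, f y = ∫ r in (0 : ℝ)..R, r ^ (n - 1) * sphMean f r := by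
  have hi : IntegrableOn f (Metric.ball (0 : Space n) R) :=
    (hf.continuousOn.integrableOn_compact (isCompact_closedBall 0 R)).mono_set
      Metric.ball_subset_closedBall
  rw [← integral_indicator measurableSet_ball,
    integral_polar hn (hi.integrable_indicator measurableSet_ball),
    intervalIntegral.integral_of_le hR, integral_Ioc_eq_integral_Ioo,
    ← integral_indicator measurableSet_Ioi, ← integral_indicator measurableSet_Ioo]
  congr 1
  funext r
  by_cases h0 : 0 < r
  · by_cases h1 : r < R
    · rw [Set.indicator_of_mem (by exact h0), Set.indicator_of_mem (by exact ⟨h0, h1⟩)]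
      congr 1
      refine unitSphereIntegral_congr fun θ hθ => ?_
      rw [Set.indicator_of_mem]
      simp [norm_smul, hθ, abs_of_pos h0, h1]
    · rw [Set.indicator_of_mem (by exact h0), Set.indicator_of_notMem (fun h => h1 h.2)]
      have : sphMean ((Metric.ball (0 : Space n) R).indicator f) r
          = unitSphereIntegral fun _ : Space n => 0 := by
        refine unitSphereIntegral_congr fun θ hθ => ?_
        rw [Set.indicator_of_notMem]
        simpa [norm_smul, hθ, abs_of_pos h0] using h1
      rw [this]
      simp [unitSphereIntegral]
  · rw [Set.indicator_of_notMem (by exact h0), Set.indicator_of_notMem (fun h => h0 h.1)]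

theorem continuous_polar_density {f : Space n → ℝ} (hf : Continuous f) :
    Continuous fun r : ℝ => r ^ (n - 1) * sphMean f r :=
  (continuous_pow _).mul (continuous_sphMean hf)

theorem hasDerivAt_integral_ball (hn : 1 ≤ n) {f : Space n → ℝ} (hf : Continuous f) {R : ℝ}
    (hR : 0 < R) :
    HasDerivAt (fun r => ∫ y in Metric.ball 0 r, f y) (R ^ (n - 1) * sphMean f R) R := by
  have hc := continuous_polar_density hf
  refine (intervalIntegral.integral_hasDerivAt_right (hc.intervalIntegrable 0 R)
    (hc.stronglyMeasurableAtFilter _ _) hc.continuousAt).congr_of_eventuallyEq ?_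
  filter_upwards [lt_mem_nhds hR] with r hr
  exact integral_ball_polar hn hf hr.le

/-! ### The divergence theorem on balls -/

theorem integral_pd_eq_zero {g : Space n → ℝ} (hg : ContDiff ℝ 1 g) (hs : HasCompactSupport g)
    (i : Fin n) : ∫ y, pd i g y = 0 := by
  have h := integral_mul_fderiv_eq_neg_fderiv_mul_of_integrable (μ := (volume : Measure (Space n)))
    (f := fun _ => (1 : ℝ)) (g := g) (v := EuclideanSpace.single i 1) (by simp)
    (by
      simp only [one_mul]
      exact (contDiff_pd hg (m := 0) (by norm_num) i).continuous.integrable_of_hasCompactSupport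
        (hs.fderiv_apply ℝ _))
    (by simpa using hg.continuous.integrable_of_hasCompactSupport hs)
    (by simp) (fun y _ => hg.differentiable (by norm_num) y)
  simpa [pd] using h

/-- The divergence of the vector field with components `X i`. -/
def dvg (X : Fin n → Space n → ℝ) (y : Space n) : ℝ := ∑ i, pd i (X i) y

/-- The outward flux density of a vector field through spheres centred at the origin. -/
def flux (X : Fin n → Space n → ℝ) (r : ℝ) : ℝ :=
  r ^ (n - 1) * unitSphereIntegral fun θ => ∑ i, θ i * X i (r • θ)

theorem continuous_dvg {X : Fin n → Space n → ℝ} (hX : ∀ i, ContDiff ℝ 1 (X i)) :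
    Continuous (dvg X) :=
  continuous_finsetSum _ fun i _ => (contDiff_pd (hX i) (m := 0) (by norm_num) i).continuous

theorem continuous_flux {X : Fin n → Space n → ℝ} (hX : ∀ i, ContDiff ℝ 1 (X i)) :
    Continuous (flux X) := by
  refine (continuous_pow _).mul (continuous_unitSphereIntegral
    (f := fun r θ => ∑ i, θ i * X i (r • θ)) ?_)
  refine continuous_finsetSum _ fun i _ => ?_
  exact ((differentiable_coord i).continuous.comp continuous_snd).mul
    ((hX i).continuous.comp (by fun_prop))

/-- The weak form of the divergence theorem, tested against a radial function. -/
theorem integral_radial_test (hn : 1 ≤ n) {X : Fin n → Space n → ℝ} (hX : ∀ i, ContDiff ℝ 1 (X i))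
    {φ ψ : ℝ → ℝ} (hφ : ∀ s, HasDerivAt φ (ψ s) s) (hψ : Continuous ψ) {B : ℝ} (hB : 0 ≤ B)
    (hsupp : ∀ s, B ^ 2 ≤ s → φ s = 0) :
    ∫ r in (0 : ℝ)..B, (φ (r ^ 2) * (r ^ (n - 1) * sphMean (dvg X) r)
      + 2 * r * ψ (r ^ 2) * flux X r) = 0 := by
  have hφ1 : ContDiff ℝ 1 φ := by
    rw [contDiff_one_iff_deriv]
    refine ⟨fun s => (hφ s).differentiableAt, ?_⟩
    rwa [show deriv φ = ψ from funext fun s => (hφ s).deriv]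
  -- Composing with ‖y‖² instead of ‖y‖ keeps the radial test function differentiable at the origin.
  have hΦ : ContDiff ℝ 1 fun y : Space n => φ (‖y‖ ^ 2) := hφ1.comp (contDiff_norm_sq ℝ)
  have hpd : ∀ (i : Fin n) (y : Space n),
      pd i (fun y => φ (‖y‖ ^ 2)) y = ψ (‖y‖ ^ 2) * (2 * y i) := by
    intro i y
    have h : fderiv ℝ (fun y : Space n => φ (‖y‖ ^ 2)) y = _ :=
      ((hφ (‖y‖ ^ 2)).comp_hasFDerivAt y (differentiable_normSq y).hasFDerivAt).fderiv
    rw [pd, h, ← pd_normSq i y]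
    rfl
  have hvan : ∀ y : Space n, y ∉ Metric.ball (0 : Space n) B → φ (‖y‖ ^ 2) = 0 := by
    intro y hy
    apply hsupp
    have : B ≤ ‖y‖ := by simpa using hy
    gcongr
  have hcs : ∀ i, HasCompactSupport fun y => φ (‖y‖ ^ 2) * X i y := by
    intro i
    refine HasCompactSupport.intro (isCompact_closedBall (0 : Space n) B) fun y hy => ?_
    rw [hvan y fun h => hy (Metric.ball_subset_closedBall h), zero_mul]
  have hc1 : ∀ i, ContDiff ℝ 1 fun y => φ (‖y‖ ^ 2) * X i y := fun i => hΦ.mul (hX i)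
  have hpdm : ∀ i y, pd i (fun y => φ (‖y‖ ^ 2) * X i y) y
      = φ (‖y‖ ^ 2) * pd i (X i) y + ψ (‖y‖ ^ 2) * (2 * y i) * X i y := by
    intro i y
    rw [pd_mul (hΦ.differentiable (by norm_num) y) ((hX i).differentiable (by norm_num) y), hpd]
  let H : Space n → ℝ := fun y => ∑ i, pd i (fun y => φ (‖y‖ ^ 2) * X i y) y
  have hHc : Continuous H := continuous_dvg hc1
  have hH0 : ∫ y, H y = 0 := by
    rw [integral_finsetSum]
    · exact Finset.sum_eq_zero fun i _ => integral_pd_eq_zero (hc1 i) (hcs i) i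
    · intro i _
      exact (contDiff_pd (hc1 i) (m := 0) (by norm_num) i).continuous.integrable_of_hasCompactSupport
        ((hcs i).fderiv_apply ℝ _)
  -- The one-sided derivative is used so that the endpoint s = B² is covered too.
  have hψ0 : ∀ s, B ^ 2 ≤ s → ψ s = 0 := by
    intro s hs
    have h1 : HasDerivWithinAt φ 0 (Set.Ici s) s :=
      (hasDerivWithinAt_const s _ (0 : ℝ)).congr (fun t ht => hsupp t (hs.trans ht)) (hsupp s hs)
    exact (uniqueDiffWithinAt_Ici s).eq_deriv _ (hφ s).hasDerivWithinAt h1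
  have hHball : ∫ y in Metric.ball 0 B, H y = 0 := by
    rw [setIntegral_eq_integral_of_forall_compl_eq_zero, hH0]
    intro y hy
    refine Finset.sum_eq_zero fun i _ => ?_
    have : B ≤ ‖y‖ := by simpa using hy
    rw [hpdm, hvan y hy, hψ0 _ (by gcongr)]
    ring
  rw [integral_ball_polar hn hHc hB] at hHball
  refine Eq.trans (intervalIntegral.integral_congr fun r _ => ?_) hHball
  have hmean : sphMean H r = φ (r ^ 2) * sphMean (dvg X) r
      + 2 * r * ψ (r ^ 2) * unitSphereIntegral fun θ => ∑ i, θ i * X i (r • θ) := by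
    simp only [sphMean, unitSphereIntegral]
    rw [← integral_const_mul, ← integral_const_mul, ← integral_add]
    · refine integral_congr_ae (.of_forall fun θ => ?_)
      have hθ : ‖r • (θ : Space n)‖ ^ 2 = r ^ 2 := by simp [norm_smul]
      simp only [H, hpdm, hθ, dvg, Finset.mul_sum, ← Finset.sum_add_distrib]
      refine Finset.sum_congr rfl fun i _ => ?_
      simp
      ring
    · exact (integrable_sphMean (continuous_dvg hX) r).const_mul _
    · refine (integrable_sphere ?_).const_mul _
      refine continuous_finsetSum _ fun i _ => ?_
      exact ((differentiable_coord i).continuous.comp continuous_subtype_val).mul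
        ((hX i).continuous.comp (by fun_prop))
  simp only [hmean, flux]
  ring

/-- A du Bois-Reymond argument. Integrating by parts in the radial weak form gives ∫ 2rψ(r²)(flux -
c) dr = 0 for every admissible ψ, where c(r) is the integral of the divergence over the ball of
radius r. Taking ψ(r²) to be flux - c times a nonnegative cutoff forces flux = c. -/
theorem integral_dvg_eq_flux (hn : 1 ≤ n) {X : Fin n → Space n → ℝ}
    (hX : ∀ i, ContDiff ℝ 1 (X i)) {R : ℝ} (hR : 0 < R) :
    ∫ r in (0 : ℝ)..R, r ^ (n - 1) * sphMean (dvg X) r = flux X R := by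
  set d : ℝ → ℝ := fun r => r ^ (n - 1) * sphMean (dvg X) r with hd
  have hdc : Continuous d := continuous_polar_density (continuous_dvg hX)
  set c : ℝ → ℝ := fun r => ∫ t in (0 : ℝ)..r, d t with hc
  have hcd : ∀ r, HasDerivAt c (d r) r := fun r =>
    intervalIntegral.integral_hasDerivAt_right (hdc.intervalIntegrable 0 r)
      (hdc.stronglyMeasurableAtFilter _ _) hdc.continuousAt
  have hcc : Continuous c := continuous_iff_continuousAt.2 fun r => (hcd r).continuousAt
  have hfc := continuous_flux hX
  -- Any radius beyond R serves: the weight B² - r² must be positive at r = R.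
  set B : ℝ := R + 1 with hBdef
  have hB : 0 ≤ B := by positivity
  let ψ : ℝ → ℝ := fun s => (flux X √s - c √s) * max 0 (B ^ 2 - s)
  have hψ : Continuous ψ := by
    refine ((hfc.comp Real.continuous_sqrt).sub (hcc.comp Real.continuous_sqrt)).mul ?_
    fun_prop
  let φ : ℝ → ℝ := fun s => ∫ t in (B ^ 2)..s, ψ t
  have hφ : ∀ s, HasDerivAt φ (ψ s) s := fun s =>
    intervalIntegral.integral_hasDerivAt_right (hψ.intervalIntegrable _ s)
      (hψ.stronglyMeasurableAtFilter _ _) hψ.continuousAt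
  have hφc : Continuous φ := continuous_iff_continuousAt.2 fun r => (hφ r).continuousAt
  have hsupp : ∀ s, B ^ 2 ≤ s → φ s = 0 := by
    intro s hs
    rw [← intervalIntegral.integral_zero (a := B ^ 2) (b := s)]
    refine intervalIntegral.integral_congr fun t ht => ?_
    rw [Set.uIcc_of_le hs] at ht
    simp only [ψ]
    rw [max_eq_left (by linarith [ht.1]), mul_zero]
  have htest := integral_radial_test hn hX hφ hψ hB hsupp
  have hφr : ∀ r : ℝ, HasDerivAt (fun r => φ (r ^ 2)) (ψ (r ^ 2) * (2 * r)) r := by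
    intro r
    have h := hasDerivAt_pow 2 r
    have := (hφ (r ^ 2)).comp r h
    simpa [Function.comp_def] using this
  -- Both boundary terms vanish, because φ(B²) = 0 and c(0) = 0.
  have hparts := intervalIntegral.integral_mul_deriv_eq_deriv_mul (a := 0) (b := B)
    (u := fun r => φ (r ^ 2)) (u' := fun r => ψ (r ^ 2) * (2 * r)) (v := c) (v' := d)
    (fun r _ => hφr r) (fun r _ => hcd r)
    (by apply Continuous.intervalIntegrable; fun_prop) (hdc.intervalIntegrable _ _)
  rw [hsupp _ le_rfl, show c 0 = 0 by simp [hc], zero_mul, mul_zero, sub_zero, zero_sub] at hparts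
  have hzero : ∫ r in (0 : ℝ)..B, 2 * r * max 0 (B ^ 2 - r ^ 2) * (flux X r - c r) ^ 2 = 0 := by
    have e1 : ∫ r in (0 : ℝ)..B, 2 * r * max 0 (B ^ 2 - r ^ 2) * (flux X r - c r) ^ 2
        = ∫ r in (0 : ℝ)..B, ((φ (r ^ 2) * d r + 2 * r * ψ (r ^ 2) * flux X r)
            - (φ (r ^ 2) * d r + ψ (r ^ 2) * (2 * r) * c r)) := by
      refine intervalIntegral.integral_congr fun r hr => ?_
      rw [Set.uIcc_of_le hB] at hr
      simp only [ψ, Real.sqrt_sq hr.1]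
      ring
    rw [e1, intervalIntegral.integral_sub, htest, intervalIntegral.integral_add, hparts]
    · ring
    all_goals
      apply Continuous.intervalIntegrable
      fun_prop
  have hcont : Continuous fun r : ℝ => 2 * r * max 0 (B ^ 2 - r ^ 2) * (flux X r - c r) ^ 2 := by
    fun_prop
  by_contra hne
  have hpos : 0 < ∫ r in (0 : ℝ)..B, 2 * r * max 0 (B ^ 2 - r ^ 2) * (flux X r - c r) ^ 2 := by
    refine intervalIntegral.integral_pos (by positivity) hcont.continuousOn ?_
      ⟨R, ⟨hR.le, by linarith⟩, ?_⟩
    · intro r hr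
      have := hr.1.le
      positivity
    · have h1 : 0 < B ^ 2 - R ^ 2 := by rw [hBdef]; nlinarith
      have h2 : flux X R - c R ≠ 0 := sub_ne_zero.2 fun h => hne h.symm
      rw [max_eq_right h1.le]
      positivity
  exact hpos.ne' hzero

theorem flux_eq (X : Fin n → Space n → ℝ) {r : ℝ} (hr : r ≠ 0) :
    flux X r = r ^ (n - 1) * (r⁻¹ * sphMean (fun y => ∑ i, y i * X i y) r) := by
  simp only [flux, sphMean, unitSphereIntegral]
  rw [← integral_const_mul r⁻¹]
  congr 2
  funext θ
  rw [Finset.mul_sum]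
  refine Finset.sum_congr rfl fun i _ => ?_
  simp
  field_simp

/-- The divergence theorem on a ball centred at the origin. -/
theorem integral_ball_dvg (hn : 1 ≤ n) {X : Fin n → Space n → ℝ}
    (hX : ∀ i, ContDiff ℝ 1 (X i)) {R : ℝ} (hR : 0 < R) :
    ∫ y in Metric.ball 0 R, dvg X y
      = R ^ (n - 1) * (R⁻¹ * sphMean (fun y => ∑ i, y i * X i y) R) := by
  rw [integral_ball_polar hn (continuous_dvg hX) hR.le, integral_dvg_eq_flux hn hX hR,
    flux_eq X hR.ne']

/-- The divergence of a tangential field has mean zero on spheres. -/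
theorem sphMean_dvg_eq_zero (hn : 1 ≤ n) {X : Fin n → Space n → ℝ}
    (hX : ∀ i, ContDiff ℝ 1 (X i)) (ht : ∀ y, ∑ i, y i * X i y = 0) {R : ℝ} (hR : 0 < R) :
    sphMean (dvg X) R = 0 := by
  have h1 := hasDerivAt_integral_ball hn (continuous_dvg hX) hR
  -- A tangential field has no flux through any sphere, so its divergence integrates to zero over
  -- every ball; the derivative in the radius is the spherical mean up to a positive factor.
  have h2 : HasDerivAt (fun r => ∫ y in Metric.ball 0 r, dvg X y) 0 R := by
    refine (hasDerivAt_const R (0 : ℝ)).congr_of_eventuallyEq ?_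
    filter_upwards [lt_mem_nhds hR] with r hr
    rw [integral_ball_dvg hn hX hr]
    simp only [ht, sphMean, unitSphereIntegral, integral_zero, mul_zero]
  have h3 := h1.unique h2
  have h4 : R ^ (n - 1) ≠ 0 := by positivity
  simpa [h4] using h3

/-- The components of the spherical gradient `|y|² ∇g - (y · ∇g) y`. -/
def tanComp (g : Space n → ℝ) (i : Fin n) (y : Space n) : ℝ :=
  ‖y‖ ^ 2 * pd i g y - euler g y * y i

theorem contDiff_tanComp {m N : WithTop ℕ∞} {g : Space n → ℝ} (hg : ContDiff ℝ N g)
    (h : m + 1 ≤ N) (i : Fin n) : ContDiff ℝ m (tanComp g i) :=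
  ((contDiff_norm_sq ℝ).mul (contDiff_pd hg h i)).sub
    ((contDiff_euler hg h).mul (contDiff_coord i))

theorem sum_mul_tanComp (f g : Space n → ℝ) (y : Space n) :
    ∑ i, pd i f y * tanComp g i y = gam f g y := by
  have : ∀ i, pd i f y * tanComp g i y
      = ‖y‖ ^ 2 * (pd i f y * pd i g y) - euler g y * (y i * pd i f y) := fun i => by
    rw [tanComp]
    ring
  simp_rw [this, Finset.sum_sub_distrib, ← Finset.mul_sum, ← euler_eq_sum]
  rw [gam, inner_gradient_gradient]
  ring

theorem sum_coord_mul_tanComp (g : Space n → ℝ) (y : Space n) :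
    ∑ i, y i * tanComp g i y = 0 := by
  have : ∀ i, y i * tanComp g i y = ‖y‖ ^ 2 * (y i * pd i g y) - euler g y * (y i * y i) :=
    fun i => by
      rw [tanComp]
      ring
  simp_rw [this, Finset.sum_sub_distrib, ← Finset.mul_sum, ← euler_eq_sum, sum_sq_eq_normSq]
  ring

/-- Expanding div(|y|² ∇g - (𝓔g) y) gives |y|² Δg + 2 𝓔g - n 𝓔g - 𝓔²g. The extension of the
spherical gradient used in `tanComp` is thus the one whose Euclidean divergence is exactly `sph`,
off the unit sphere as well. -/
theorem dvg_tanComp {g : Space n → ℝ} (hg : ContDiff ℝ 2 g) (y : Space n) :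
    dvg (tanComp g) y = sph g y := by
  have hpdd : ∀ i, Differentiable ℝ (pd i g) := fun i =>
    (contDiff_pd hg (m := 1) (by norm_num) i).differentiable (by norm_num)
  have hed : Differentiable ℝ (euler g) :=
    (contDiff_euler hg (m := 1) (by norm_num)).differentiable (by norm_num)
  have hpdY : ∀ i, pd i (tanComp g i) y = 2 * (y i * pd i g y) + ‖y‖ ^ 2 * pd i (pd i g) y
      - euler g y - y i * pd i (euler g) y := by
    intro i
    unfold tanComp
    rw [pd_sub ((differentiable_normSq y).fun_mul (hpdd i y))
      ((hed y).fun_mul (differentiable_coord i y)), pd_mul (differentiable_normSq y) (hpdd i y),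
      pd_mul (hed y) (differentiable_coord i y), pd_normSq, pd_coord]
    simp
    ring
  rw [dvg]
  simp_rw [hpdY, Finset.sum_sub_distrib, Finset.sum_add_distrib, ← Finset.mul_sum, ← euler_eq_sum]
  rw [sph, laplacian_eq_sum hg]
  simp
  ring

/-- Integration by parts on spheres. -/
theorem sphMean_mul_sph (hn : 1 ≤ n) {f g : Space n → ℝ} (hf : ContDiff ℝ 1 f)
    (hg : ContDiff ℝ 2 g) {R : ℝ} (hR : 0 < R) :
    sphMean (fun y => f y * sph g y + gam f g y) R = 0 := by
  have hY : ∀ i, ContDiff ℝ 1 (tanComp g i) := fun i => contDiff_tanComp hg (by norm_num) i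
  -- The field f · (|y|² ∇g - (𝓔g) y) is tangential, and the product rule for its divergence yields
  -- the integrand.
  have hdiv : (fun y => f y * sph g y + gam f g y) = dvg fun i y => f y * tanComp g i y := by
    funext y
    rw [← dvg_tanComp hg, ← sum_mul_tanComp, dvg, dvg, Finset.mul_sum, ← Finset.sum_add_distrib]
    exact Finset.sum_congr rfl fun i _ => (pd_mul (hf.differentiable (by norm_num) y)
      ((hY i).differentiable (by norm_num) y) i).symm
  rw [hdiv]
  refine sphMean_dvg_eq_zero hn (fun i => hf.mul (hY i)) (fun y => ?_) hR
  have : ∀ i, y i * (f y * tanComp g i y) = f y * (y i * tanComp g i y) := fun i => by ring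
  simp_rw [this, ← Finset.mul_sum, sum_coord_mul_tanComp, mul_zero]

/-! ### The ladder of scaling derivatives -/

/-- `ladder c f j = (𝓔 + c - (j - 1)) ⋯ (𝓔 + c) f` with `𝓔` the Euler operator; it satisfies
`∂_t^j (t^c f(tθ)) = t^(c-j) (ladder c f j)(tθ)`. -/
def ladder (c : ℝ) (f : Space n → ℝ) : ℕ → Space n → ℝ
  | 0 => f
  | j + 1 => fun y => euler (ladder c f j) y + (c - j) * ladder c f j y

/-- Each rung costs one derivative, so the order `m` has to vary in the induction. -/
theorem contDiff_ladder (c : ℝ) {f : Space n → ℝ} (j : ℕ) :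
    ∀ {m : WithTop ℕ∞}, ContDiff ℝ (m + j) f → ContDiff ℝ m (ladder c f j) := by
  induction j with
  | zero => intro m hf; simpa [ladder] using hf
  | succ j ih =>
    intro m hf
    have h : ContDiff ℝ (m + 1) (ladder c f j) := ih (by
      have e : m + ((j + 1 : ℕ) : WithTop ℕ∞) = m + 1 + j := by
        push_cast
        rw [add_comm (j : WithTop ℕ∞) 1, add_assoc]
      rwa [e] at hf)
    exact (contDiff_euler h le_rfl).add (contDiff_const.mul (h.of_le (by simp)))

theorem contDiff_ladder_of_le (c : ℝ) {f : Space n → ℝ} (j : ℕ) {m N : WithTop ℕ∞}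
    (hf : ContDiff ℝ N f) (h : m + j ≤ N) : ContDiff ℝ m (ladder c f j) :=
  contDiff_ladder c j (hf.of_le h)

theorem euler_ladder (c : ℝ) (f : Space n → ℝ) (j : ℕ) (y : Space n) :
    euler (ladder c f j) y = ladder c f (j + 1) y - (c - j) * ladder c f j y := by
  rw [ladder]
  ring

theorem ladder_one (c : ℝ) (f : Space n → ℝ) :
    ladder c f 1 = fun y => euler f y + c * f y := by
  funext y
  simp [ladder]

/-- The expansions in powers of 𝓔 serve to compare ladders of different weights: weight 0 encodes
iterated radial derivatives, weight κ the derivatives of u^λ. -/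
theorem ladder_two (c : ℝ) {f : Space n → ℝ} (hf : ContDiff ℝ 4 f) :
    ladder c f 2 = fun y => euler (euler f) y + ((2 * c - 1) * euler f y + c * (c - 1) * f y) := by
  have h0 := hf.differentiable (by norm_num)
  have h1 := (contDiff_euler hf (m := 3) (by norm_num)).differentiable (by norm_num)
  funext y
  change euler (ladder c f 1) y + (c - (1 : ℕ)) * ladder c f 1 y = _
  rw [ladder_one, euler_add (h1 y) ((h0 y).const_mul c), euler_const_mul (h0 y)]
  push_cast
  ring

theorem ladder_three (c : ℝ) {f : Space n → ℝ} (hf : ContDiff ℝ 4 f) :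
    ladder c f 3 = fun y => euler (euler (euler f)) y + ((3 * c - 3) * euler (euler f) y
      + ((3 * c ^ 2 - 6 * c + 2) * euler f y + c * (c - 1) * (c - 2) * f y)) := by
  have h0 := hf.differentiable (by norm_num)
  have c1 := contDiff_euler hf (m := 3) (by norm_num)
  have h1 := c1.differentiable (by norm_num)
  have h2 := (contDiff_euler c1 (m := 2) (by norm_num)).differentiable (by norm_num)
  funext y
  change euler (ladder c f 2) y + (c - (2 : ℕ)) * ladder c f 2 y = _
  rw [ladder_two c hf,
    euler_add (h2 y) (((h1 y).const_mul _).fun_add ((h0 y).const_mul _)),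
    euler_add ((h1 y).const_mul _) ((h0 y).const_mul _), euler_const_mul (h1 y),
    euler_const_mul (h0 y)]
  push_cast
  ring

theorem ladder_four (c : ℝ) {f : Space n → ℝ} (hf : ContDiff ℝ 4 f) :
    ladder c f 4 = fun y => euler (euler (euler (euler f))) y
      + (4 * c - 6) * euler (euler (euler f)) y
      + (6 * c ^ 2 - 18 * c + 11) * euler (euler f) y
      + (4 * c ^ 3 - 18 * c ^ 2 + 22 * c - 6) * euler f y
      + c * (c - 1) * (c - 2) * (c - 3) * f y := by
  have h0 := hf.differentiable (by norm_num)
  have c1 := contDiff_euler hf (m := 3) (by norm_num)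
  have h1 := c1.differentiable (by norm_num)
  have c2 := contDiff_euler c1 (m := 2) (by norm_num)
  have h2 := c2.differentiable (by norm_num)
  have h3 := (contDiff_euler c2 (m := 1) (by norm_num)).differentiable (by norm_num)
  funext y
  change euler (ladder c f 3) y + (c - (3 : ℕ)) * ladder c f 3 y = _
  rw [ladder_three c hf,
    euler_add (h3 y) (((h2 y).const_mul _).fun_add (((h1 y).const_mul _).fun_add
      ((h0 y).const_mul _))),
    euler_add ((h2 y).const_mul _) (((h1 y).const_mul _).fun_add ((h0 y).const_mul _)),
    euler_add ((h1 y).const_mul _) ((h0 y).const_mul _), euler_const_mul (h2 y),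
    euler_const_mul (h1 y), euler_const_mul (h0 y)]
  push_cast
  ring

theorem euler_sph_ladder (c : ℝ) {f : Space n → ℝ} (j : ℕ) (hf : ContDiff ℝ 3 (ladder c f j))
    (y : Space n) :
    euler (sph (ladder c f j)) y
      = sph (ladder c f (j + 1)) y - (c - j) * sph (ladder c f j) y := by
  have h2 : ContDiff ℝ 2 (ladder c f j) := hf.of_le (by norm_num)
  rw [euler_sph hf, ladder, sph_add (contDiff_euler hf (by norm_num)) (contDiff_const.mul h2),
    sph_const_mul h2]
  ring

theorem gam_ladder_succ_left (c : ℝ) {f g : Space n → ℝ} (j : ℕ)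
    (hf : ContDiff ℝ 2 (ladder c f j)) (y : Space n) :
    gam (euler (ladder c f j)) g y
      = gam (ladder c f (j + 1)) g y - (c - j) * gam (ladder c f j) g y := by
  have h0 := hf.differentiable (by norm_num)
  have h1 := (contDiff_euler hf (m := 1) (by norm_num)).differentiable (by norm_num)
  rw [ladder, gam_add_left (h1 y) ((h0 y).const_mul _), gam_const_mul_left (h0 y)]
  ring

theorem euler_gam_ladder (c : ℝ) {f : Space n → ℝ} (i j : ℕ) (hi : ContDiff ℝ 2 (ladder c f i))
    (hj : ContDiff ℝ 2 (ladder c f j)) (y : Space n) :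
    euler (gam (ladder c f i) (ladder c f j)) y
      = gam (ladder c f (i + 1)) (ladder c f j) y + gam (ladder c f i) (ladder c f (j + 1)) y
        - (2 * c - i - j) * gam (ladder c f i) (ladder c f j) y := by
  rw [euler_gam hi hj, gam_comm (ladder c f i) (euler _), gam_ladder_succ_left c i hi,
    gam_ladder_succ_left c j hj, gam_comm (ladder c f (j + 1)), gam_comm (ladder c f j)]
  ring

/-- This is |y|² Δ = 𝓔² + (n-2) 𝓔 + `sph`, with 𝓔 and 𝓔² eliminated in favour of the first two
rungs. -/
theorem normSq_mul_laplacian_ladder (c : ℝ) {f : Space n → ℝ} (hf : ContDiff ℝ 4 f) (y : Space n) :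
    ‖y‖ ^ 2 * (Δ f) y = ladder c f 2 y + ((n - 1 - 2 * c) * ladder c f 1 y
      + (c * (c + 2 - n) * ladder c f 0 y + sph (ladder c f 0) y)) := by
  rw [normSq_mul_laplacian, ladder_two c hf, ladder_one, ladder]
  ring

/-- The commutator of the Laplacian with the scaling derivative. -/
theorem laplacian_ladder_one (c : ℝ) {f : Space n → ℝ} (hf : ContDiff ℝ 3 f) (y : Space n) :
    (Δ (ladder c f 1)) y = euler (Δ f) y + (c + 2) * (Δ f) y := by
  have h2 : ContDiff ℝ 2 f := hf.of_le (by norm_num)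
  have he : ContDiff ℝ 2 (euler f) := contDiff_euler hf (by norm_num)
  have h : (Δ (fun z => euler f z + c * f z)) y = (Δ (euler f)) y + (Δ (fun z => c * f z)) y :=
    ContDiffAt.laplacian_add he.contDiffAt (contDiff_const.mul h2).contDiffAt
  have h' : (Δ (fun z => c * f z)) y = c * (Δ f) y :=
    InnerProductSpace.laplacian_smul c h2.contDiffAt
  rw [ladder_one, h, h', laplacian_euler hf]
  ring

/-- The bilaplacian in terms of the scaling derivatives and the spherical Laplacian. -/
theorem norm_pow_mul_bilaplacian (c : ℝ) {f : Space n → ℝ} (hf : ContDiff ℝ 6 f) (y : Space n) :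
    ‖y‖ ^ 4 * (Δ (Δ f)) y
      = ladder c f 4 y
        + (2 * ((n : ℝ) - 1) - 4 * c) * ladder c f 3 y
        + (6 * c * (1 + c) - 6 * ((n : ℝ) - 1) * c + ((n : ℝ) - 1) * ((n : ℝ) - 3))
          * ladder c f 2 y
        + (-4 * c * (1 + c) * (2 + c) + 6 * ((n : ℝ) - 1) * c * (1 + c)
          - ((n : ℝ) - 1) * ((n : ℝ) - 3) * (1 + 2 * c)) * ladder c f 1 y
        + (c * (1 + c) * (2 + c) * (3 + c) - 2 * ((n : ℝ) - 1) * c * (1 + c) * (2 + c)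
          + ((n : ℝ) - 1) * ((n : ℝ) - 3) * c * (2 + c)) * ladder c f 0 y
        + 2 * sph (ladder c f 2) y
        + 2 * (n - 3 - 2 * c) * sph (ladder c f 1) y
        + 2 * (c * (4 + c - n) - n + 4) * sph (ladder c f 0) y
        + sph (sph (ladder c f 0)) y := by
  have hf4 : ContDiff ℝ 4 f := hf.of_le (by norm_num)
  have w0 : ContDiff ℝ 6 (ladder c f 0) := contDiff_ladder_of_le c 0 hf (by norm_num)
  have w1 : ContDiff ℝ 5 (ladder c f 1) := contDiff_ladder_of_le c 1 hf (by norm_num)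
  have w2 : ContDiff ℝ 4 (ladder c f 2) := contDiff_ladder_of_le c 2 hf (by norm_num)
  have w3 : ContDiff ℝ 3 (ladder c f 3) := contDiff_ladder_of_le c 3 hf (by norm_num)
  have s0 : ContDiff ℝ 4 (sph (ladder c f 0)) := contDiff_sph w0 (by norm_num)
  have s1 : ContDiff ℝ 3 (sph (ladder c f 1)) := contDiff_sph w1 (by norm_num)
  have v : ContDiff ℝ 4 (Δ f) := contDiff_laplacian hf (by norm_num)
  have d0 := w0.differentiable (by norm_num)
  have d1 := w1.differentiable (by norm_num)
  have d2 := w2.differentiable (by norm_num)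
  have d3 := w3.differentiable (by norm_num)
  have e0 := s0.differentiable (by norm_num)
  have e1 := s1.differentiable (by norm_num)
  have dv := v.differentiable (by norm_num)
  set a : ℝ := n - 1 - 2 * c with ha
  set b : ℝ := c * (c + 2 - n) with hb
  -- With F = |y|² Δf in ladder form, the same polar decomposition is applied to F; this requires
  -- 𝓔F, 𝓔²F and `sph` F.
  have hL : (fun y : Space n => ‖y‖ ^ 2 * (Δ f) y) = fun y => ladder c f 2 y + (a * ladder c f 1 y
      + (b * ladder c f 0 y + sph (ladder c f 0) y)) :=
    funext (normSq_mul_laplacian_ladder c hf4)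
  have hE : euler (fun y : Space n => ‖y‖ ^ 2 * (Δ f) y) = fun y =>
      ladder c f 3 y + ((a - (c - 2)) * ladder c f 2 y + ((b - a * (c - 1)) * ladder c f 1 y
        + (-b * c * ladder c f 0 y + (sph (ladder c f 1) y + (-c) * sph (ladder c f 0) y)))) := by
    funext z
    rw [hL, euler_add (d2 z) (((d1 z).const_mul _).fun_add (((d0 z).const_mul _).fun_add (e0 z))),
      euler_add ((d1 z).const_mul _) (((d0 z).const_mul _).fun_add (e0 z)),
      euler_add ((d0 z).const_mul _) (e0 z), euler_const_mul (d1 z), euler_const_mul (d0 z),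
      euler_ladder, euler_ladder, euler_ladder, euler_sph_ladder c 0 (w0.of_le (by norm_num))]
    push_cast
    ring
  have hEE : euler (euler (fun y : Space n => ‖y‖ ^ 2 * (Δ f) y)) y =
      (ladder c f 4 y - (c - 3) * ladder c f 3 y)
      + (a - (c - 2)) * (ladder c f 3 y - (c - 2) * ladder c f 2 y)
      + (b - a * (c - 1)) * (ladder c f 2 y - (c - 1) * ladder c f 1 y)
      - b * c * (ladder c f 1 y - c * ladder c f 0 y)
      + (sph (ladder c f 2) y - (c - 1) * sph (ladder c f 1) y)
      - c * (sph (ladder c f 1) y - c * sph (ladder c f 0) y) := by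
    rw [hE, euler_add (d3 y) (((d2 y).const_mul _).fun_add (((d1 y).const_mul _).fun_add
      (((d0 y).const_mul _).fun_add ((e1 y).fun_add ((e0 y).const_mul _))))),
      euler_add ((d2 y).const_mul _) (((d1 y).const_mul _).fun_add
      (((d0 y).const_mul _).fun_add ((e1 y).fun_add ((e0 y).const_mul _)))),
      euler_add ((d1 y).const_mul _) (((d0 y).const_mul _).fun_add
        ((e1 y).fun_add ((e0 y).const_mul _))),
      euler_add ((d0 y).const_mul _) ((e1 y).fun_add ((e0 y).const_mul _)),
      euler_add (e1 y) ((e0 y).const_mul _),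
      euler_const_mul (d2 y), euler_const_mul (d1 y), euler_const_mul (d0 y),
      euler_const_mul (e0 y),
      euler_ladder, euler_ladder, euler_ladder, euler_ladder,
      euler_sph_ladder c 0 (w0.of_le (by norm_num)), euler_sph_ladder c 1 (w1.of_le (by norm_num))]
    push_cast
    ring
  have hS : sph (fun y : Space n => ‖y‖ ^ 2 * (Δ f) y) y = sph (ladder c f 2) y
      + (a * sph (ladder c f 1) y + (b * sph (ladder c f 0) y + sph (sph (ladder c f 0)) y)) := by
    have w0' : ContDiff ℝ 2 (ladder c f 0) := w0.of_le (by norm_num)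
    have w1' : ContDiff ℝ 2 (ladder c f 1) := w1.of_le (by norm_num)
    have w2' : ContDiff ℝ 2 (ladder c f 2) := w2.of_le (by norm_num)
    have s0' : ContDiff ℝ 2 (sph (ladder c f 0)) := s0.of_le (by norm_num)
    rw [hL, sph_add w2' ((contDiff_const.mul w1').add ((contDiff_const.mul w0').add s0')),
      sph_add (contDiff_const.mul w1') ((contDiff_const.mul w0').add s0'),
      sph_add (contDiff_const.mul w0') s0', sph_const_mul w1', sph_const_mul w0']
  have hlap := laplacian_normSq_mul (v.of_le (by norm_num) : ContDiff ℝ 2 (Δ f)) y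
  have hmul := euler_mul (differentiable_normSq y) (dv y)
  rw [euler_normSq] at hmul
  have hL' := congrFun hL y
  have hE' := congrFun hE y
  have hN := normSq_mul_laplacian (fun y : Space n => ‖y‖ ^ 2 * (Δ f) y) y
  -- Commuting |y|² past the outer Laplacian: |y|⁴ Δv = |y|² Δ(|y|²v) - 4 𝓔(|y|²v) + (8 - 2n)|y|²v,
  -- where v = Δf.
  have key : ‖y‖ ^ 4 * (Δ (Δ f)) y
      = ‖y‖ ^ 2 * (Δ (fun y : Space n => ‖y‖ ^ 2 * (Δ f) y)) y
        - 4 * euler (fun y : Space n => ‖y‖ ^ 2 * (Δ f) y) y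
        + (8 - 2 * n) * (‖y‖ ^ 2 * (Δ f) y) := by
    rw [hlap, hmul]
    ring
  rw [key, hN, hEE, hS]
  rw [hE', hL', ha, hb]
  ring

/-! ### The derivative of the bulk energy -/

theorem dvg_mul_pd {f g : Space n → ℝ} (hf : ContDiff ℝ 1 f) (hg : ContDiff ℝ 2 g) (y : Space n) :
    dvg (fun i z => f z * pd i g z) y = f y * (Δ g) y + ∑ i, pd i f y * pd i g y := by
  have hfd := hf.differentiable (by norm_num)
  have hgd : ∀ i, Differentiable ℝ (pd i g) := fun i =>
    (contDiff_pd hg (m := 1) (by norm_num) i).differentiable (by norm_num)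
  rw [dvg, laplacian_eq_sum hg, Finset.mul_sum, ← Finset.sum_add_distrib]
  exact Finset.sum_congr rfl fun i _ => pd_mul (hfd y) (hgd i y) i

theorem dvg_mul_coord {h : Space n → ℝ} (hh : Differentiable ℝ h) (y : Space n) :
    dvg (fun i z => h z * z i) y = n * h y + euler h y := by
  rw [dvg, euler_eq_sum]
  simp_rw [pd_mul (hh y) (differentiable_coord _ y), pd_coord]
  simp [Finset.sum_add_distrib, mul_comm]

theorem kappa_mul_sub_one {p : ℝ} (hp : 1 < p) : kappa p * (p - 1) = 6 := by
  rw [kappa, div_mul_cancel₀]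
  linarith

/-- The density of the bulk energy. -/
def bulkDensity (p : ℝ) (U : Space n → ℝ) (y : Space n) : ℝ :=
  1 / 2 * ‖∇ (Δ U) y‖ ^ 2 - 1 / (p + 1) * |U y| ^ (p + 1)

/-- The vector field whose divergence is the scaling derivative of the bulk density. -/
def bulkField (p : ℝ) (U : Space n → ℝ) (i : Fin n) (y : Space n) : ℝ :=
  (Δ (ladder (kappa p) U 1)) y * pd i (Δ U) y - (Δ (Δ U)) y * pd i (ladder (kappa p) U 1) y
    + ladder (kappa p) U 1 y * pd i (Δ (Δ U)) y

/-- The boundary term of the derivative of the bulk energy. -/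
def bulkBoundary (p : ℝ) (U : Space n → ℝ) (y : Space n) : ℝ :=
  (Δ (ladder (kappa p) U 1)) y * euler (Δ U) y - (Δ (Δ U)) y * euler (ladder (kappa p) U 1) y
    + ladder (kappa p) U 1 y * euler (Δ (Δ U)) y

section Bulk

variable {p : ℝ} {U : Space n → ℝ}

theorem contDiff_bulkDensity (hp : 1 < p) (hU : ContDiff ℝ 6 U) :
    ContDiff ℝ 1 (bulkDensity p U) := by
  have hv : ContDiff ℝ 4 (Δ U) := contDiff_laplacian hU (by norm_num)
  have h : bulkDensity p U
      = fun y => 1 / 2 * ∑ i, pd i (Δ U) y ^ 2 - 1 / (p + 1) * ‖U y‖ ^ (p + 1) := by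
    funext y
    rw [bulkDensity, norm_gradient_sq, Real.norm_eq_abs]
  rw [h]
  refine (contDiff_const.mul (ContDiff.sum fun i _ => (contDiff_pd hv (by norm_num) i).pow 2)).sub
    (contDiff_const.mul ?_)
  exact (contDiff_norm_rpow (by linarith : 1 < p + 1)).comp (hU.of_le (by norm_num))

theorem euler_bulkDensity (hp : 1 < p) (hU : ContDiff ℝ 6 U) (y : Space n) :
    euler (bulkDensity p U) y
      = ∑ i, pd i (Δ U) y * (pd i (euler (Δ U)) y - pd i (Δ U) y)
        - |U y| ^ (p - 1) * U y * euler U y := by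
  have hv : ContDiff ℝ 4 (Δ U) := contDiff_laplacian hU (by norm_num)
  have hv2 : ContDiff ℝ 2 (Δ U) := hv.of_le (by norm_num)
  have hpd : ∀ i, Differentiable ℝ (pd i (Δ U)) := fun i =>
    (contDiff_pd hv (m := 1) (by norm_num) i).differentiable (by norm_num)
  have hUd : Differentiable ℝ U := hU.differentiable (by norm_num)
  have hrp : HasFDerivAt (fun z => |U z| ^ (p + 1))
      (((p + 1) * |U y| ^ (p + 1 - 2) * U y) • fderiv ℝ U y) y :=
    (hasDerivAt_abs_rpow (U y) (by linarith : 1 < p + 1)).comp_hasFDerivAt y (hUd y).hasFDerivAt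
  have hre : euler (fun z => |U z| ^ (p + 1)) y = (p + 1) * |U y| ^ (p - 1) * U y * euler U y := by
    rw [euler, hrp.fderiv, show p + 1 - 2 = p - 1 by ring]
    rfl
  have h : bulkDensity p U
      = fun y => 1 / 2 * (∑ i, pd i (Δ U) y * pd i (Δ U) y) - 1 / (p + 1) * |U y| ^ (p + 1) := by
    funext y
    rw [bulkDensity, norm_gradient_sq]
    simp [sq]
  have hs : DifferentiableAt ℝ (fun z => ∑ i, pd i (Δ U) z * pd i (Δ U) z) y :=
    DifferentiableAt.fun_sum fun i _ => (hpd i y).fun_mul (hpd i y)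
  have hp1 : p + 1 ≠ 0 := by linarith
  rw [h, euler_sub (hs.const_mul _) (hrp.differentiableAt.const_mul _), euler_const_mul hs,
    euler_const_mul hrp.differentiableAt, hre, euler_sum _ (fun i _ => (hpd i y).fun_mul (hpd i y))]
  simp_rw [euler_mul (hpd _ y) (hpd _ y), pd_euler hv2, Finset.mul_sum]
  congr 1
  · exact Finset.sum_congr rfl fun i _ => by ring
  · field_simp

theorem contDiff_bulkField (hU : ContDiff ℝ 6 U) (i : Fin n) : ContDiff ℝ 1 (bulkField p U i) := by
  have hv : ContDiff ℝ 4 (Δ U) := contDiff_laplacian hU (by norm_num)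
  have hvv : ContDiff ℝ 2 (Δ (Δ U)) := contDiff_laplacian hv (by norm_num)
  have hw : ContDiff ℝ 5 (ladder (kappa p) U 1) := contDiff_ladder_of_le _ 1 hU (by norm_num)
  have hlw : ContDiff ℝ 1 (Δ (ladder (kappa p) U 1)) := contDiff_laplacian hw (by norm_num)
  exact ((hlw.mul (contDiff_pd hv (by norm_num) i)).sub
    ((hvv.of_le (by norm_num)).mul (contDiff_pd hw (by norm_num) i))).add
    ((hw.of_le (by norm_num)).mul (contDiff_pd hvv (by norm_num) i))

/-- Write w = (𝓔 + κ)U. In the divergence of the field, the products of Δw with Δ²U and of ∇w with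
∇Δ²U cancel, leaving ∇Δw · ∇ΔU + w Δ³U. By the equation this is the variation of the density h along
w, hence (𝓔 + 2κ + 6)h by scaling. Splitting off div(h y) = 𝓔h + n h leaves the factor 2κ + 6 - n,
the exponent in front of the bulk integral. -/
theorem dvg_bulkField (hp : 1 < p) (hU : ContDiff ℝ 6 U)
    (heq : ∀ y, -(Δ (Δ (Δ U))) y = |U y| ^ (p - 1) * U y) (y : Space n) :
    dvg (bulkField p U) y
      = (2 * kappa p + 6 - n) * bulkDensity p U y
        + dvg (fun i z => bulkDensity p U z * z i) y := by
  have hv : ContDiff ℝ 4 (Δ U) := contDiff_laplacian hU (by norm_num)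
  have hvv : ContDiff ℝ 2 (Δ (Δ U)) := contDiff_laplacian hv (by norm_num)
  have hw : ContDiff ℝ 5 (ladder (kappa p) U 1) := contDiff_ladder_of_le _ 1 hU (by norm_num)
  have hlw : ContDiff ℝ 3 (Δ (ladder (kappa p) U 1)) := contDiff_laplacian hw (by norm_num)
  have hev : Differentiable ℝ (euler (Δ U)) :=
    (contDiff_euler hv (m := 3) (by norm_num)).differentiable (by norm_num)
  have hvd := hv.differentiable (by norm_num)
  have d1 : ∀ i, Differentiable ℝ fun z => (Δ (ladder (kappa p) U 1)) z * pd i (Δ U) z := fun i =>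
    (hlw.differentiable (by norm_num)).fun_mul
      ((contDiff_pd hv (m := 1) (by norm_num) i).differentiable (by norm_num))
  have d2 : ∀ i, Differentiable ℝ fun z => (Δ (Δ U)) z * pd i (ladder (kappa p) U 1) z := fun i =>
    (hvv.differentiable (by norm_num)).fun_mul
      ((contDiff_pd hw (m := 1) (by norm_num) i).differentiable (by norm_num))
  have d3 : ∀ i, Differentiable ℝ fun z => ladder (kappa p) U 1 z * pd i (Δ (Δ U)) z := fun i =>
    (hw.differentiable (by norm_num)).fun_mul
      ((contDiff_pd hvv (m := 1) (by norm_num) i).differentiable (by norm_num))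
  have hsplit : dvg (bulkField p U) y
      = dvg (fun i z => (Δ (ladder (kappa p) U 1)) z * pd i (Δ U) z) y
        - dvg (fun i z => (Δ (Δ U)) z * pd i (ladder (kappa p) U 1) z) y
        + dvg (fun i z => ladder (kappa p) U 1 z * pd i (Δ (Δ U)) z) y := by
    simp only [dvg]
    rw [← Finset.sum_sub_distrib, ← Finset.sum_add_distrib]
    refine Finset.sum_congr rfl fun i _ => ?_
    rw [← pd_sub (d1 i y) (d2 i y), ← pd_add ((d1 i y).fun_sub (d2 i y)) (d3 i y)]
    rfl
  have hlap : Δ (ladder (kappa p) U 1) = fun z => euler (Δ U) z + (kappa p + 2) * (Δ U) z :=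
    funext (laplacian_ladder_one _ (hU.of_le (by norm_num)))
  have hpdl : ∀ i, pd i (Δ (ladder (kappa p) U 1)) y
      = pd i (euler (Δ U)) y + (kappa p + 2) * pd i (Δ U) y := by
    intro i
    rw [hlap, pd_add (hev y) ((hvd y).const_mul _), pd_const_mul (hvd y)]
  rw [hsplit, dvg_mul_pd (hlw.of_le (by norm_num)) (hv.of_le (by norm_num)),
    dvg_mul_pd (hvv.of_le (by norm_num)) (hw.of_le (by norm_num)),
    dvg_mul_pd (hw.of_le (by norm_num)) hvv,
    dvg_mul_coord ((contDiff_bulkDensity hp hU).differentiable (by norm_num)),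
    euler_bulkDensity hp hU, bulkDensity, norm_gradient_sq]
  have h3 : (Δ (Δ (Δ U))) y = -(|U y| ^ (p - 1) * U y) := by rw [← heq y, neg_neg]
  have hpow : |U y| ^ (p + 1) = |U y| ^ (p - 1) * U y * U y := by
    rcases eq_or_ne (U y) 0 with h0 | h0
    · rw [h0, abs_zero, Real.zero_rpow (by linarith), mul_zero]
    · rw [show p + 1 = (p - 1) + 2 by ring, Real.rpow_add (abs_pos.2 h0), Real.rpow_two, sq_abs]
      ring
  -- The relation κ(p + 1) = 2κ + 6, which is where the choice κ = 6/(p - 1) enters: |U|^(p+1) and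
  -- |∇ΔU|² have the same weight.
  have hk : (2 * kappa p + 6) * (1 / (p + 1)) = kappa p := by
    have := kappa_mul_sub_one hp
    have hp1 : p + 1 ≠ 0 := by linarith
    field_simp
    linarith
  have hl1 : ladder (kappa p) U 1 y = euler U y + kappa p * U y := by rw [ladder_one]
  have hcomm : ∑ i, pd i (Δ (Δ U)) y * pd i (ladder (kappa p) U 1) y
      = ∑ i, pd i (ladder (kappa p) U 1) y * pd i (Δ (Δ U)) y :=
    Finset.sum_congr rfl fun i _ => mul_comm _ _
  have hsum : ∑ i, pd i (Δ (ladder (kappa p) U 1)) y * pd i (Δ U) y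
      = (kappa p + 3) * ∑ i, pd i (Δ U) y ^ 2
        + ∑ i, pd i (Δ U) y * (pd i (euler (Δ U)) y - pd i (Δ U) y) := by
    rw [Finset.mul_sum, ← Finset.sum_add_distrib]
    refine Finset.sum_congr rfl fun i _ => ?_
    rw [hpdl]
    ring
  rw [h3, hcomm, hsum, hl1, hpow]
  linear_combination (|U y| ^ (p - 1) * U y * U y) * hk

/-- The derivative of the bulk part of the energy is a boundary integral. -/
theorem hasDerivAt_bulk (hn : 1 ≤ n) (hp : 1 < p) (hU : ContDiff ℝ 6 U)
    (heq : ∀ y, -(Δ (Δ (Δ U))) y = |U y| ^ (p - 1) * U y) {R : ℝ} (hR : 0 < R) :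
    HasDerivAt (fun t : ℝ => t ^ (2 * kappa p + 6 - n) * ∫ y in Metric.ball 0 t, bulkDensity p U y)
      (R ^ (2 * kappa p - 1) * (R ^ 4 * sphMean (bulkBoundary p U) R)) R := by
  set e : ℝ := 2 * kappa p + 6 - n with he
  have hh := contDiff_bulkDensity hp hU
  have h1 := (Real.hasDerivAt_rpow_const (x := R) (p := e) (Or.inl hR.ne')).mul
    (hasDerivAt_integral_ball hn hh.continuous hR)
  refine h1.congr_deriv ?_
  have hX : ∀ i, ContDiff ℝ 1 (fun z : Space n => bulkDensity p U z * z i) := fun i =>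
    hh.mul (contDiff_coord i)
  have hY : ∀ i, ContDiff ℝ 1 (bulkField p U i) := fun i => contDiff_bulkField hU i
  have hint : ∀ {g : Space n → ℝ}, Continuous g → IntegrableOn g (Metric.ball 0 R) := fun hg =>
    (hg.continuousOn.integrableOn_compact (isCompact_closedBall 0 R)).mono_set
      Metric.ball_subset_closedBall
  -- The product rule for R^e ∫ h gives e ∫ h plus the flux of h y, up to powers of R. This is the
  -- integral of the divergence of `bulkField`, so only a boundary term survives.
  have hdiv : ∫ y in Metric.ball 0 R, dvg (bulkField p U) y
      = e * (∫ y in Metric.ball 0 R, bulkDensity p U y)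
        + ∫ y in Metric.ball 0 R, dvg (fun i z => bulkDensity p U z * z i) y := by
    simp_rw [dvg_bulkField hp hU heq]
    rw [integral_add ((hint hh.continuous).const_mul _) (hint (continuous_dvg hX)),
      integral_const_mul]
  rw [integral_ball_dvg hn hX hR, integral_ball_dvg hn hY hR] at hdiv
  have hflux1 : sphMean (fun y : Space n => ∑ i, y i * (bulkDensity p U y * y i)) R
      = R ^ 2 * sphMean (bulkDensity p U) R := by
    simp only [sphMean, unitSphereIntegral]
    rw [← integral_const_mul]
    refine integral_congr_ae (.of_forall fun θ => ?_)
    have hθ : ‖R • (θ : Space n)‖ ^ 2 = R ^ 2 := by simp [norm_smul]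
    simp only
    rw [← hθ, ← sum_sq_eq_normSq, Finset.sum_mul]
    exact Finset.sum_congr rfl fun i _ => by ring
  have hflux2 : (fun y : Space n => ∑ i, y i * bulkField p U i y) = bulkBoundary p U := by
    funext y
    rw [bulkBoundary, euler_eq_sum, euler_eq_sum, euler_eq_sum, Finset.mul_sum, Finset.mul_sum,
      Finset.mul_sum, ← Finset.sum_sub_distrib, ← Finset.sum_add_distrib]
    refine Finset.sum_congr rfl fun i _ => ?_
    rw [bulkField]
    ring
  rw [hflux1, hflux2] at hdiv
  have hpow1 : R ^ e = R ^ (e - 1) * R := by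
    rw [← Real.rpow_add_one hR.ne', sub_add_cancel]
  -- Exponent count: (e - 1) + (n - 1) - 1 = 2κ + 3 = (2κ - 1) + 4.
  have hpow2 : R ^ (e - 1) * (R ^ (n - 1) * R⁻¹) = R ^ (2 * kappa p - 1) * R ^ 4 := by
    rw [← Real.rpow_natCast R (n - 1), ← Real.rpow_natCast R 4, ← Real.rpow_neg_one,
      ← Real.rpow_add hR, ← Real.rpow_add hR, ← Real.rpow_add hR, Nat.cast_sub hn]
    congr 1
    push_cast
    rw [he]
    ring
  have hinv : R⁻¹ * (R ^ 2) = R := by field_simp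
  rw [← mul_assoc (R ^ (2 * kappa p - 1)), ← hpow2, hpow1]
  linear_combination (-(R ^ (e - 1))) * hdiv
    - R ^ (e - 1) * R ^ (n - 1) * sphMean (bulkDensity p U) R * hinv

end Bulk

/-! ### Scaling derivatives of products -/

/-- `f` is differentiable and `(𝓔 + c) f = f'`, where `𝓔` is the Euler operator. -/
def HasDil (c : ℝ) (f f' : Space n → ℝ) : Prop :=
  Differentiable ℝ f ∧ ∀ y, euler f y + c * f y = f' y

namespace HasDil

variable {c d : ℝ} {f g f' g' : Space n → ℝ}

theorem of_differentiable (c : ℝ) (hf : Differentiable ℝ f) :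
    HasDil c f fun y => euler f y + c * f y :=
  ⟨hf, fun _ => rfl⟩

theorem add (hf : HasDil c f f') (hg : HasDil c g g') :
    HasDil c (fun y => f y + g y) fun y => f' y + g' y :=
  ⟨hf.1.fun_add hg.1, fun y => by
    beta_reduce
    rw [euler_add (hf.1 y) (hg.1 y), ← hf.2 y, ← hg.2 y]
    ring⟩

theorem const_mul (a : ℝ) (hf : HasDil c f f') :
    HasDil c (fun y => a * f y) fun y => a * f' y :=
  ⟨hf.1.const_mul a, fun y => by
    beta_reduce
    rw [euler_const_mul (hf.1 y), ← hf.2 y]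
    ring⟩

theorem mul (hf : HasDil c f f') (hg : HasDil d g g') :
    HasDil (c + d) (fun y => f y * g y) fun y => f' y * g y + f y * g' y :=
  ⟨hf.1.fun_mul hg.1, fun y => by
    beta_reduce
    rw [euler_mul (hf.1 y) (hg.1 y), ← hf.2 y, ← hg.2 y]
    ring⟩

/-- The weight drops by two because |y|² is homogeneous of degree two. -/
theorem normSq_mul (hf : HasDil c f f') :
    HasDil (c - 2) (fun y => ‖y‖ ^ 2 * f y) fun y => ‖y‖ ^ 2 * f' y :=
  ⟨differentiable_normSq.fun_mul hf.1, fun y => by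
    beta_reduce
    rw [euler_mul (differentiable_normSq y) (hf.1 y), euler_normSq, ← hf.2 y]
    ring⟩

theorem congr (hf : HasDil c f f') (hc : c = d) (hg : ∀ y, g y = f y) : HasDil d g f' := by
  obtain rfl := hc
  rwa [show g = f from funext hg]

end HasDil

/-! ### The energy density on spheres and its dissipation -/

/-- The density of the boundary part of the energy, as a function on `ℝⁿ`. -/
def boundaryDensity (p : ℝ) (U : Space n → ℝ) (y : Space n) : ℝ :=
  -1 * (ladder (kappa p) U 4 y * ladder (kappa p) U 1 y)
  + 2 * (ladder (kappa p) U 3 y * ladder (kappa p) U 2 y)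
  + -(delta1 n p - 6) * (ladder (kappa p) U 3 y * ladder (kappa p) U 1 y)
  + 1 / 2 * (kappa p + 2) * ((‖y‖ ^ 2 * (Δ U) y) * (‖y‖ ^ 2 * (Δ U) y))
  + -(24 - 6 * delta1 n p + delta2 n p) * (ladder (kappa p) U 2 y * ladder (kappa p) U 1 y)
  + -(9 * delta1 n p - 3 * delta2 n p - 36) * (ladder (kappa p) U 1 y * ladder (kappa p) U 1 y)
  + (delta1 n p - 8) * (ladder (kappa p) U 2 y * ladder (kappa p) U 2 y)
  + delta4 n p * (ladder (kappa p) U 1 y * ladder (kappa p) U 0 y)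
  + 2 * delta4 n p * (ladder (kappa p) U 0 y * ladder (kappa p) U 0 y)
  + 2 * (sph (ladder (kappa p) U 0) y * sph (ladder (kappa p) U 0) y)
  + 1 * (sph (ladder (kappa p) U 0) y * sph (ladder (kappa p) U 1) y)
  + -4 * (beta n p - n + 4) * gam (ladder (kappa p) U 0) (ladder (kappa p) U 0) y
  + -2 * (beta n p - n + 4) * gam (ladder (kappa p) U 0) (ladder (kappa p) U 1) y
  + -6 * gam (ladder (kappa p) U 1) (ladder (kappa p) U 1) y
  + 2 * gam (ladder (kappa p) U 1) (ladder (kappa p) U 2) y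

/-- The density of the derivative of the energy, as a function on `ℝⁿ`. -/
def dissipation (p : ℝ) (U : Space n → ℝ) (y : Space n) : ℝ :=
  2 * ladder (kappa p) U 3 y ^ 2
  + (10 * delta1 n p - 2 * delta2 n p - 56) * ladder (kappa p) U 2 y ^ 2
  + (-18 * delta1 n p + 6 * delta2 n p - 4 * delta3 n p + 2 * delta4 n p + 72)
    * ladder (kappa p) U 1 y ^ 2
  + 4 * gam (ladder (kappa p) U 2) (ladder (kappa p) U 2) y
  + (8 * alpha n p - 4 * beta n p + 4 * n - 28) * gam (ladder (kappa p) U 1) (ladder (kappa p) U 1) y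
  + 2 * sph (ladder (kappa p) U 1) y ^ 2
  + (‖y‖ ^ 2 * (Δ (ladder (kappa p) U 1)) y) ^ 2

/-- The continuous functions with mean zero on the sphere of radius `r`. -/
def sphNull (n : ℕ) (r : ℝ) : Submodule ℝ (Space n → ℝ) where
  carrier := {f | Continuous f ∧ sphMean f r = 0}
  zero_mem' := ⟨continuous_const, by simp [sphMean, unitSphereIntegral]⟩
  add_mem' := by
    rintro f g ⟨hf, hf0⟩ ⟨hg, hg0⟩
    refine ⟨hf.add hg, ?_⟩
    have := integral_add (integrable_sphMean hf r) (integrable_sphMean hg r)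
    simp only [sphMean, unitSphereIntegral, Pi.add_apply] at hf0 hg0 ⊢
    rw [this, hf0, hg0, add_zero]
  smul_mem' := by
    rintro c f ⟨hf, hf0⟩
    refine ⟨hf.const_smul c, ?_⟩
    simp only [sphMean, unitSphereIntegral, Pi.smul_apply, smul_eq_mul] at hf0 ⊢
    rw [integral_const_mul, hf0, mul_zero]

/-! ### Balance between boundary flux, boundary density and dissipation -/

section Balance

variable {p : ℝ} {U : Space n → ℝ}

/-- All rungs are given the same weight c, at the price of the term with coefficient j. Every
product in `boundaryDensity` then has weight 2κ, so the summands can be differentiated together. -/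
theorem hasDil_ladder {c : ℝ} {f : Space n → ℝ} (j : ℕ) (hf : ContDiff ℝ 1 (ladder c f j)) :
    HasDil c (ladder c f j) fun y => ladder c f (j + 1) y + j * ladder c f j y :=
  ⟨hf.differentiable (by norm_num), fun y => by
    rw [euler_ladder]
    ring⟩

theorem hasDil_sph_ladder {c : ℝ} {f : Space n → ℝ} (j : ℕ) (hf : ContDiff ℝ 3 (ladder c f j)) :
    HasDil c (sph (ladder c f j)) fun y =>
      sph (ladder c f (j + 1)) y + j * sph (ladder c f j) y :=
  ⟨(contDiff_sph hf (m := 1) (by norm_num)).differentiable (by norm_num), fun y => by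
    rw [euler_sph_ladder c j hf]
    ring⟩

theorem hasDil_gam_ladder {c : ℝ} {f : Space n → ℝ} (i j : ℕ) (hi : ContDiff ℝ 2 (ladder c f i))
    (hj : ContDiff ℝ 2 (ladder c f j)) :
    HasDil (c + c) (gam (ladder c f i) (ladder c f j)) fun y =>
      gam (ladder c f (i + 1)) (ladder c f j) y + gam (ladder c f i) (ladder c f (j + 1)) y
        + (i + j) * gam (ladder c f i) (ladder c f j) y :=
  ⟨(contDiff_gam hi hj (m := 1) (by norm_num)).differentiable (by norm_num), fun y => by
    rw [euler_gam_ladder c i j hi hj]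
    ring⟩

theorem contDiff_boundaryDensity (hU : ContDiff ℝ 6 U) :
    ContDiff ℝ 1 (boundaryDensity p U) := by
  have w0 : ContDiff ℝ 6 (ladder (kappa p) U 0) := contDiff_ladder_of_le _ 0 hU (by norm_num)
  have w1 : ContDiff ℝ 5 (ladder (kappa p) U 1) := contDiff_ladder_of_le _ 1 hU (by norm_num)
  have w2 : ContDiff ℝ 4 (ladder (kappa p) U 2) := contDiff_ladder_of_le _ 2 hU (by norm_num)
  have v0 : ContDiff ℝ 1 (ladder (kappa p) U 0) := w0.of_le (by norm_num)
  have v1 : ContDiff ℝ 1 (ladder (kappa p) U 1) := w1.of_le (by norm_num)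
  have v2 : ContDiff ℝ 1 (ladder (kappa p) U 2) := w2.of_le (by norm_num)
  have v3 : ContDiff ℝ 1 (ladder (kappa p) U 3) := contDiff_ladder_of_le _ 3 hU (by norm_num)
  have v4 : ContDiff ℝ 1 (ladder (kappa p) U 4) := contDiff_ladder_of_le _ 4 hU (by norm_num)
  have s0 : ContDiff ℝ 1 (sph (ladder (kappa p) U 0)) := contDiff_sph w0 (by norm_num)
  have s1 : ContDiff ℝ 1 (sph (ladder (kappa p) U 1)) := contDiff_sph w1 (by norm_num)
  have l : ContDiff ℝ 1 (Δ U) := contDiff_laplacian hU (by norm_num)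
  have g00 : ContDiff ℝ 1 (gam (ladder (kappa p) U 0) (ladder (kappa p) U 0)) :=
    contDiff_gam w0 w0 (by norm_num)
  have g01 : ContDiff ℝ 1 (gam (ladder (kappa p) U 0) (ladder (kappa p) U 1)) :=
    contDiff_gam (w0.of_le (by norm_num)) w1 (by norm_num)
  have g11 : ContDiff ℝ 1 (gam (ladder (kappa p) U 1) (ladder (kappa p) U 1)) :=
    contDiff_gam w1 w1 (by norm_num)
  have g12 : ContDiff ℝ 1 (gam (ladder (kappa p) U 1) (ladder (kappa p) U 2)) :=
    contDiff_gam (w1.of_le (by norm_num)) w2 (by norm_num)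
  have nn : ContDiff ℝ 1 (fun y : Space n => ‖y‖ ^ 2) := contDiff_norm_sq ℝ
  unfold boundaryDensity
  fun_prop

theorem continuous_bulkBoundary (hU : ContDiff ℝ 6 U) : Continuous (bulkBoundary p U) := by
  have hv : ContDiff ℝ 4 (Δ U) := contDiff_laplacian hU (by norm_num)
  have hvv : ContDiff ℝ 2 (Δ (Δ U)) := contDiff_laplacian hv (by norm_num)
  have hw : ContDiff ℝ 5 (ladder (kappa p) U 1) := contDiff_ladder_of_le _ 1 hU (by norm_num)
  have hlw : ContDiff ℝ 1 (Δ (ladder (kappa p) U 1)) := contDiff_laplacian hw (by norm_num)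
  have h1 : ContDiff ℝ 0 (euler (Δ U)) := contDiff_euler hv (by norm_num)
  have h2 : ContDiff ℝ 0 (euler (Δ (Δ U))) := contDiff_euler hvv (by norm_num)
  have h3 : ContDiff ℝ 0 (euler (ladder (kappa p) U 1)) := contDiff_euler hw (by norm_num)
  exact ((hlw.continuous.mul h1.continuous).sub (hvv.continuous.mul h3.continuous)).add
    (hw.continuous.mul h2.continuous)

theorem continuous_dissipation (hU : ContDiff ℝ 6 U) : Continuous (dissipation p U) := by
  have w1 : ContDiff ℝ 5 (ladder (kappa p) U 1) := contDiff_ladder_of_le _ 1 hU (by norm_num)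
  have w2 : ContDiff ℝ 4 (ladder (kappa p) U 2) := contDiff_ladder_of_le _ 2 hU (by norm_num)
  have w3 : ContDiff ℝ 3 (ladder (kappa p) U 3) := contDiff_ladder_of_le _ 3 hU (by norm_num)
  have c1 := w1.continuous
  have c2 := w2.continuous
  have c3 := w3.continuous
  have s1 := (contDiff_sph w1 (m := 3) (by norm_num)).continuous
  have l1 := (contDiff_laplacian w1 (m := 3) (by norm_num)).continuous
  have g11 := (contDiff_gam w1 w1 (m := 1) (by norm_num)).continuous
  have g22 := (contDiff_gam w2 w2 (m := 1) (by norm_num)).continuous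
  unfold dissipation
  fun_prop

/-- The operator 𝓔 + κ is applied to both sides of `norm_pow_mul_bilaplacian`; it raises each rung
and commutes with `sph`. -/
theorem hasDil_bilaplacian (hU : ContDiff ℝ 6 U) (y : Space n) :
    ‖y‖ ^ 4 * (euler (Δ (Δ U)) y + (kappa p + 4) * (Δ (Δ U)) y)
      = (ladder (kappa p) U 5 y + 4 * ladder (kappa p) U 4 y)
        + delta1 n p * (ladder (kappa p) U 4 y + 3 * ladder (kappa p) U 3 y)
        + delta2 n p * (ladder (kappa p) U 3 y + 2 * ladder (kappa p) U 2 y)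
        + delta3 n p * (ladder (kappa p) U 2 y + ladder (kappa p) U 1 y)
        + delta4 n p * ladder (kappa p) U 1 y
        + 2 * (sph (ladder (kappa p) U 3) y + 2 * sph (ladder (kappa p) U 2) y)
        + 2 * alpha n p * (sph (ladder (kappa p) U 2) y + sph (ladder (kappa p) U 1) y)
        + 2 * (beta n p - n + 4) * sph (ladder (kappa p) U 1) y
        + sph (sph (ladder (kappa p) U 1)) y := by
  have w0 : ContDiff ℝ 6 (ladder (kappa p) U 0) := contDiff_ladder_of_le _ 0 hU (by norm_num)
  have w1 : ContDiff ℝ 5 (ladder (kappa p) U 1) := contDiff_ladder_of_le _ 1 hU (by norm_num)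
  have w2 : ContDiff ℝ 4 (ladder (kappa p) U 2) := contDiff_ladder_of_le _ 2 hU (by norm_num)
  have w3 : ContDiff ℝ 3 (ladder (kappa p) U 3) := contDiff_ladder_of_le _ 3 hU (by norm_num)
  have w4 : ContDiff ℝ 2 (ladder (kappa p) U 4) := contDiff_ladder_of_le _ 4 hU (by norm_num)
  have s0 : ContDiff ℝ 4 (sph (ladder (kappa p) U 0)) := contDiff_sph w0 (by norm_num)
  have s1 : ContDiff ℝ 3 (sph (ladder (kappa p) U 1)) := contDiff_sph w1 (by norm_num)
  have ss : HasDil (kappa p) (sph (sph (ladder (kappa p) U 0)))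
      (sph (sph (ladder (kappa p) U 1))) := by
    refine ⟨(contDiff_sph s0 (m := 1) (by norm_num)).differentiable (by norm_num), fun y => ?_⟩
    have e : (fun z => euler (sph (ladder (kappa p) U 0)) z
        + kappa p * sph (ladder (kappa p) U 0) z) = sph (ladder (kappa p) U 1) := by
      funext z
      rw [euler_sph_ladder _ 0 (w0.of_le (by norm_num))]
      push_cast
      ring
    rw [euler_sph (s0.of_le (by norm_num)), ← e,
      sph_add (contDiff_euler s0 (by norm_num)) (contDiff_const.mul (s0.of_le (by norm_num))),
      sph_const_mul (s0.of_le (by norm_num))]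
  have hv : Differentiable ℝ (Δ (Δ U)) :=
    (contDiff_laplacian (contDiff_laplacian hU (m := 4) (by norm_num)) (m := 2)
      (by norm_num)).differentiable (by norm_num)
  have hZ := ((((((((hasDil_ladder 4 (w4.of_le (by norm_num))).add
    ((hasDil_ladder 3 (w3.of_le (by norm_num))).const_mul (delta1 n p))).add
    ((hasDil_ladder 2 (w2.of_le (by norm_num))).const_mul (delta2 n p))).add
    ((hasDil_ladder 1 (w1.of_le (by norm_num))).const_mul (delta3 n p))).add
    ((hasDil_ladder 0 (w0.of_le (by norm_num))).const_mul (delta4 n p))).add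
    ((hasDil_sph_ladder 2 (w2.of_le (by norm_num))).const_mul 2)).add
    ((hasDil_sph_ladder 1 (w1.of_le (by norm_num))).const_mul (2 * alpha n p))).add
    ((hasDil_sph_ladder 0 (w0.of_le (by norm_num))).const_mul (2 * (beta n p - n + 4)))).add ss
  -- Two factors |y|² bring the weight κ + 4 of Δ²U down to κ.
  have hL := ((HasDil.of_differentiable (kappa p + 4) hv).normSq_mul).normSq_mul
  have hZ' := hZ.congr (d := kappa p) (g := fun y => ‖y‖ ^ 2 * (‖y‖ ^ 2 * (Δ (Δ U)) y)) rfl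
    (fun y => by
      have := norm_pow_mul_bilaplacian (kappa p) hU y
      rw [← mul_assoc, ← pow_add, this]
      simp only [delta1, delta2, delta3, delta4, alpha, beta])
  have hL' := (hL.congr (d := kappa p) (by ring) fun y => rfl).2 y
  rw [hZ'.2 y] at hL'
  simp only at hL'
  rw [show ‖y‖ ^ 4 = ‖y‖ ^ 2 * ‖y‖ ^ 2 by ring, mul_assoc, ← hL']
  push_cast
  ring

/-- The exact balance, up to divergences on the sphere. -/
theorem balance_pointwise (hU : ContDiff ℝ 6 U) (y : Space n) :
    ‖y‖ ^ 4 * bulkBoundary p U y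
      + (euler (boundaryDensity p U) y + 2 * kappa p * boundaryDensity p U y) - dissipation p U y
    = 2 * (ladder (kappa p) U 1 y * sph (ladder (kappa p) U 3) y
        + gam (ladder (kappa p) U 1) (ladder (kappa p) U 3) y)
      + (2 * alpha n p - 6) * (ladder (kappa p) U 1 y * sph (ladder (kappa p) U 2) y
        + gam (ladder (kappa p) U 1) (ladder (kappa p) U 2) y)
      + (2 * (beta n p - n + 4) - 8 * alpha n p)
        * (ladder (kappa p) U 1 y * sph (ladder (kappa p) U 1) y
        + gam (ladder (kappa p) U 1) (ladder (kappa p) U 1) y)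
      + (-10 * (beta n p - n + 4)) * (ladder (kappa p) U 1 y * sph (ladder (kappa p) U 0) y
        + gam (ladder (kappa p) U 1) (ladder (kappa p) U 0) y)
      + (-2) * (ladder (kappa p) U 2 y * sph (ladder (kappa p) U 2) y
        + gam (ladder (kappa p) U 2) (ladder (kappa p) U 2) y)
      + (-2 * alpha n p) * (ladder (kappa p) U 2 y * sph (ladder (kappa p) U 1) y
        + gam (ladder (kappa p) U 2) (ladder (kappa p) U 1) y)
      + (-2 * (beta n p - n + 4)) * (ladder (kappa p) U 2 y * sph (ladder (kappa p) U 0) y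
        + gam (ladder (kappa p) U 2) (ladder (kappa p) U 0) y)
      + 1 * (ladder (kappa p) U 1 y * sph (sph (ladder (kappa p) U 1)) y
        + gam (ladder (kappa p) U 1) (sph (ladder (kappa p) U 1)) y)
      + (-1) * (sph (ladder (kappa p) U 1) y * sph (ladder (kappa p) U 1) y
        + gam (sph (ladder (kappa p) U 1)) (ladder (kappa p) U 1) y)
      + (-5) * (ladder (kappa p) U 1 y * sph (sph (ladder (kappa p) U 0)) y
        + gam (ladder (kappa p) U 1) (sph (ladder (kappa p) U 0)) y)
      + 5 * (sph (ladder (kappa p) U 0) y * sph (ladder (kappa p) U 1) y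
        + gam (sph (ladder (kappa p) U 0)) (ladder (kappa p) U 1) y)
      + (-1) * (ladder (kappa p) U 2 y * sph (sph (ladder (kappa p) U 0)) y
        + gam (ladder (kappa p) U 2) (sph (ladder (kappa p) U 0)) y)
      + 1 * (sph (ladder (kappa p) U 0) y * sph (ladder (kappa p) U 2) y
        + gam (sph (ladder (kappa p) U 0)) (ladder (kappa p) U 2) y) := by
  have w0 : ContDiff ℝ 6 (ladder (kappa p) U 0) := contDiff_ladder_of_le _ 0 hU (by norm_num)
  have w1 : ContDiff ℝ 5 (ladder (kappa p) U 1) := contDiff_ladder_of_le _ 1 hU (by norm_num)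
  have w2 : ContDiff ℝ 4 (ladder (kappa p) U 2) := contDiff_ladder_of_le _ 2 hU (by norm_num)
  have w3 : ContDiff ℝ 3 (ladder (kappa p) U 3) := contDiff_ladder_of_le _ 3 hU (by norm_num)
  have w4 : ContDiff ℝ 2 (ladder (kappa p) U 4) := contDiff_ladder_of_le _ 4 hU (by norm_num)
  have hvd : Differentiable ℝ (Δ U) :=
    (contDiff_laplacian hU (m := 4) (by norm_num)).differentiable (by norm_num)
  have W0 := hasDil_ladder 0 (w0.of_le (by norm_num))
  have W1 := hasDil_ladder 1 (w1.of_le (by norm_num))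
  have W2 := hasDil_ladder 2 (w2.of_le (by norm_num))
  have W3 := hasDil_ladder 3 (w3.of_le (by norm_num))
  have W4 := hasDil_ladder 4 (w4.of_le (by norm_num))
  have S0 := hasDil_sph_ladder 0 (w0.of_le (by norm_num))
  have S1 := hasDil_sph_ladder 1 (w1.of_le (by norm_num))
  -- For |y|² ΔU the image under 𝓔 + κ is |y|² (𝓔 + κ + 2)ΔU, that is |y|² Δw_1 by
  -- `laplacian_ladder_one`.
  have V := ((HasDil.of_differentiable (kappa p + 2) hvd).normSq_mul).congr
    (d := kappa p) (by ring) fun y => rfl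
  have w0' : ContDiff ℝ 2 (ladder (kappa p) U 0) := w0.of_le (by norm_num)
  have w1' : ContDiff ℝ 2 (ladder (kappa p) U 1) := w1.of_le (by norm_num)
  have w2' : ContDiff ℝ 2 (ladder (kappa p) U 2) := w2.of_le (by norm_num)
  -- The summands follow the order in `boundaryDensity`, so the differentiated function is that
  -- density by definition.
  have hQ := ((((((((((((((
    ((W4.mul W1).const_mul (-1))).add
    ((W3.mul W2).const_mul 2)).add
    ((W3.mul W1).const_mul (-(delta1 n p - 6)))).add
    ((V.mul V).const_mul (1 / 2 * (kappa p + 2)))).add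
    ((W2.mul W1).const_mul (-(24 - 6 * delta1 n p + delta2 n p)))).add
    ((W1.mul W1).const_mul (-(9 * delta1 n p - 3 * delta2 n p - 36)))).add
    ((W2.mul W2).const_mul (delta1 n p - 8))).add
    ((W1.mul W0).const_mul (delta4 n p))).add
    ((W0.mul W0).const_mul (2 * delta4 n p))).add
    ((S0.mul S0).const_mul 2)).add
    ((S0.mul S1).const_mul 1)).add
    ((hasDil_gam_ladder 0 0 w0' w0').const_mul (-4 * (beta n p - n + 4)))).add
    ((hasDil_gam_ladder 0 1 w0' w1').const_mul (-2 * (beta n p - n + 4)))).add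
    ((hasDil_gam_ladder 1 1 w1' w1').const_mul (-6))).add
    ((hasDil_gam_ladder 1 2 w1' w2').const_mul 2)
  have hQy := hQ.2 y
  have hQy' : euler (boundaryDensity p U) y + (kappa p + kappa p) * boundaryDensity p U y = _ := hQy
  have hB := hasDil_bilaplacian (p := p) hU y
  have hZ := norm_pow_mul_bilaplacian (kappa p) hU y
  rw [← delta1, ← delta2, ← delta3, ← delta4, ← alpha, ← beta] at hZ
  have hE := euler_ladder (kappa p) U 1 y
  have hlap := laplacian_ladder_one (kappa p) (hU.of_le (by norm_num) : ContDiff ℝ 3 U) y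
  -- Each `gam` is oriented one way. In the last three pairs on the right the `gam` terms then
  -- cancel, and what is left expresses the self-adjointness of `sph`.
  rw [gam_comm (ladder (kappa p) U 1) (ladder (kappa p) U 0),
    gam_comm (ladder (kappa p) U 2) (ladder (kappa p) U 1),
    gam_comm (ladder (kappa p) U 2) (ladder (kappa p) U 0),
    gam_comm (sph (ladder (kappa p) U 1)) (ladder (kappa p) U 1),
    gam_comm (sph (ladder (kappa p) U 0)) (ladder (kappa p) U 1),
    gam_comm (sph (ladder (kappa p) U 0)) (ladder (kappa p) U 2)]
  simp only [Nat.reduceAdd, zero_add] at hQy' hE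
  rw [gam_comm (ladder (kappa p) U 1) (ladder (kappa p) U 0),
    gam_comm (ladder (kappa p) U 2) (ladder (kappa p) U 1)] at hQy'
  push_cast at hQy' hE
  rw [bulkBoundary, dissipation, hlap, hE]
  generalize euler (boundaryDensity p U) y = EQ at *
  generalize boundaryDensity p U y = Q at *
  -- From w_1 𝓔Δ²U = w_1 (𝓔+κ+4)Δ²U - (κ+4) w_1 Δ²U and 𝓔w_1 = w_2 - (κ-1) w_1, the total
  -- coefficient of Δ²U is -(w_2 + 5 w_1).
  linear_combination hQy' + ladder (kappa p) U 1 y * hB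
    - (ladder (kappa p) U 2 y + 5 * ladder (kappa p) U 1 y) * hZ

theorem sphMean_balance (hn : 1 ≤ n) (hU : ContDiff ℝ 6 U) {r : ℝ} (hr : 0 < r) :
    r ^ 4 * sphMean (bulkBoundary p U) r
      + sphMean (fun y => euler (boundaryDensity p U) y + 2 * kappa p * boundaryDensity p U y) r
    = sphMean (dissipation p U) r := by
  have w0 : ContDiff ℝ 6 (ladder (kappa p) U 0) := contDiff_ladder_of_le _ 0 hU (by norm_num)
  have w1 : ContDiff ℝ 5 (ladder (kappa p) U 1) := contDiff_ladder_of_le _ 1 hU (by norm_num)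
  have w2 : ContDiff ℝ 4 (ladder (kappa p) U 2) := contDiff_ladder_of_le _ 2 hU (by norm_num)
  have w3 : ContDiff ℝ 3 (ladder (kappa p) U 3) := contDiff_ladder_of_le _ 3 hU (by norm_num)
  have s0 : ContDiff ℝ 4 (sph (ladder (kappa p) U 0)) := contDiff_sph w0 (by norm_num)
  have s1 : ContDiff ℝ 3 (sph (ladder (kappa p) U 1)) := contDiff_sph w1 (by norm_num)
  have v0 : ContDiff ℝ 2 (ladder (kappa p) U 0) := w0.of_le (by norm_num)
  have v1 : ContDiff ℝ 2 (ladder (kappa p) U 1) := w1.of_le (by norm_num)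
  have v2 : ContDiff ℝ 2 (ladder (kappa p) U 2) := w2.of_le (by norm_num)
  have v3 : ContDiff ℝ 2 (ladder (kappa p) U 3) := w3.of_le (by norm_num)
  have t0 : ContDiff ℝ 2 (sph (ladder (kappa p) U 0)) := s0.of_le (by norm_num)
  have t1 : ContDiff ℝ 2 (sph (ladder (kappa p) U 1)) := s1.of_le (by norm_num)
  have ibp : ∀ {f g : Space n → ℝ} (c : ℝ), ContDiff ℝ 2 f → ContDiff ℝ 2 g →
      (fun y => c * (f y * sph g y + gam f g y)) ∈ sphNull n r := by
    intro f g c hf hg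
    have hs : ContDiff ℝ 0 (sph g) := contDiff_sph hg (by norm_num)
    have hG : ContDiff ℝ 0 (gam f g) := contDiff_gam hf hg (by norm_num)
    exact (sphNull n r).smul_mem c ⟨(hf.continuous.mul hs.continuous).add hG.continuous,
      sphMean_mul_sph hn (hf.of_le (by norm_num)) hg hr⟩
  -- The thirteen terms are added in the order of the right-hand side of `balance_pointwise`.
  have hmem := (sphNull n r).add_mem ((sphNull n r).add_mem ((sphNull n r).add_mem
    ((sphNull n r).add_mem ((sphNull n r).add_mem ((sphNull n r).add_mem ((sphNull n r).add_mem
    ((sphNull n r).add_mem ((sphNull n r).add_mem ((sphNull n r).add_mem ((sphNull n r).add_mem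
    ((sphNull n r).add_mem
    (ibp 2 v1 v3) (ibp (2 * alpha n p - 6) v1 v2))
    (ibp (2 * (beta n p - n + 4) - 8 * alpha n p) v1 v1))
    (ibp (-10 * (beta n p - n + 4)) v1 v0))
    (ibp (-2) v2 v2)) (ibp (-2 * alpha n p) v2 v1)) (ibp (-2 * (beta n p - n + 4)) v2 v0))
    (ibp 1 v1 t1)) (ibp (-1) t1 v1)) (ibp (-5) v1 t0)) (ibp 5 t0 v1)) (ibp (-1) v2 t0))
    (ibp 1 t0 v2)
  have hmean := hmem.2
  have hfun : sphMean (fun y => ‖y‖ ^ 4 * bulkBoundary p U y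
      + (euler (boundaryDensity p U) y + 2 * kappa p * boundaryDensity p U y)
      - dissipation p U y) r = 0 := by
    rw [funext (balance_pointwise (p := p) hU)]
    exact hmean
  have hb := continuous_bulkBoundary (p := p) hU
  have hQ := contDiff_boundaryDensity (p := p) hU
  have hEQ : Continuous fun y => euler (boundaryDensity p U) y
      + 2 * kappa p * boundaryDensity p U y :=
    (contDiff_euler hQ (m := 0) (by norm_num)).continuous.add (continuous_const.mul hQ.continuous)
  have hR := continuous_dissipation (p := p) hU
  have hnb : Continuous fun y : Space n => ‖y‖ ^ 4 * bulkBoundary p U y := by fun_prop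
  have hnorm : sphMean (fun y : Space n => ‖y‖ ^ 4 * bulkBoundary p U y) r
      = r ^ 4 * sphMean (bulkBoundary p U) r := by
    simp only [sphMean, unitSphereIntegral]
    rw [← integral_const_mul]
    refine integral_congr_ae (.of_forall fun θ => ?_)
    simp [norm_smul, abs_of_pos hr]
  rw [← hnorm, ← sub_eq_zero, ← hfun]
  simp only [sphMean, unitSphereIntegral]
  rw [← integral_add (integrable_sphMean hnb r) (integrable_sphMean hEQ r),
    ← integral_sub _ (integrable_sphMean hR r)]
  exact (integrable_sphMean hnb r).add (integrable_sphMean hEQ r)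

/-- The derivative of the boundary part of the energy. -/
theorem hasDerivAt_rpow_mul_sphMean {Q : Space n → ℝ} (hQ : ContDiff ℝ 1 Q) (c : ℝ) {r : ℝ}
    (hr : 0 < r) :
    HasDerivAt (fun t : ℝ => t ^ c * sphMean Q t)
      (r ^ (c - 1) * sphMean (fun y => euler Q y + c * Q y) r) r := by
  have h := (Real.hasDerivAt_rpow_const (x := r) (p := c) (Or.inl hr.ne')).mul
    (hasDerivAt_sphMean hQ hr.ne')
  refine h.congr_deriv ?_
  have hs : sphMean (fun y => euler Q y + c * Q y) r = sphMean (euler Q) r + c * sphMean Q r := by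
    simp only [sphMean, unitSphereIntegral]
    rw [← integral_const_mul, integral_add
      (integrable_sphMean (contDiff_euler hQ (m := 0) (by norm_num)).continuous r)
      ((integrable_sphMean hQ.continuous r).const_mul c)]
  have hp : r ^ c = r ^ (c - 1) * r := by rw [← Real.rpow_add_one hr.ne', sub_add_cancel]
  rw [hs, hp]
  field_simp
  ring

end Balance

/-! ### Translation to the origin -/

theorem gradient_shift (x : Space n) (f : Space n → ℝ) (y : Space n) :
    ∇ f (x + y) = ∇ (fun z => f (x + z)) y := by
  rw [gradient, gradient, fderiv_comp_add_left]

theorem laplacian_shift (x : Space n) (f : Space n → ℝ) :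
    Δ (fun z => f (x + z)) = fun y => (Δ f) (x + y) := by
  funext y
  simp only [InnerProductSpace.laplacian_eq_iteratedFDeriv_stdOrthonormalBasis,
    iteratedFDeriv_comp_add_left]

theorem setIntegral_ball_shift (x : Space n) (r : ℝ) (f : Space n → ℝ) :
    ∫ y in Metric.ball x r, f y = ∫ y in Metric.ball 0 r, f (x + y) := by
  have h := (measurePreserving_add_left (volume : Measure (Space n)) x).setIntegral_preimage_emb
    (measurableEmbedding_addLeft x) f (Metric.ball x r)
  rw [← h]
  congr 2
  ext y
  simp

theorem IsSolution.shift {p : ℝ} {u : Space n → ℝ} (hu : IsSolution p u) (x : Space n) :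
    ContDiff ℝ 6 (fun y => u (x + y)) ∧ ∀ y, -(Δ (Δ (Δ fun z => u (x + z)))) y
      = |u (x + y)| ^ (p - 1) * u (x + y) := by
  refine ⟨hu.contDiff.comp (contDiff_const.add contDiff_id), fun y => ?_⟩
  rw [← hu.equation (x + y), laplacian_shift, laplacian_shift x (Δ u),
    laplacian_shift x (Δ (Δ u))]
  have hneg : ∀ f : Space n → ℝ, negLaplacian f = -(Δ f) := fun f => rfl
  simp only [Function.iterate_succ, Function.iterate_zero, Function.comp_apply, id, hneg,
    InnerProductSpace.laplacian_neg, neg_neg, Pi.neg_apply]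

/-! ### Radial derivatives -/

theorem radialDeriv_shift (x : Space n) (f : Space n → ℝ) (y : Space n) :
    radialDeriv x f (x + y) = ‖y‖⁻¹ * euler (fun z => f (x + z)) y := by
  rw [radialDeriv, add_sub_cancel_left, real_inner_smul_right, inner_gradient_left, euler,
    fderiv_comp_add_left]

theorem euler_inv_norm_pow {y : Space n} (hy : y ≠ 0) (j : ℕ) :
    DifferentiableAt ℝ (fun z : Space n => ‖z‖⁻¹ ^ j) y ∧
      euler (fun z : Space n => ‖z‖⁻¹ ^ j) y = -j * ‖y‖⁻¹ ^ j := by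
  have hd : DifferentiableAt ℝ (fun z : Space n => ‖z‖) y := differentiableAt_id.norm ℝ hy
  have hn : ‖y‖ ≠ 0 := norm_ne_zero_iff.2 hy
  have h1 : HasDerivAt (fun s : ℝ => s⁻¹ ^ j) (j * ‖y‖⁻¹ ^ (j - 1) * -(‖y‖ ^ 2)⁻¹) ‖y‖ :=
    (hasDerivAt_inv hn).fun_pow j
  have h2 : HasFDerivAt (fun z : Space n => ‖z‖⁻¹ ^ j) _ y :=
    h1.comp_hasFDerivAt y hd.hasFDerivAt
  refine ⟨h2.differentiableAt, ?_⟩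
  rw [euler, h2.fderiv]
  simp only [FunLike.coe_smul, Pi.smul_apply, hd.fderiv_norm_self, smul_eq_mul]
  cases j with
  | zero => simp
  | succ j =>
    simp only [Nat.add_sub_cancel, pow_succ]
    field_simp

/-- Since |y|^(-j) is homogeneous of degree -j, ∂_r(|y|^(-j) g) = |y|^(-j-1) (𝓔 - j)g, which is one
rung of the ladder of weight 0. -/
theorem iterate_radialDeriv (x : Space n) (u : Space n → ℝ) (j : ℕ)
    (hU : ContDiff ℝ j fun y => u (x + y)) {y : Space n} (hy : y ≠ 0) :
    ((radialDeriv x)^[j] u) (x + y) = ‖y‖⁻¹ ^ j * ladder 0 (fun y => u (x + y)) j y := by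
  induction j generalizing y with
  | zero => simp [ladder]
  | succ j ih =>
    have hU' : ContDiff ℝ j fun y => u (x + y) := hU.of_le (by exact_mod_cast Nat.le_succ j)
    have hl : ContDiff ℝ 1 (ladder 0 (fun y => u (x + y)) j) :=
      contDiff_ladder_of_le 0 j hU (by push_cast; rw [add_comm])
    -- The induction hypothesis is available only off the origin, which suffices for a derivative at
    -- y ≠ 0.
    have hev : (fun z => ((radialDeriv x)^[j] u) (x + z))
        =ᶠ[nhds y] fun z => ‖z‖⁻¹ ^ j * ladder 0 (fun y => u (x + y)) j z := by
      filter_upwards [isOpen_ne.mem_nhds hy] with z hz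
      exact ih hU' hz
    obtain ⟨hd, he⟩ := euler_inv_norm_pow hy j
    have heu : euler (fun z => ((radialDeriv x)^[j] u) (x + z)) y
        = euler (fun z => ‖z‖⁻¹ ^ j * ladder 0 (fun y => u (x + y)) j z) y := by
      rw [euler, hev.fderiv_eq, euler]
    rw [Function.iterate_succ_apply', radialDeriv_shift, heu,
      euler_mul hd (hl.differentiable (by norm_num) y), he]
    change _ = ‖y‖⁻¹ ^ (j + 1) * (euler (ladder 0 (fun y => u (x + y)) j) y
      + (0 - (j : ℝ)) * ladder 0 (fun y => u (x + y)) j y)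
    ring

section OnSphere

variable {p : ℝ} {x : Space n} {u : Space n → ℝ} {t : ℝ} {θ : Space n}

theorem norm_smul_of_unit (ht : 0 < t) (hθ : ‖θ‖ = 1) : ‖t • θ‖ = t := by
  rw [norm_smul, hθ, mul_one, Real.norm_eq_abs, abs_of_pos ht]

theorem smul_ne_zero_of_unit (ht : 0 < t) (hθ : ‖θ‖ = 1) : t • θ ≠ 0 := by
  rw [← norm_ne_zero_iff, norm_smul_of_unit ht hθ]
  exact ht.ne'

theorem pow_mul_iterate_radialDeriv (j : ℕ) (hU : ContDiff ℝ j fun y => u (x + y)) (ht : 0 < t)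
    (hθ : ‖θ‖ = 1) :
    t ^ j * ((radialDeriv x)^[j] u) (x + t • θ) = ladder 0 (fun y => u (x + y)) j (t • θ) := by
  rw [iterate_radialDeriv x u j hU (smul_ne_zero_of_unit ht hθ), norm_smul_of_unit ht hθ,
    ← mul_assoc, ← mul_pow, mul_inv_cancel₀ ht.ne', one_pow, one_mul]

theorem T1_eq (p : ℝ) (x : Space n) (u : Space n → ℝ) (ht : 0 < t) (hθ : ‖θ‖ = 1) :
    T1 p x u t (x + t • θ) = ladder (kappa p) (fun y => u (x + y)) 1 (t • θ) := by
  rw [T1, radialDeriv_shift, norm_smul_of_unit ht hθ, ladder_one, ← mul_assoc,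
    mul_inv_cancel₀ ht.ne']
  ring

/-- This and the next two lemmas are the Leibniz rule for t^κ · u(x + tθ): the coefficients of T2,
T3 and T4 are binomial coefficients times falling factorials of κ. -/
theorem T2_eq (p : ℝ) (hU : ContDiff ℝ 6 fun y => u (x + y)) (ht : 0 < t) (hθ : ‖θ‖ = 1) :
    T2 p x u t (x + t • θ) = ladder (kappa p) (fun y => u (x + y)) 2 (t • θ) := by
  have h4 : ContDiff ℝ 4 fun y => u (x + y) := hU.of_le (by norm_num)
  have h1 := pow_mul_iterate_radialDeriv 1 (hU.of_le (by norm_num)) ht hθ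
  have h2 := pow_mul_iterate_radialDeriv 2 (hU.of_le (by norm_num)) ht hθ
  rw [ladder_one, pow_one, Function.iterate_one] at h1
  rw [ladder_two 0 h4] at h2
  rw [T2, ladder_two _ h4]
  linear_combination 2 * kappa p * h1 + h2

theorem T3_eq (p : ℝ) (hU : ContDiff ℝ 6 fun y => u (x + y)) (ht : 0 < t) (hθ : ‖θ‖ = 1) :
    T3 p x u t (x + t • θ) = ladder (kappa p) (fun y => u (x + y)) 3 (t • θ) := by
  have h4 : ContDiff ℝ 4 fun y => u (x + y) := hU.of_le (by norm_num)
  have h1 := pow_mul_iterate_radialDeriv 1 (hU.of_le (by norm_num)) ht hθ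
  have h2 := pow_mul_iterate_radialDeriv 2 (hU.of_le (by norm_num)) ht hθ
  have h3 := pow_mul_iterate_radialDeriv 3 (hU.of_le (by norm_num)) ht hθ
  rw [ladder_one, pow_one, Function.iterate_one] at h1
  rw [ladder_two 0 h4] at h2
  rw [ladder_three 0 h4] at h3
  rw [T3, ladder_three _ h4]
  linear_combination 3 * kappa p * (kappa p - 1) * h1 + 3 * kappa p * h2 + h3

theorem T4_eq (p : ℝ) (hU : ContDiff ℝ 6 fun y => u (x + y)) (ht : 0 < t) (hθ : ‖θ‖ = 1) :
    T4 p x u t (x + t • θ) = ladder (kappa p) (fun y => u (x + y)) 4 (t • θ) := by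
  have h4 : ContDiff ℝ 4 fun y => u (x + y) := hU.of_le (by norm_num)
  have h1 := pow_mul_iterate_radialDeriv 1 (hU.of_le (by norm_num)) ht hθ
  have h2 := pow_mul_iterate_radialDeriv 2 (hU.of_le (by norm_num)) ht hθ
  have h3 := pow_mul_iterate_radialDeriv 3 (hU.of_le (by norm_num)) ht hθ
  have h4' := pow_mul_iterate_radialDeriv 4 (hU.of_le (by norm_num)) ht hθ
  rw [ladder_one, pow_one, Function.iterate_one] at h1
  rw [ladder_two 0 h4] at h2
  rw [ladder_three 0 h4] at h3
  rw [ladder_four 0 h4] at h4'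
  rw [T4, ladder_four _ h4]
  linear_combination 4 * kappa p * (kappa p - 1) * (kappa p - 2) * h1
    + 6 * kappa p * (kappa p - 1) * h2 + 4 * kappa p * h3 + h4'

/-- On the sphere of radius t, t² ∂_rr is 𝓔(𝓔 - 1) and t ∂_r is 𝓔, so the subtracted terms add up to
𝓔² + (n-2) 𝓔. -/
theorem angularPart_eq (hU : ContDiff ℝ 6 fun y => u (x + y)) (ht : 0 < t) (hθ : ‖θ‖ = 1) :
    angularPart x u t (x + t • θ) = sph (fun y => u (x + y)) (t • θ) := by
  have h4 : ContDiff ℝ 4 fun y => u (x + y) := hU.of_le (by norm_num)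
  have h1 := pow_mul_iterate_radialDeriv 1 (hU.of_le (by norm_num)) ht hθ
  have h2 := pow_mul_iterate_radialDeriv 2 (hU.of_le (by norm_num)) ht hθ
  rw [ladder_one, pow_one, Function.iterate_one] at h1
  rw [ladder_two 0 h4] at h2
  have hl : (Δ fun y => u (x + y)) (t • θ) = (Δ u) (x + t • θ) := by rw [laplacian_shift]
  rw [angularPart, sph, hl, norm_smul_of_unit ht hθ]
  linear_combination -h2 - ((n : ℝ) - 1) * h1

theorem normSq_mul_tangentialSq (x : Space n) (f : Space n → ℝ) {y : Space n} (hy : y ≠ 0) :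
    ‖y‖ ^ 2 * tangentialSq x f (x + y)
      = gam (fun z => f (x + z)) (fun z => f (x + z)) y := by
  have hn : ‖y‖ ≠ 0 := norm_ne_zero_iff.2 hy
  rw [tangentialSq, gradient_shift, radialDeriv_shift, gam, real_inner_self_eq_norm_sq]
  field_simp

/-- `gam f f` sees only the component of the gradient orthogonal to y, so a radial change of the
gradient does not affect it. -/
theorem gam_self_of_pd_eq {f g : Space n → ℝ} {y : Space n} {c : ℝ}
    (h : ∀ i, pd i f y = pd i g y + c * y i) : gam f f y = gam g g y := by
  have he : euler f y = euler g y + c * ‖y‖ ^ 2 := by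
    rw [euler_eq_sum, euler_eq_sum, ← sum_sq_eq_normSq, Finset.mul_sum, ← Finset.sum_add_distrib]
    exact Finset.sum_congr rfl fun i _ => by rw [h]; ring
  have hs : ∑ i, pd i f y * pd i f y
      = ∑ i, pd i g y * pd i g y + 2 * c * euler g y + c ^ 2 * ‖y‖ ^ 2 := by
    rw [euler_eq_sum, ← sum_sq_eq_normSq, Finset.mul_sum, Finset.mul_sum,
      ← Finset.sum_add_distrib, ← Finset.sum_add_distrib]
    exact Finset.sum_congr rfl fun i _ => by rw [h]; ring
  rw [gam, gam, inner_gradient_gradient, inner_gradient_gradient, hs, he]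
  ring

theorem pd_comp_normSq {h : ℝ → ℝ} {h' : ℝ} {y : Space n} (hh : HasDerivAt h h' (‖y‖ ^ 2))
    (i : Fin n) :
    DifferentiableAt ℝ (fun z : Space n => h (‖z‖ ^ 2)) y ∧
      pd i (fun z => h (‖z‖ ^ 2)) y = h' * (2 * y i) := by
  have hd : HasFDerivAt (fun z : Space n => h (‖z‖ ^ 2)) _ y :=
    hh.comp_hasFDerivAt y (differentiable_normSq y).hasFDerivAt
  refine ⟨hd.differentiableAt, ?_⟩
  rw [pd, hd.fderiv, ← pd_normSq i y]
  rfl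

/-- Inside the tangential gradient t is frozen, so T1 differs from w_1 by (t/|z| - 1) 𝓔U away from
the sphere. The factor is radial and vanishes on |z| = t; the two gradients there differ by a radial
vector only. -/
theorem gam_T1_eq (p : ℝ) (hU : ContDiff ℝ 6 fun y => u (x + y)) (ht : 0 < t) (hθ : ‖θ‖ = 1) :
    gam (fun z => T1 p x u t (x + z)) (fun z => T1 p x u t (x + z)) (t • θ)
      = gam (ladder (kappa p) (fun y => u (x + y)) 1)
          (ladder (kappa p) (fun y => u (x + y)) 1) (t • θ) := by
  set U : Space n → ℝ := fun y => u (x + y) with hUdef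
  have he : Differentiable ℝ (euler U) :=
    (contDiff_euler hU (m := 1) (by norm_num)).differentiable (by norm_num)
  have hw : Differentiable ℝ (ladder (kappa p) U 1) :=
    (contDiff_ladder_of_le _ 1 hU (m := 1) (by norm_num)).differentiable (by norm_num)
  have hF : (fun z => T1 p x u t (x + z))
      = fun z => ladder (kappa p) U 1 z + (t * (√(‖z‖ ^ 2))⁻¹ - 1) * euler U z := by
    funext z
    rw [T1, radialDeriv_shift, ladder_one, Real.sqrt_sq (norm_nonneg z)]
    ring
  have hnt : ‖t • θ‖ = t := norm_smul_of_unit ht hθ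
  have hd : DifferentiableAt ℝ (fun s : ℝ => t * (√s)⁻¹ - 1) (‖t • θ‖ ^ 2) := by
    rw [hnt]
    have h1 : DifferentiableAt ℝ (fun s : ℝ => √s) (t ^ 2) :=
      (Real.hasDerivAt_sqrt (by positivity)).differentiableAt
    exact ((h1.fun_inv (by positivity)).const_mul t).sub_const 1
  rw [hF]
  -- The gradient of ρ(|z|²) is 2ρ'(|z|²) z; the other term of the product rule carries the factor ρ
  -- = 0.
  refine gam_self_of_pd_eq (c := 2 * deriv (fun s : ℝ => t * (√s)⁻¹ - 1) (‖t • θ‖ ^ 2)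
    * euler U (t • θ)) fun i => ?_
  obtain ⟨hρ, hpd⟩ := pd_comp_normSq hd.hasDerivAt i
  rw [pd_add (hw _) (hρ.fun_mul (he _)), pd_mul hρ (he _), hpd]
  have h0 : t * (√(‖t • θ‖ ^ 2))⁻¹ - 1 = 0 := by
    rw [Real.sqrt_sq (norm_nonneg _), hnt, mul_inv_cancel₀ ht.ne', sub_self]
  rw [h0]
  ring

/-! ### Derivatives along rays -/

theorem hasDerivAt_rpow_smul_ray {F : Type*} [NormedAddCommGroup F] [NormedSpace ℝ F]
    {f : Space n → F} (hf : Differentiable ℝ f) (c : ℝ) (θ : Space n) (ht : 0 < t) :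
    HasDerivAt (fun s : ℝ => s ^ c • f (s • θ))
      (t ^ (c - 1) • (euler f (t • θ) + c • f (t • θ))) t := by
  have h := (Real.hasDerivAt_rpow_const (x := t) (p := c) (Or.inl ht.ne')).fun_smul
    (hasDerivAt_ray (hf (t • θ)))
  refine h.congr_deriv ?_
  have hp : t ^ c = t ^ (c - 1) * t := by rw [← Real.rpow_add_one ht.ne', sub_add_cancel]
  rw [fderiv_ray f θ ht.ne', hp, smul_smul, mul_assoc, mul_inv_cancel₀ ht.ne', mul_one, smul_add,
    smul_smul, mul_comm c]

/-- Stated for vector values so as to cover both u^λ and its spherical gradient. -/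
theorem iteratedDeriv_ray {F : Type*} [NormedAddCommGroup F] [NormedSpace ℝ F] {c : ℝ}
    {g : ℕ → Space n → F} {J : ℕ} (hg : ∀ j < J, Differentiable ℝ (g j))
    (hstep : ∀ j < J, ∀ y, euler (g j) y + (c - j) • g j y = g (j + 1) y) {f : ℝ → F}
    (h0 : ∀ s > 0, f s = s ^ c • g 0 (s • θ)) (j : ℕ) (hj : j ≤ J) (ht : 0 < t) :
    iteratedDeriv j f t = t ^ (c - j) • g j (t • θ) := by
  induction j generalizing t with
  | zero => simpa using h0 t ht
  | succ j ih =>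
    have hev : iteratedDeriv j f =ᶠ[nhds t] fun s => s ^ (c - j) • g j (s • θ) := by
      filter_upwards [lt_mem_nhds ht] with s hs
      exact ih (Nat.le_of_succ_le hj) hs
    rw [iteratedDeriv_succ, hev.deriv_eq,
      (hasDerivAt_rpow_smul_ray (hg j hj) (c - j) θ ht).deriv, hstep j hj]
    congr 2
    push_cast
    ring

/-- The exponent c is left free because the last energy term lacks the factor t² that would make its
weight 2κ. -/
theorem rayDeriv_eq {p : ℝ} {Q : ℝ → Space n → ℝ} {q : Space n → ℝ} (hq : Differentiable ℝ q)
    (c : ℝ) (h : ∀ s > 0, s ^ (2 * kappa p) * Q s (x + s • θ) = s ^ c * q (s • θ)) (ht : 0 < t) :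
    rayDeriv p x Q t (x + t • θ) = t ^ (c - 1) * (euler q (t • θ) + c * q (t • θ)) := by
  have hev : (fun s : ℝ => s ^ (2 * kappa p) * Q s (x + (s / t) • (x + t • θ - x)))
      =ᶠ[nhds t] fun s => s ^ c • q (s • θ) := by
    filter_upwards [lt_mem_nhds ht] with s hs
    rw [add_sub_cancel_left, smul_smul, div_mul_cancel₀ _ ht.ne', h s hs, smul_eq_mul]
  rw [rayDeriv, hev.deriv_eq, (hasDerivAt_rpow_smul_ray hq c θ ht).deriv]
  simp

end OnSphere

/-! ### The energy in terms of the scaling derivatives -/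

theorem sphMean_add {f g : Space n → ℝ} (hf : Continuous f) (hg : Continuous g) (r : ℝ) :
    sphMean (fun y => f y + g y) r = sphMean f r + sphMean g r :=
  integral_add (integrable_sphMean hf r) (integrable_sphMean hg r)

theorem sphMean_const_mul (c : ℝ) (f : Space n → ℝ) (r : ℝ) :
    sphMean (fun y => c * f y) r = c * sphMean f r :=
  integral_const_mul c _

theorem sphereIntegral_eq_sphMean (hn : 1 ≤ n) {a : ℝ} {x : Space n} {t : ℝ} (ht : 0 < t)
    {f q : Space n → ℝ} (h : ∀ θ, ‖θ‖ = 1 → f (x + t • θ) = t ^ (a + 1 - n) * q (t • θ)) :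
    sphereIntegral x t f = t ^ a * sphMean q t := by
  rw [sphereIntegral, unitSphereIntegral_congr h]
  have h1 : unitSphereIntegral (fun θ => t ^ (a + 1 - n) * q (t • θ))
      = t ^ (a + 1 - n) * sphMean q t := integral_const_mul _ _
  rw [h1, ← mul_assoc, ← Real.rpow_natCast t (n - 1), ← Real.rpow_add ht, Nat.cast_sub hn]
  congr 2
  push_cast
  ring

theorem const_mul_sphereIntegral (c : ℝ) (x : Space n) (t : ℝ) (f : Space n → ℝ) :
    c * sphereIntegral x t f = sphereIntegral x t fun y => c * f y := by
  simp only [sphereIntegral, unitSphereIntegral]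
  rw [integral_const_mul]
  ring

theorem energy_exponent {p : ℝ} (hp : 1 < p) :
    6 * ((p + 1) / (p - 1)) - n = 2 * kappa p + 6 - n := by
  have : p - 1 ≠ 0 := by linarith
  rw [kappa]
  field_simp
  ring

theorem bulk_energy_eq {p : ℝ} {u : Space n → ℝ} (hp : 1 < p) (x : Space n)
    (hU : ContDiff ℝ 6 fun y => u (x + y)) (t : ℝ) :
    (∫ y in Metric.ball x t, 1 / 2 * ‖∇ (Δ u) y‖ ^ 2)
      - 1 / (p + 1) * ∫ y in Metric.ball x t, |u y| ^ (p + 1)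
    = ∫ y in Metric.ball 0 t, bulkDensity p (fun y => u (x + y)) y := by
  have hint : ∀ {g : Space n → ℝ}, Continuous g → IntegrableOn g (Metric.ball 0 t) := fun hg =>
    (hg.continuousOn.integrableOn_compact (isCompact_closedBall 0 t)).mono_set
      Metric.ball_subset_closedBall
  have hv : ContDiff ℝ 4 (Δ fun y => u (x + y)) := contDiff_laplacian hU (by norm_num)
  have hpd : ∀ i, Continuous (pd i (Δ fun y => u (x + y))) := fun i =>
    (contDiff_pd hv (m := 0) (by norm_num) i).continuous
  have h1 : Continuous fun y => 1 / 2 * ‖∇ (Δ fun y => u (x + y)) y‖ ^ 2 := by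
    simp_rw [norm_gradient_sq]
    fun_prop
  have h2 : Continuous fun y => 1 / (p + 1) * |u (x + y)| ^ (p + 1) :=
    continuous_const.mul (hU.continuous.abs.rpow_const fun y => Or.inr (by linarith))
  rw [setIntegral_ball_shift, setIntegral_ball_shift x t (fun y => |u y| ^ (p + 1)),
    ← integral_const_mul]
  simp_rw [gradient_shift, ← laplacian_shift]
  rw [← integral_sub (hint h1) (hint h2)]
  rfl

theorem energy_eq {p : ℝ} {u : Space n → ℝ} (hn : 1 ≤ n) (hp : 1 < p) (x : Space n)
    (hU : ContDiff ℝ 6 fun y => u (x + y)) {t : ℝ} (ht : 0 < t) :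
    energy p t x u
      = t ^ (2 * kappa p + 6 - n) * (∫ y in Metric.ball 0 t, bulkDensity p (fun y => u (x + y)) y)
        + t ^ (2 * kappa p) * sphMean (boundaryDensity p fun y => u (x + y)) t := by
  set U : Space n → ℝ := fun y => u (x + y) with hUdef
  have w0 : ContDiff ℝ 6 (ladder (kappa p) U 0) := contDiff_ladder_of_le _ 0 hU (by norm_num)
  have w1 : ContDiff ℝ 5 (ladder (kappa p) U 1) := contDiff_ladder_of_le _ 1 hU (by norm_num)
  have w2 : ContDiff ℝ 4 (ladder (kappa p) U 2) := contDiff_ladder_of_le _ 2 hU (by norm_num)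
  have w3 : ContDiff ℝ 3 (ladder (kappa p) U 3) := contDiff_ladder_of_le _ 3 hU (by norm_num)
  have w4 : ContDiff ℝ 2 (ladder (kappa p) U 4) := contDiff_ladder_of_le _ 4 hU (by norm_num)
  have s0 : ContDiff ℝ 4 (sph (ladder (kappa p) U 0)) := contDiff_sph w0 (by norm_num)
  have s1 : ContDiff ℝ 3 (sph (ladder (kappa p) U 1)) := contDiff_sph w1 (by norm_num)
  have l : ContDiff ℝ 4 (Δ U) := contDiff_laplacian hU (by norm_num)
  have v0 : ContDiff ℝ 2 (ladder (kappa p) U 0) := w0.of_le (by norm_num)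
  have v1 : ContDiff ℝ 2 (ladder (kappa p) U 1) := w1.of_le (by norm_num)
  have v2 : ContDiff ℝ 2 (ladder (kappa p) U 2) := w2.of_le (by norm_num)
  have g00 : ContDiff ℝ 1 (gam (ladder (kappa p) U 0) (ladder (kappa p) U 0)) :=
    contDiff_gam v0 v0 (by norm_num)
  have g01 : ContDiff ℝ 1 (gam (ladder (kappa p) U 0) (ladder (kappa p) U 1)) :=
    contDiff_gam v0 v1 (by norm_num)
  have g11 : ContDiff ℝ 1 (gam (ladder (kappa p) U 1) (ladder (kappa p) U 1)) :=
    contDiff_gam v1 v1 (by norm_num)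
  have g12 : ContDiff ℝ 1 (gam (ladder (kappa p) U 1) (ladder (kappa p) U 2)) :=
    contDiff_gam v1 v2 (by norm_num)
  have e5 : 2 * kappa p + 6 - n - 5 = 2 * kappa p + 1 - (n : ℝ) := by ring
  have t1 := fun θ (hθ : ‖θ‖ = 1) => T1_eq p x u ht hθ
  have t2 := fun θ (hθ : ‖θ‖ = 1) => T2_eq p hU ht hθ
  have t3 := fun θ (hθ : ‖θ‖ = 1) => T3_eq p hU ht hθ
  have t4 := fun θ (hθ : ‖θ‖ = 1) => T4_eq p hU ht hθ
  have ang := fun θ (hθ : ‖θ‖ = 1) {s : ℝ} (hs : 0 < s) => angularPart_eq (u := u) hU hs hθ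
  have tan0 : ∀ θ, ‖θ‖ = 1 → ∀ s > 0, s ^ 2 * tangentialSq x u (x + s • θ)
      = gam (ladder (kappa p) U 0) (ladder (kappa p) U 0) (s • θ) := by
    intro θ hθ s hs
    have := normSq_mul_tangentialSq x u (smul_ne_zero_of_unit hs hθ)
    rwa [norm_smul_of_unit hs hθ] at this
  have tan1 : ∀ θ, ‖θ‖ = 1 → ∀ s > 0, s ^ 2 * tangentialSq x (T1 p x u s) (x + s • θ)
      = gam (ladder (kappa p) U 1) (ladder (kappa p) U 1) (s • θ) := by
    intro θ hθ s hs
    have := normSq_mul_tangentialSq x (T1 p x u s) (smul_ne_zero_of_unit hs hθ)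
    rwa [norm_smul_of_unit hs hθ, gam_T1_eq p hU hs hθ] at this
  have q1 := sphereIntegral_eq_sphMean hn (a := 2 * kappa p) (x := x) ht
    (f := fun y => t ^ (2 * kappa p + 1 - (n : ℝ)) * (T4 p x u t y * T1 p x u t y))
    (q := fun y => ladder (kappa p) U 4 y * ladder (kappa p) U 1 y)
    fun θ hθ => by simp only [t4 θ hθ, t1 θ hθ, hUdef]
  have q2 := sphereIntegral_eq_sphMean hn (a := 2 * kappa p) (x := x) ht
    (f := fun y => t ^ (2 * kappa p + 1 - (n : ℝ)) * (T3 p x u t y * T2 p x u t y))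
    (q := fun y => ladder (kappa p) U 3 y * ladder (kappa p) U 2 y)
    fun θ hθ => by simp only [t3 θ hθ, t2 θ hθ, hUdef]
  have q3 := sphereIntegral_eq_sphMean hn (a := 2 * kappa p) (x := x) ht
    (f := fun y => t ^ (2 * kappa p + 1 - (n : ℝ)) * (T3 p x u t y * T1 p x u t y))
    (q := fun y => ladder (kappa p) U 3 y * ladder (kappa p) U 1 y)
    fun θ hθ => by simp only [t3 θ hθ, t1 θ hθ, hUdef]
  -- The exponent e - 1 exceeds e - 5 by 4, which supplies the two factors |y|² = t².
  have q4 := sphereIntegral_eq_sphMean hn (a := 2 * kappa p) (x := x) ht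
    (f := fun y => t ^ (2 * kappa p + 6 - n - 1) * ((Δ u) y ^ 2))
    (q := fun y => (‖y‖ ^ 2 * (Δ U) y) * (‖y‖ ^ 2 * (Δ U) y))
    fun θ hθ => by
      have hl : (Δ U) (t • θ) = (Δ u) (x + t • θ) := by rw [hUdef, laplacian_shift]
      rw [hl, norm_smul_of_unit ht hθ, show 2 * kappa p + 6 - n - 1
        = 2 * kappa p + 1 - (n : ℝ) + (4 : ℕ) by push_cast; ring, Real.rpow_add_natCast ht.ne']
      ring
  have q5 := sphereIntegral_eq_sphMean hn (a := 2 * kappa p) (x := x) ht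
    (f := fun y => t ^ (2 * kappa p + 1 - (n : ℝ)) * (T2 p x u t y * T1 p x u t y))
    (q := fun y => ladder (kappa p) U 2 y * ladder (kappa p) U 1 y)
    fun θ hθ => by simp only [t2 θ hθ, t1 θ hθ, hUdef]
  have q6 := sphereIntegral_eq_sphMean hn (a := 2 * kappa p) (x := x) ht
    (f := fun y => t ^ (2 * kappa p + 1 - (n : ℝ)) * T1 p x u t y ^ 2)
    (q := fun y => ladder (kappa p) U 1 y * ladder (kappa p) U 1 y)
    fun θ hθ => by simp only [t1 θ hθ, hUdef, sq]
  have q7 := sphereIntegral_eq_sphMean hn (a := 2 * kappa p) (x := x) ht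
    (f := fun y => t ^ (2 * kappa p + 1 - (n : ℝ)) * T2 p x u t y ^ 2)
    (q := fun y => ladder (kappa p) U 2 y * ladder (kappa p) U 2 y)
    fun θ hθ => by simp only [t2 θ hθ, hUdef, sq]
  have q8 := sphereIntegral_eq_sphMean hn (a := 2 * kappa p) (x := x) ht
    (f := fun y => t ^ (2 * kappa p + 1 - (n : ℝ)) * (T1 p x u t y * u y))
    (q := fun y => ladder (kappa p) U 1 y * ladder (kappa p) U 0 y)
    fun θ hθ => by simp only [t1 θ hθ, hUdef, ladder]
  have q9 := sphereIntegral_eq_sphMean hn (a := 2 * kappa p) (x := x) ht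
    (f := fun y => t ^ (2 * kappa p + 1 - (n : ℝ)) * u y ^ 2)
    (q := fun y => ladder (kappa p) U 0 y * ladder (kappa p) U 0 y)
    fun θ hθ => by simp only [hUdef, ladder, sq]
  have q10 := sphereIntegral_eq_sphMean hn (a := 2 * kappa p) (x := x) ht
    (f := fun y => t ^ (2 * kappa p + 1 - (n : ℝ)) * angularPart x u t y ^ 2)
    (q := fun y => sph (ladder (kappa p) U 0) y * sph (ladder (kappa p) U 0) y)
    fun θ hθ => by simp only [ang θ hθ ht, hUdef, ladder, sq]
  have q11 := sphereIntegral_eq_sphMean hn (a := 2 * kappa p) (x := x) ht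
    -- Applying 𝓔 + 2κ to the square gives twice the mixed product, which accounts for the
    -- coefficient 1 in `boundaryDensity` against 1/2 in the energy.
    (f := fun y => t ^ (2 - (n : ℝ)) * rayDeriv p x (fun t z => angularPart x u t z ^ 2) t y)
    (q := fun y => 2 * (sph (ladder (kappa p) U 0) y * sph (ladder (kappa p) U 1) y))
    fun θ hθ => by
      have hS := hasDil_sph_ladder 0 (w0.of_le (by norm_num))
      have hSS := hS.mul hS
      have h := rayDeriv_eq (p := p) (x := x) (θ := θ) (Q := fun t z => angularPart x u t z ^ 2)
        hSS.1 (2 * kappa p) (fun s hs => by simp only [ang θ hθ hs, hUdef, ladder, sq]) ht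
      have h2 := hSS.2 (t • θ)
      rw [← two_mul] at h2
      rw [h, h2, ← mul_assoc, ← Real.rpow_add ht]
      push_cast
      rw [show 2 - (n : ℝ) + (2 * kappa p - 1) = 2 * kappa p + 1 - n by ring]
      ring
  have q12 := sphereIntegral_eq_sphMean hn (a := 2 * kappa p) (x := x) ht
    (f := fun y => t ^ (2 * kappa p + 1 - (n : ℝ)) * (t ^ 2 * tangentialSq x u y))
    (q := gam (ladder (kappa p) U 0) (ladder (kappa p) U 0))
    fun θ hθ => by simp only [tan0 θ hθ t ht]
  have q13 := sphereIntegral_eq_sphMean hn (a := 2 * kappa p) (x := x) ht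
    (f := fun y => t ^ (2 - (n : ℝ))
      * rayDeriv p x (fun t z => t ^ 2 * tangentialSq x u z) t y)
    (q := fun y => 2 * gam (ladder (kappa p) U 0) (ladder (kappa p) U 1) y)
    fun θ hθ => by
      have hG := hasDil_gam_ladder 0 0 v0 v0
      have h := rayDeriv_eq (p := p) (x := x) (θ := θ)
        (Q := fun t z => t ^ 2 * tangentialSq x u z)
        hG.1 (2 * kappa p) (fun s hs => by simp only [tan0 θ hθ s hs]) ht
      have h2 := hG.2 (t • θ)
      rw [← two_mul] at h2
      rw [h, h2, ← mul_assoc, ← Real.rpow_add ht, gam_comm (ladder (kappa p) U (0 + 1))]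
      push_cast
      rw [show 2 - (n : ℝ) + (2 * kappa p - 1) = 2 * kappa p + 1 - n by ring]
      ring
  have q14 := sphereIntegral_eq_sphMean hn (a := 2 * kappa p) (x := x) ht
    (f := fun y => t ^ (2 * kappa p + 1 - (n : ℝ)) * (t ^ 2 * tangentialSq x (T1 p x u t) y))
    (q := gam (ladder (kappa p) U 1) (ladder (kappa p) U 1))
    fun θ hθ => by simp only [tan1 θ hθ t ht]
  -- Without the factor t² the weight is 2κ - 2. The shift by -2 cancels the multiple of `gam` w_1
  -- w_1 produced by the two first rungs and leaves 2 `gam` w_1 w_2.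
  have q15 := sphereIntegral_eq_sphMean hn (a := 2 * kappa p) (x := x) ht
    (f := fun y => t ^ (4 - (n : ℝ))
      * rayDeriv p x (fun t z => tangentialSq x (T1 p x u t) z) t y)
    (q := fun y => 2 * gam (ladder (kappa p) U 1) (ladder (kappa p) U 2) y)
    fun θ hθ => by
      have hG := hasDil_gam_ladder 1 1 v1 v1
      have h := rayDeriv_eq (p := p) (x := x) (θ := θ)
        (Q := fun t z => tangentialSq x (T1 p x u t) z)
        hG.1 (2 * kappa p - 2) (fun s hs => by
          rw [← tan1 θ hθ s hs, ← mul_assoc, ← Real.rpow_natCast s 2, ← Real.rpow_add hs]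
          push_cast
          rw [sub_add_cancel]) ht
      have h2 := hG.2 (t • θ)
      rw [gam_comm (ladder (kappa p) U (1 + 1))] at h2
      push_cast at h2
      rw [h, ← mul_assoc, ← Real.rpow_add ht,
        show 4 - (n : ℝ) + (2 * kappa p - 2 - 1) = 2 * kappa p + 1 - n by ring]
      congr 1
      linear_combination h2
  have hQ : sphMean (boundaryDensity p U) t
      = -1 * sphMean (fun y => ladder (kappa p) U 4 y * ladder (kappa p) U 1 y) t
      + 2 * sphMean (fun y => ladder (kappa p) U 3 y * ladder (kappa p) U 2 y) t
      + -(delta1 n p - 6) * sphMean (fun y => ladder (kappa p) U 3 y * ladder (kappa p) U 1 y) t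
      + 1 / 2 * (kappa p + 2) * sphMean (fun y => (‖y‖ ^ 2 * (Δ U) y) * (‖y‖ ^ 2 * (Δ U) y)) t
      + -(24 - 6 * delta1 n p + delta2 n p)
        * sphMean (fun y => ladder (kappa p) U 2 y * ladder (kappa p) U 1 y) t
      + -(9 * delta1 n p - 3 * delta2 n p - 36)
        * sphMean (fun y => ladder (kappa p) U 1 y * ladder (kappa p) U 1 y) t
      + (delta1 n p - 8) * sphMean (fun y => ladder (kappa p) U 2 y * ladder (kappa p) U 2 y) t
      + delta4 n p * sphMean (fun y => ladder (kappa p) U 1 y * ladder (kappa p) U 0 y) t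
      + 2 * delta4 n p * sphMean (fun y => ladder (kappa p) U 0 y * ladder (kappa p) U 0 y) t
      + 2 * sphMean (fun y => sph (ladder (kappa p) U 0) y * sph (ladder (kappa p) U 0) y) t
      + 1 * sphMean (fun y => sph (ladder (kappa p) U 0) y * sph (ladder (kappa p) U 1) y) t
      + -4 * (beta n p - n + 4) * sphMean (gam (ladder (kappa p) U 0) (ladder (kappa p) U 0)) t
      + -2 * (beta n p - n + 4) * sphMean (gam (ladder (kappa p) U 0) (ladder (kappa p) U 1)) t
      + -6 * sphMean (gam (ladder (kappa p) U 1) (ladder (kappa p) U 1)) t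
      + 2 * sphMean (gam (ladder (kappa p) U 1) (ladder (kappa p) U 2)) t := by
    have := w0.continuous
    have := w1.continuous
    have := w2.continuous
    have := w3.continuous
    have := w4.continuous
    have := s0.continuous
    have := s1.continuous
    have := l.continuous
    have := g00.continuous
    have := g01.continuous
    have := g11.continuous
    have := g12.continuous
    unfold boundaryDensity
    rw [sphMean_add, sphMean_add, sphMean_add, sphMean_add, sphMean_add, sphMean_add, sphMean_add,
      sphMean_add, sphMean_add, sphMean_add, sphMean_add, sphMean_add, sphMean_add, sphMean_add]
    · simp only [sphMean_const_mul]
    all_goals fun_prop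
  rw [sphMean_const_mul] at q11 q13 q15
  rw [← const_mul_sphereIntegral] at q4
  have hb := bulk_energy_eq hp x hU t
  simp only [energy, energy_exponent hp, e5]
  rw [hb, mul_assoc (1 / 2 * (kappa p + 2)), q1, q2, q3, q4, q5, q6, q7,
    q8, q9, q10, q11, q12, q13, q14, q15, hQ]
  ring

/-! ### The angular gradient and divergence of the rescaled function -/

/-- The spherical gradient `|y|² ∇g - (y · ∇g) y`. -/
def tanField (g : Space n → ℝ) (y : Space n) : Space n := WithLp.toLp 2 fun i => tanComp g i y

theorem tanField_apply (g : Space n → ℝ) (y : Space n) (i : Fin n) :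
    tanField g y i = tanComp g i y := rfl

theorem differentiable_tanField {g : Space n → ℝ} (hg : ContDiff ℝ 2 g) :
    Differentiable ℝ (tanField g) :=
  differentiable_euclidean.2 fun i =>
    (contDiff_tanComp hg (m := 1) (by norm_num) i).differentiable (by norm_num)

/-- The field T = |y|² ∇g - (𝓔g) y is orthogonal to y, so |T|² = |y|² ∇g · T. -/
theorem norm_tanField_sq (g : Space n → ℝ) (y : Space n) :
    ‖tanField g y‖ ^ 2 = ‖y‖ ^ 2 * gam g g y := by
  have h : ∀ i, tanComp g i y * tanComp g i y
      = ‖y‖ ^ 2 * (pd i g y * tanComp g i y) - euler g y * (y i * tanComp g i y) := fun i => by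
    rw [tanComp]
    ring
  rw [← sum_sq_eq_normSq]
  simp_rw [tanField_apply, h, Finset.sum_sub_distrib, ← Finset.mul_sum, sum_mul_tanComp,
    sum_coord_mul_tanComp, mul_zero, sub_zero]

theorem fderiv_coord {X : Space n → Space n} {y : Space n} (hX : DifferentiableAt ℝ X y)
    (v : Space n) (i : Fin n) : (fderiv ℝ X y v) i = fderiv ℝ (fun z => X z i) y v := by
  have h : HasFDerivAt (fun z => X z i)
      ((EuclideanSpace.proj i : Space n →L[ℝ] ℝ).comp (fderiv ℝ X y)) y :=
    (EuclideanSpace.proj i : Space n →L[ℝ] ℝ).hasFDerivAt.comp y hX.hasFDerivAt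
  rw [h.fderiv]
  rfl

/-- The coefficients are quadratic in y and one derivative is taken, so the operator has degree one.
Hence the extra summand, and the weight c - 1 instead of c in `euler_tanField_ladder`. -/
theorem euler_tanComp {g : Space n → ℝ} (hg : ContDiff ℝ 2 g) (i : Fin n) (y : Space n) :
    euler (tanComp g i) y = tanComp (euler g) i y + tanComp g i y := by
  have hpd : Differentiable ℝ (pd i g) :=
    (contDiff_pd hg (m := 1) (by norm_num) i).differentiable (by norm_num)
  have he : Differentiable ℝ (euler g) :=
    (contDiff_euler hg (m := 1) (by norm_num)).differentiable (by norm_num)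
  have hc : euler (fun z : Space n => z i) y = y i := by
    rw [euler_eq_sum]
    simp [pd_coord]
  have e : tanComp g i = fun y => ‖y‖ ^ 2 * pd i g y - euler g y * y i := rfl
  rw [e, euler_sub ((differentiable_normSq y).fun_mul (hpd y))
    ((he y).fun_mul (differentiable_coord i y)), euler_mul (differentiable_normSq y) (hpd y),
    euler_mul (he y) (differentiable_coord i y), euler_normSq, hc, tanComp, pd_euler hg]
  ring

theorem euler_tanField {g : Space n → ℝ} (hg : ContDiff ℝ 2 g) (y : Space n) :
    euler (tanField g) y = tanField (euler g) y + tanField g y := by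
  ext i
  rw [euler, fderiv_coord (differentiable_tanField hg y)]
  exact euler_tanComp hg i y

theorem euler_tanField_ladder {c : ℝ} {f : Space n → ℝ} (j : ℕ)
    (hf : ContDiff ℝ 2 (ladder c f j)) (y : Space n) :
    euler (tanField (ladder c f j)) y + (c - 1 - j) • tanField (ladder c f j) y
      = tanField (ladder c f (j + 1)) y := by
  have hd := hf.differentiable (by norm_num)
  have he : Differentiable ℝ (euler (ladder c f j)) :=
    (contDiff_euler hf (m := 1) (by norm_num)).differentiable (by norm_num)
  rw [euler_tanField hf]
  ext i
  simp only [PiLp.add_apply, PiLp.smul_apply, tanField_apply, smul_eq_mul, tanComp]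
  rw [ladder, pd_add (he y) ((hd y).const_mul _), pd_const_mul (hd y),
    euler_add (he y) ((hd y).const_mul _), euler_const_mul (hd y)]
  ring

/-- At a unit vector the derivative of y ↦ y/|y| is the orthogonal projection onto the tangent space
of the sphere. -/
theorem hasFDerivAt_normalize {θ : Space n} (hθ : ‖θ‖ = 1) :
    HasFDerivAt (fun y : Space n => ‖y‖⁻¹ • y)
      (ContinuousLinearMap.id ℝ (Space n) - (innerSL ℝ θ).smulRight θ) θ := by
  have h1 : HasFDerivAt (fun y : Space n => √(‖y‖ ^ 2)) _ θ :=
    ((hasStrictFDerivAt_norm_sq θ).hasFDerivAt).sqrt (by simp [hθ])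
  have h2 : HasFDerivAt (fun y : Space n => (√(‖y‖ ^ 2))⁻¹) _ θ :=
    (hasDerivAt_inv (by simp [hθ])).comp_hasFDerivAt θ h1
  have h3 := h2.fun_smul (hasFDerivAt_id θ)
  simp only [Real.sqrt_sq (norm_nonneg _), hθ] at h3
  refine h3.congr_fderiv ?_
  ext v
  simp
  ring

section Ray

variable {p : ℝ} {x : Space n} {u : Space n → ℝ} {t : ℝ} {θ : Space n}

/-- The chain rule gives t^(κ+1) times the tangential part of ∇U at tθ, whereas `tanField` carries a
factor t²; hence the exponent κ - 1. -/
theorem angularGradient_rescale (hU : ContDiff ℝ 6 fun y => u (x + y)) (ht : 0 < t)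
    (hθ : ‖θ‖ = 1) :
    angularGradient (rescale p x u t) θ
      = t ^ (kappa p - 1) • tanField (fun y => u (x + y)) (t • θ) := by
  set U : Space n → ℝ := fun y => u (x + y) with hUdef
  have hd : Differentiable ℝ U := hU.differentiable (by norm_num)
  have h1 := ((hasFDerivAt_normalize hθ).const_smul t)
  have hpt : t • (‖θ‖⁻¹ • θ) = t • θ := by simp [hθ]
  have h2 : HasFDerivAt (fun y : Space n => t ^ kappa p * U (t • (‖y‖⁻¹ • y))) _ θ :=
    ((hpt ▸ (hd (t • θ)).hasFDerivAt :
      HasFDerivAt U (fderiv ℝ U (t • θ)) (t • (‖θ‖⁻¹ • θ))).comp θ h1).const_mul (t ^ kappa p)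
  have h3 : rayExtension (rescale p x u t) = fun y : Space n => t ^ kappa p * U (t • (‖y‖⁻¹ • y)) :=
    rfl
  have hp : t ^ kappa p = t ^ (kappa p - 1) * t := by
    rw [← Real.rpow_add_one ht.ne', sub_add_cancel]
  ext i
  rw [angularGradient, gradient_apply, h3, pd, h2.fderiv]
  simp only [PiLp.smul_apply, tanField_apply, tanComp, norm_smul_of_unit ht hθ, smul_eq_mul]
  have hθi : inner ℝ θ (EuclideanSpace.single i (1 : ℝ)) = θ i := by
    simp [EuclideanSpace.inner_single_right]
  have he : euler U (t • θ) = t * fderiv ℝ U (t • θ) θ := by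
    rw [euler, map_smul, smul_eq_mul]
  simp [hθi, map_smul, he, hp]
  rw [pd]
  ring

/-- Extending along rays composes the derivative of `tanField` with the tangential projection. The
trace is the full divergence, which is `sph`, minus the normal entry ⟨θ, D(`tanField`)θ⟩, which
vanishes. -/
theorem angularDiv_rescale (hU : ContDiff ℝ 6 fun y => u (x + y)) (ht : 0 < t)
    (hθ : ‖θ‖ = 1) :
    angularDiv (angularGradient (rescale p x u t)) θ
      = t ^ kappa p * sph (fun y => u (x + y)) (t • θ) := by
  set U : Space n → ℝ := fun y => u (x + y) with hUdef
  have hU2 : ContDiff ℝ 2 U := hU.of_le (by norm_num)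
  have hd := differentiable_tanField hU2
  have hev : rayExtension (angularGradient (rescale p x u t))
      =ᶠ[nhds θ] fun y => t ^ (kappa p - 1) • tanField U (t • (‖y‖⁻¹ • y)) := by
    have hθ0 : θ ≠ 0 := by
      rw [← norm_ne_zero_iff, hθ]
      norm_num
    filter_upwards [isOpen_ne.mem_nhds hθ0] with y hy
    rw [rayExtension]
    refine angularGradient_rescale hU ht ?_
    rw [norm_smul, norm_inv, norm_norm, inv_mul_cancel₀ (norm_ne_zero_iff.2 hy)]
  have h1 := ((hasFDerivAt_normalize hθ).const_smul t)
  have hpt : t • (‖θ‖⁻¹ • θ) = t • θ := by simp [hθ]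
  have h2 : HasFDerivAt (fun y : Space n => t ^ (kappa p - 1) • tanField U (t • (‖y‖⁻¹ • y))) _ θ :=
    ((hpt ▸ (hd (t • θ)).hasFDerivAt :
      HasFDerivAt (tanField U) (fderiv ℝ (tanField U) (t • θ)) (t • (‖θ‖⁻¹ • θ))).comp θ
        h1).const_smul (t ^ (kappa p - 1))
  have hp : t ^ kappa p = t ^ (kappa p - 1) * t := by
    rw [← Real.rpow_add_one ht.ne', sub_add_cancel]
  rw [angularDiv, hev.fderiv_eq, h2.fderiv,
    LinearMap.trace_eq_sum_inner _ (EuclideanSpace.basisFun (Fin n) ℝ)]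
  -- The radial derivative of the field is a multiple of `tanField` (𝓔U) + `tanField` U, again
  -- orthogonal to θ.
  have hrad : ∑ i, θ i * (fderiv ℝ (tanField U) (t • θ) θ) i = 0 := by
    have h3 : fderiv ℝ (tanField U) (t • θ) θ = t⁻¹ • euler (tanField U) (t • θ) :=
      fderiv_ray _ θ ht.ne'
    have h4 : ∀ g : Space n → ℝ, ∑ i, θ i * tanComp g i (t • θ) = 0 := by
      intro g
      have h5 := sum_coord_mul_tanComp g (t • θ)
      simp only [PiLp.smul_apply, smul_eq_mul, mul_assoc, ← Finset.mul_sum] at h5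
      exact (mul_eq_zero.1 h5).resolve_left ht.ne'
    rw [h3, euler_tanField hU2]
    simp only [PiLp.smul_apply, PiLp.add_apply, tanField_apply, smul_eq_mul, mul_add, mul_left_comm,
      Finset.sum_add_distrib, ← Finset.mul_sum, h4, mul_zero, add_zero]
  have hterm : ∀ i, inner ℝ (EuclideanSpace.basisFun (Fin n) ℝ i)
      ((t ^ (kappa p - 1) • (fderiv ℝ (tanField U) (t • θ)).comp
        (t • (ContinuousLinearMap.id ℝ (Space n) - (innerSL ℝ θ).smulRight θ)))
          (EuclideanSpace.basisFun (Fin n) ℝ i))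
      = t ^ kappa p * (pd i (tanComp U i) (t • θ)
        - θ i * (fderiv ℝ (tanField U) (t • θ) θ) i) := by
    intro i
    have hθi : inner ℝ θ (EuclideanSpace.single i (1 : ℝ)) = θ i := by
      simp [EuclideanSpace.inner_single_right]
    have h6 : (fderiv ℝ (tanField U) (t • θ) (EuclideanSpace.single i 1)) i
        = pd i (tanComp U i) (t • θ) := fderiv_coord (hd _) _ i
    rw [EuclideanSpace.basisFun_apply, EuclideanSpace.inner_single_left, ← h6, hp]
    simp [hθi, map_smul]
    ring
  refine (Finset.sum_congr rfl fun i _ => hterm i).trans ?_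
  rw [← Finset.mul_sum, Finset.sum_sub_distrib, hrad, sub_zero, ← dvg_tanComp hU2]
  rfl

theorem pd_comp_smul {f : Space n → ℝ} (hf : Differentiable ℝ f) (c t : ℝ) (i : Fin n) :
    pd i (fun y => c * f (t • y)) = fun y => c * t * pd i f (t • y) := by
  funext y
  have h : HasFDerivAt (fun y : Space n => c * f (t • y)) _ y :=
    ((hf (t • y)).hasFDerivAt.comp y ((hasFDerivAt_id y).const_smul t)).const_mul c
  rw [pd, h.fderiv]
  simp [pd, mul_assoc]

theorem laplacian_rescale (hU : ContDiff ℝ 6 fun y => u (x + y)) (ht : 0 < t) (y : Space n) :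
    (Δ (rescale p x u t)) y = t ^ (kappa p + 2) * (Δ fun y => u (x + y)) (t • y) := by
  set U : Space n → ℝ := fun y => u (x + y) with hUdef
  have hU2 : ContDiff ℝ 2 U := hU.of_le (by norm_num)
  have hr : rescale p x u t = fun y => t ^ kappa p * U (t • y) := rfl
  have hr2 : ContDiff ℝ 2 fun y : Space n => t ^ kappa p * U (t • y) :=
    contDiff_const.mul (hU2.comp (contDiff_const_smul t))
  rw [hr, laplacian_eq_sum hr2, laplacian_eq_sum hU2, Finset.mul_sum]
  refine Finset.sum_congr rfl fun i _ => ?_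
  rw [pd_comp_smul (hU2.differentiable (by norm_num)), pd_comp_smul
    ((contDiff_pd hU2 (m := 1) (by norm_num) i).differentiable (by norm_num)),
    Real.rpow_add ht, Real.rpow_two]
  ring

/-! ### The scaling derivatives of the rescaled function -/

theorem iteratedDeriv_rescale (hU : ContDiff ℝ 6 fun y => u (x + y)) (j : ℕ) (hj : j ≤ 3)
    (ht : 0 < t) :
    iteratedDeriv j (fun s => rescale p x u s θ) t
      = t ^ (kappa p - j) * ladder (kappa p) (fun y => u (x + y)) j (t • θ) :=
  iteratedDeriv_ray (c := kappa p) (g := ladder (kappa p) fun y => u (x + y)) (J := 3)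
    (fun i hi => by
      refine (contDiff_ladder_of_le (kappa p) (m := 1) i hU ?_).differentiable (by norm_num)
      interval_cases i <;> norm_num)
    (fun i _ y => rfl) (fun s _ => rfl) j hj ht

theorem iteratedDeriv_angularGradient_rescale (hU : ContDiff ℝ 6 fun y => u (x + y)) (j : ℕ)
    (hj : j ≤ 2) (ht : 0 < t) (hθ : ‖θ‖ = 1) :
    iteratedDeriv j (fun s => angularGradient (rescale p x u s) θ) t
      = t ^ (kappa p - 1 - j) • tanField (ladder (kappa p) (fun y => u (x + y)) j) (t • θ) := by
  have hc : ∀ i < 2, ContDiff ℝ 2 (ladder (kappa p) (fun y => u (x + y)) i) := by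
    intro i hi
    refine contDiff_ladder_of_le (kappa p) (m := 2) i hU ?_
    interval_cases i <;> norm_num
  exact iteratedDeriv_ray (c := kappa p - 1)
    (g := fun i => tanField (ladder (kappa p) (fun y => u (x + y)) i)) (J := 2)
    (fun i hi => differentiable_tanField (hc i hi))
    (fun i hi y => euler_tanField_ladder i (hc i hi) y)
    (fun s hs => angularGradient_rescale hU hs hθ) j hj ht

theorem deriv_angularDiv_rescale (hU : ContDiff ℝ 6 fun y => u (x + y)) (ht : 0 < t)
    (hθ : ‖θ‖ = 1) :
    deriv (fun s => angularDiv (angularGradient (rescale p x u s)) θ) t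
      = t ^ (kappa p - 1) * sph (ladder (kappa p) (fun y => u (x + y)) 1) (t • θ) := by
  have hS := hasDil_sph_ladder (c := kappa p) (f := fun y => u (x + y)) 0
    (hU.of_le (by norm_num))
  have hev : (fun s => angularDiv (angularGradient (rescale p x u s)) θ)
      =ᶠ[nhds t] fun s => s ^ kappa p
        • sph (ladder (kappa p) (fun y => u (x + y)) 0) (s • θ) := by
    filter_upwards [lt_mem_nhds ht] with s hs
    exact angularDiv_rescale hU hs hθ
  rw [hev.deriv_eq, (hasDerivAt_rpow_smul_ray hS.1 (kappa p) θ ht).deriv, smul_eq_mul, smul_eq_mul,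
    hS.2]
  simp

theorem deriv_laplacian_rescale (hU : ContDiff ℝ 6 fun y => u (x + y)) (ht : 0 < t) :
    deriv (fun s => (Δ (rescale p x u s)) θ) t
      = t ^ (kappa p + 1) * (Δ (ladder (kappa p) (fun y => u (x + y)) 1)) (t • θ) := by
  have hd : Differentiable ℝ (Δ fun y => u (x + y)) :=
    (contDiff_laplacian hU (m := 4) (by norm_num)).differentiable (by norm_num)
  have hev : (fun s => (Δ (rescale p x u s)) θ)
      =ᶠ[nhds t] fun s => s ^ (kappa p + 2) • (Δ fun y => u (x + y)) (s • θ) := by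
    filter_upwards [lt_mem_nhds ht] with s hs
    exact laplacian_rescale hU hs θ
  rw [hev.deriv_eq, (hasDerivAt_rpow_smul_ray hd (kappa p + 2) θ ht).deriv, smul_eq_mul,
    smul_eq_mul, laplacian_ladder_one _ (hU.of_le (by norm_num)),
    show kappa p + 2 - 1 = kappa p + 1 by ring]

end Ray

theorem pow_mul_rpow_sq {t : ℝ} (ht : 0 < t) (m : ℕ) {a b : ℝ} (h : 2 * a + m = b) :
    t ^ m * (t ^ a) ^ 2 = t ^ b := by
  rw [← h, Real.rpow_add ht, Real.rpow_natCast, mul_comm 2 a, Real.rpow_mul ht.le, Real.rpow_two]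
  ring

/-- The right-hand side of the monotonicity formula as a single mean over the sphere. -/
theorem sphMean_dissipation {p : ℝ} {x : Space n} {u : Space n → ℝ}
    (hU : ContDiff ℝ 6 fun y => u (x + y)) {t : ℝ} (ht : 0 < t) :
    t ^ (2 * kappa p - 1) * sphMean (dissipation p fun y => u (x + y)) t
    = unitSphereIntegral (fun θ =>
          2 * t ^ 5 * (iteratedDeriv 3 (fun s => rescale p x u s θ) t) ^ 2
          + (10 * delta1 n p - 2 * delta2 n p - 56) * t ^ 3
            * (iteratedDeriv 2 (fun s => rescale p x u s θ) t) ^ 2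
          + (-18 * delta1 n p + 6 * delta2 n p - 4 * delta3 n p + 2 * delta4 n p + 72) * t
            * (deriv (fun s => rescale p x u s θ) t) ^ 2)
        + unitSphereIntegral (fun θ =>
          4 * t ^ 3 * ‖iteratedDeriv 2 (fun s => angularGradient (rescale p x u s) θ) t‖ ^ 2
          + (8 * alpha n p - 4 * beta n p + 4 * n - 28) * t
            * ‖deriv (fun s => angularGradient (rescale p x u s) θ) t‖ ^ 2)
        + 2 * t * unitSphereIntegral (fun θ =>
            (deriv (fun s => angularDiv (angularGradient (rescale p x u s)) θ) t) ^ 2)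
        + t * unitSphereIntegral (fun θ => (deriv (fun s => (Δ (rescale p x u s)) θ) t) ^ 2) := by
  set U : Space n → ℝ := fun y => u (x + y) with hUdef
  have w1 : ContDiff ℝ 5 (ladder (kappa p) U 1) := contDiff_ladder_of_le _ 1 hU (by norm_num)
  have w2 : ContDiff ℝ 4 (ladder (kappa p) U 2) := contDiff_ladder_of_le _ 2 hU (by norm_num)
  have w3 : ContDiff ℝ 3 (ladder (kappa p) U 3) := contDiff_ladder_of_le _ 3 hU (by norm_num)
  have c1 := w1.continuous
  have c2 := w2.continuous
  have c3 := w3.continuous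
  have s1 := (contDiff_sph w1 (m := 3) (by norm_num)).continuous
  have l1 := (contDiff_laplacian w1 (m := 3) (by norm_num)).continuous
  have g11 := (contDiff_gam w1 w1 (m := 1) (by norm_num)).continuous
  have g22 := (contDiff_gam w2 w2 (m := 1) (by norm_num)).continuous
  have hsplit : dissipation p U = fun y =>
      (((2 * ladder (kappa p) U 3 y ^ 2
        + (10 * delta1 n p - 2 * delta2 n p - 56) * ladder (kappa p) U 2 y ^ 2
        + (-18 * delta1 n p + 6 * delta2 n p - 4 * delta3 n p + 2 * delta4 n p + 72)
          * ladder (kappa p) U 1 y ^ 2)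
      + (4 * gam (ladder (kappa p) U 2) (ladder (kappa p) U 2) y
        + (8 * alpha n p - 4 * beta n p + 4 * n - 28)
          * gam (ladder (kappa p) U 1) (ladder (kappa p) U 1) y))
      + 2 * sph (ladder (kappa p) U 1) y ^ 2)
      + (‖y‖ ^ 2 * (Δ (ladder (kappa p) U 1)) y) ^ 2 := by
    funext y
    rw [dissipation]
    ring
  -- The powers of t in each term collapse to t^(2κ-1). For the gradients, |`tanField`|² supplies an
  -- extra t²; for the Laplacian term, the t⁴ left over is the factor |y|⁴ in `dissipation`.
  have p5 := pow_mul_rpow_sq ht 5 (a := kappa p - (3 : ℕ)) (b := 2 * kappa p - 1)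
    (by push_cast; ring)
  have p3 := pow_mul_rpow_sq ht 3 (a := kappa p - (2 : ℕ)) (b := 2 * kappa p - 1)
    (by push_cast; ring)
  have p1 := pow_mul_rpow_sq ht 1 (a := kappa p - (1 : ℕ)) (b := 2 * kappa p - 1)
    (by push_cast; ring)
  have p5' := pow_mul_rpow_sq ht 5 (a := kappa p - 1 - (2 : ℕ)) (b := 2 * kappa p - 1)
    (by push_cast; ring)
  have p3' := pow_mul_rpow_sq ht 3 (a := kappa p - 1 - (1 : ℕ)) (b := 2 * kappa p - 1)
    (by push_cast; ring)
  have p1' := pow_mul_rpow_sq ht 1 (a := kappa p - 1) (b := 2 * kappa p - 1)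
    (by push_cast; ring)
  have p1'' := pow_mul_rpow_sq ht 1 (a := kappa p + 1) (b := 2 * kappa p - 1 + (4 : ℕ))
    (by push_cast; ring)
  rw [Real.rpow_add_natCast ht.ne'] at p1''
  rw [hsplit, sphMean_add (by fun_prop) (by fun_prop), sphMean_add (by fun_prop) (by fun_prop),
    sphMean_add (by fun_prop) (by fun_prop), sphMean_const_mul, mul_add, mul_add, mul_add]
  congr 1
  · congr 1
    · congr 1
      · rw [← sphMean_const_mul]
        refine unitSphereIntegral_congr fun θ hθ => ?_
        rw [← iteratedDeriv_one, iteratedDeriv_rescale hU 3 le_rfl ht,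
          iteratedDeriv_rescale hU 2 (by norm_num) ht, iteratedDeriv_rescale hU 1 (by norm_num) ht]
        linear_combination
          (-2 * ladder (kappa p) U 3 (t • θ) ^ 2) * p5
          - ((10 * delta1 n p - 2 * delta2 n p - 56) * ladder (kappa p) U 2 (t • θ) ^ 2) * p3
          - ((-18 * delta1 n p + 6 * delta2 n p - 4 * delta3 n p + 2 * delta4 n p + 72)
            * ladder (kappa p) U 1 (t • θ) ^ 2) * p1
      · rw [← sphMean_const_mul]
        refine unitSphereIntegral_congr fun θ hθ => ?_
        rw [← iteratedDeriv_one, iteratedDeriv_angularGradient_rescale hU 2 le_rfl ht hθ,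
          iteratedDeriv_angularGradient_rescale hU 1 (by norm_num) ht hθ, norm_smul, norm_smul,
          mul_pow, mul_pow, norm_tanField_sq, norm_tanField_sq, norm_smul_of_unit ht hθ,
          Real.norm_eq_abs, sq_abs, Real.norm_eq_abs, sq_abs]
        linear_combination
          (-4 * gam (ladder (kappa p) U 2) (ladder (kappa p) U 2) (t • θ)) * p5'
          - ((8 * alpha n p - 4 * beta n p + 4 * n - 28)
            * gam (ladder (kappa p) U 1) (ladder (kappa p) U 1) (t • θ)) * p3'
    · rw [← mul_assoc, ← sphMean_const_mul]
      simp only [unitSphereIntegral, sphMean]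
      rw [← integral_const_mul]
      refine unitSphereIntegral_congr (f := fun θ => t ^ (2 * kappa p - 1) * 2
        * sph (ladder (kappa p) U 1) (t • θ) ^ 2) (g := fun θ => 2 * t
        * deriv (fun s => angularDiv (angularGradient (rescale p x u s)) θ) t ^ 2)
        fun θ hθ => ?_
      simp only [deriv_angularDiv_rescale hU ht hθ]
      linear_combination (-2 * sph (ladder (kappa p) U 1) (t • θ) ^ 2) * p1'
  · rw [← sphMean_const_mul]
    simp only [unitSphereIntegral, sphMean]
    rw [← integral_const_mul]
    refine unitSphereIntegral_congr (f := fun θ => t ^ (2 * kappa p - 1)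
      * (‖t • θ‖ ^ 2 * (Δ (ladder (kappa p) U 1)) (t • θ)) ^ 2) (g := fun θ => t
      * deriv (fun s => (Δ (rescale p x u s)) θ) t ^ 2) fun θ hθ => ?_
    simp only [deriv_laplacian_rescale hU ht, norm_smul_of_unit ht hθ]
    linear_combination (-(Δ (ladder (kappa p) U 1)) (t • θ) ^ 2) * p1''

end Triharmonic

end

/-! ### The monotonicity formula -/

theorem theorem2p1 (n : ℕ) (hn : 1 ≤ n) (p : ℝ) (hp : 1 < p)
    (u : Triharmonic.Space n → ℝ) (hu : Triharmonic.IsSolution p u)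
    (x : Triharmonic.Space n) (lam : ℝ) (hlam : 0 < lam) :
    HasDerivAt (fun t : ℝ => Triharmonic.energy p t x u)
      (Triharmonic.unitSphereIntegral (fun θ =>
          2 * lam ^ 5 * (iteratedDeriv 3 (fun t => Triharmonic.rescale p x u t θ) lam) ^ 2
          + (10 * Triharmonic.delta1 n p - 2 * Triharmonic.delta2 n p - 56) * lam ^ 3
            * (iteratedDeriv 2 (fun t => Triharmonic.rescale p x u t θ) lam) ^ 2
          + (-18 * Triharmonic.delta1 n p + 6 * Triharmonic.delta2 n p
              - 4 * Triharmonic.delta3 n p + 2 * Triharmonic.delta4 n p + 72) * lam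
            * (deriv (fun t => Triharmonic.rescale p x u t θ) lam) ^ 2)
        + Triharmonic.unitSphereIntegral (fun θ =>
          4 * lam ^ 3 * ‖iteratedDeriv 2
            (fun t => Triharmonic.angularGradient (Triharmonic.rescale p x u t) θ) lam‖ ^ 2
          + (8 * Triharmonic.alpha n p - 4 * Triharmonic.beta n p + 4 * n - 28) * lam
            * ‖deriv
              (fun t => Triharmonic.angularGradient (Triharmonic.rescale p x u t) θ) lam‖ ^ 2)
        + 2 * lam * Triharmonic.unitSphereIntegral (fun θ =>
            (deriv (fun t => Triharmonic.angularDiv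
              (Triharmonic.angularGradient (Triharmonic.rescale p x u t)) θ) lam) ^ 2)
        + lam * Triharmonic.unitSphereIntegral (fun θ =>
            (deriv (fun t => (Δ (Triharmonic.rescale p x u t)) θ) lam) ^ 2))
      lam := by
  obtain ⟨hU, heq⟩ := hu.shift x
  have hQ := Triharmonic.contDiff_boundaryDensity (p := p) hU
  have h := (Triharmonic.hasDerivAt_bulk hn hp hU heq hlam).fun_add
    (Triharmonic.hasDerivAt_rpow_mul_sphMean hQ (2 * Triharmonic.kappa p) hlam)
  -- Both derivatives carry the factor λ^(2κ-1), so the balance applies to their sum.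
  rw [← mul_add, Triharmonic.sphMean_balance hn hU hlam,
    Triharmonic.sphMean_dissipation hU hlam] at h
  -- The two-term form of the energy is available only for positive radii, which is enough near λ.
  refine h.congr_of_eventuallyEq ?_
  filter_upwards [lt_mem_nhds hlam] with t ht
  exact Triharmonic.energy_eq hn hp x hU ht
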